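/- **Theorem 1.5 (short variation estimates).** Let $G$ be a locally compact group with a metric $d$ (which need not induce the topology of $G$), and put $B(h,r)=\{g\in G: d(g,h)\le r\}$. Let $m$ be a measure on a $\sigma$-algebra containing the $d$-open sets, finite on all balls $B(h,r)$ and on all compact subsets of $G$. Let $r_0>0$, $\epsilon\in(0,1]$ and $D_0>0$, and assume: * (annular decay) there is $K>0$ such that $m(B(h,r+s))-m(B(h,r))\le K(s/r)^{\epsilon}\,m(B(h,r))$ for all $h\in G$, $r>r_0$ and $0<s\le r$; * (geometric doubling) for every $0<r\le 4r_0$, every ball $B(h,r)$ is covered by at most $D_0$ balls of radius $r/2$. Let $A'_rf(h)=\frac1{m(B(h,r))}\int_{B(h,r)}f\,dm$ (read as $0$ if $m(B(h,r))=0$). Fix $0<c_0<C_0<\infty$ and $\delta>1$ with $18C_0\delta^{-1}\le c_0$, and let $n_{r_0}$ be the unique integer with $\delta^{n_{r_0}}<r_0\le\delta^{n_{r_0}+1}$. For $I\subseteq(0,\infty)$ let $V_2(a_r:r\in I)=\sup\big(\sum_{j=0}^{J-1}|a_{r_{j+1}}-a_{r_j}|^2\big)^{1/2}$, the supremum being over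 all finite sequences $r_0'<r_1'<\dots<r_J'$ in $I$ (with $r_j'$ in place of $r_j$ in the sum). Define $$SV(f)=\Big(\sum_{n\ge n_{r_0}}V_2\big(A'_rf:r\in[\delta^n,\delta^{n+1})\big)^2\Big)^{1/2},\qquad SV_{\ge r_0}(f)=\Big(\sum_{n\ge n_{r_0}}V_2\big(A'_rf:r\in[\delta^n,\delta^{n+1}),\ r\ge r_0\big)^2\Big)^{1/2}.$$ A *system of dyadic cubes* with parameters $c_0,C_0,\delta$ consists of, for each $k\in\mathbb Z$, points $z^k_\alpha$ ($\alpha\in I_k$) with $d(z^k_\alpha,z^k_\beta)\ge c_0\delta^k$ for $\alpha\ne\beta$ and such that every $x\in G$ satisfies $d(x,z^k_\alpha)<C_0\delta^k$ for some $\alpha$, and measurable sets $Q^k_\alpha$ such that: (a) $\bigcup_\alpha Q^k_\alpha=G$; (b) for $k\le l$, either $Q^k_\alpha\subseteq Q^l_\beta$ or $Q^k_\alpha\cap Q^l_\beta=\emptyset$; (c) for $k<n$ and each $\alpha$ there is a unique $\beta$ with $Q^k_\alpha\subseteq Q^n_\beta$; (d) $B(z^k_\alpha,\tfrac{c_0}{3}\delta^k)\subseteq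 Q^k_\alpha\subseteq B(z^k_\alpha,2C_0\delta^k)$. For such a system, the dyadic space $BMO$ consists of the locally integrable functions $F$ (integrable on compact sets) with $\|F\|_{BMO}=\|M^\sharp F\|_{L^\infty(G,m)}<\infty$, where $M^\sharp F(x)=\sup_{Q^k_\alpha\ni x}\inf_c\frac1{m(Q^k_\alpha)}\int_{Q^k_\alpha}|F-c|\,dm$ (cubes of measure zero contribute $0$). Then: 1. For every $p\in(1,\infty)$ there is $c_p>0$ such that for every $f\in L^p(G,m)$ the function $SV(f)$ is $m$-measurable and $\|SV(f)\|_{L^p(G,m)}\le c_p\|f\|_{L^p(G,m)}$. 2. There is $c>0$ such that * for every $f\in L^1(G,m)$ the function $SV(f)$ is $m$-measurable and $m(\{g\in G: SV(f)(g)>\gamma\})\le\frac c\gamma\|f\|_{L^1(G,m)}$ for all $\gamma>0$; * for every system of dyadic cubes with parameters $c_0,C_0,\delta$ and every $f\in L^\infty(G,m)$ vanishing almost everywhere outside a compact set, $SV_{\ge r_0}(f)$ is finite almost everywhere, belongs to $BMO$, and satisfies $\|SV_{\ge r_0}(f)\|_{BMO}\le c\|f\|_{L^\infty(G,m)}$.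 Here functions are complex-valued, and $c_p$, $c$ do not depend on $f$, $\gamma$ or the system of dyadic cubes. -/

import Mathlib

open MeasureTheory Set
open scoped ENNReal

noncomputable section

/-- The `(ε, r₀)`-annular decay property of the balls `B(h, r) = {g | d (g, h) ≤ r}`:
for some `K > 0`, all centres `h`, all `r > r₀` and all `0 < s ≤ r`,
`m (B (h, r + s)) - m (B (h, r)) ≤ K (s / r) ^ ε m (B (h, r))`. -/
def AnnularDecay {G : Type*} [MetricSpace G] [MeasurableSpace G]
    (m : Measure G) (ε r₀ : ℝ) : Prop :=
  ∃ K : ℝ, 0 < K ∧ ∀ (h : G) (r s : ℝ), r₀ < r → 0 < s → s ≤ r →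
    m.real (Metric.closedBall h (r + s)) - m.real (Metric.closedBall h r) ≤
      K * (s / r) ^ ε * m.real (Metric.closedBall h r)

/-- The `(D₀, R)`-geometrically doubling property: every ball of radius `r ∈ (0, R]` is covered by
at most `D₀` balls of radius `r / 2`. -/
def GeometricallyDoubling (G : Type*) [MetricSpace G] (D₀ R : ℝ) : Prop :=
  ∀ (h : G) (r : ℝ), 0 < r → r ≤ R → ∃ t : Finset G, (t.card : ℝ) ≤ D₀ ∧
    Metric.closedBall h r ⊆ ⋃ y ∈ t, Metric.closedBall y (r / 2)

/-- The ball average `A'_r f (h) = m (B (h, r))⁻¹ ∫_{B (h, r)} f dm`. -/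
def ballAverage {G : Type*} [MetricSpace G] [MeasurableSpace G]
    (m : Measure G) (r : ℝ) (f : G → ℂ) (h : G) : ℂ :=
  ⨍ g in Metric.closedBall h r, f g ∂m

/-- The `q`-variation `V_q (a_r : r ∈ I)`: the supremum, over all finite sequences
`r_0 < r_1 < ⋯ < r_J` in `I`, of `(∑_j |a_{r_{j+1}} - a_{r_j}| ^ q) ^ (1 / q)`, in `[0, ∞]`. -/
def qVariation (q : ℝ) (I : Set ℝ) (a : ℝ → ℂ) : ℝ≥0∞ :=
  ⨆ (J : ℕ) (r : Fin (J + 1) → ℝ) (_ : StrictMono r) (_ : ∀ j, r j ∈ I),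
    (∑ j : Fin J, ‖a (r j.succ) - a (r j.castSucc)‖ₑ ^ q) ^ (1 / q)

/-- The short `2`-variation operator at base `δ`, starting at the scale `n₀`, for the averages with
radius in `I`:
`(∑_{n ≥ n₀} V₂ (A'_r f (x) : r ∈ [δ ^ n, δ ^ (n + 1)) ∩ I) ^ 2) ^ (1 / 2)`, in `[0, ∞]`. -/
def shortVariation {G : Type*} [MetricSpace G] [MeasurableSpace G]
    (m : Measure G) (δ : ℝ) (n₀ : ℤ) (I : Set ℝ) (f : G → ℂ) (x : G) : ℝ≥0∞ :=
  (∑' n : {n : ℤ // n₀ ≤ n},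
    qVariation 2 (Set.Ico (δ ^ n.1) (δ ^ (n.1 + 1)) ∩ I)
      (fun r => ballAverage m r f x) ^ (2 : ℝ)) ^ (1 / 2 : ℝ)

/-- A system of dyadic cubes with parameters `c₀, C₀, δ`. The cubes of generation `k` are indexed by
their centres `z ∈ center k`; the values `cube k z` with `z ∉ center k` play no role. -/
structure DyadicSystem (G : Type*) [MetricSpace G] [MeasurableSpace G] (c₀ C₀ δ : ℝ) where
  center : ℤ → Set G
  cube : ℤ → G → Set G
  separated : ∀ k, ∀ z ∈ center k, ∀ w ∈ center k, z ≠ w → c₀ * δ ^ k ≤ dist z w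
  dense : ∀ k x, ∃ z ∈ center k, dist x z < C₀ * δ ^ k
  measurable : ∀ k, ∀ z ∈ center k, MeasurableSet (cube k z)
  cover : ∀ k, ⋃ z ∈ center k, cube k z = Set.univ
  nested : ∀ k l, k ≤ l → ∀ z ∈ center k, ∀ w ∈ center l,
    cube k z ⊆ cube l w ∨ Disjoint (cube k z) (cube l w)
  ancestor : ∀ k n, k < n → ∀ z ∈ center k, ∃! w, w ∈ center n ∧ cube k z ⊆ cube n w
  inner : ∀ k, ∀ z ∈ center k, Metric.closedBall z (c₀ / 3 * δ ^ k) ⊆ cube k z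
  outer : ∀ k, ∀ z ∈ center k, cube k z ⊆ Metric.closedBall z (2 * C₀ * δ ^ k)

/-- The dyadic sharp maximal function
`M♯ F (x) = sup_{Q ∋ x} inf_c m (Q)⁻¹ ∫_Q |F - c| dm`, in `[0, ∞]`. (Since `F` is real-valued,
the infimum over real `c` is the infimum over complex `c`; cubes of measure zero contribute `0`.) -/
def dyadicSharp {G : Type*} [MetricSpace G] [MeasurableSpace G] {c₀ C₀ δ : ℝ}
    (m : Measure G) (𝒬 : DyadicSystem G c₀ C₀ δ) (F : G → ℝ) (x : G) : ℝ≥0∞ :=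
  ⨆ (k : ℤ) (z ∈ 𝒬.center k) (_ : x ∈ 𝒬.cube k z),
    ⨅ c : ℝ, ⨍⁻ y in 𝒬.cube k z, ‖F y - c‖ₑ ∂m

/-- The dyadic `BMO` norm `‖M♯ F‖_{L^∞}`, in `[0, ∞]`. -/
def dyadicBMONorm {G : Type*} [MetricSpace G] [MeasurableSpace G] {c₀ C₀ δ : ℝ}
    (m : Measure G) (𝒬 : DyadicSystem G c₀ C₀ δ) (F : G → ℝ) : ℝ≥0∞ :=
  essSup (dyadicSharp m 𝒬 F) m

/-- `F ∈ L¹_loc`: `F` is integrable on the sets that are compact for the topology `τ`. -/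
def IntegrableOnCompacts {G : Type*} [MeasurableSpace G] (m : Measure G) (τ : TopologicalSpace G)
    (F : G → ℝ) : Prop :=
  ∀ K : Set G, @IsCompact G τ K → IntegrableOn F K m

/-- `F` belongs to dyadic `BMO`. -/
def MemDyadicBMO {G : Type*} [MetricSpace G] [MeasurableSpace G] {c₀ C₀ δ : ℝ}
    (m : Measure G) (𝒬 : DyadicSystem G c₀ C₀ δ) (τ : TopologicalSpace G) (F : G → ℝ) : Prop :=
  IntegrableOnCompacts m τ F ∧ dyadicBMONorm m 𝒬 F < ∞

/-- `f ∈ L^∞_c`: `f` is essentially bounded and vanishes almost everywhere outside some set that is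
compact for the topology `τ`. -/
def MemLinftyCompact {G : Type*} [MeasurableSpace G] (m : Measure G) (τ : TopologicalSpace G)
    (f : G → ℂ) : Prop :=
  MemLp f ∞ m ∧ ∃ K : Set G, @IsCompact G τ K ∧ ∀ᵐ x ∂m, x ∉ K → f x = 0

end

section

open Filter Topology Metric
open scoped NNReal

set_option linter.unusedSectionVars false

noncomputable section

section

open Filter Topology

/-! ### The `q`-variation of a function of a real parameter -/

/-! Annular decay with `s = r` is doubling, so at radii at least `r₀` the measure behaves as on a
space of homogeneous type. The scales are `a * δ ^ k` with `a = δ ^ (n₀ + 2)`, and everything at one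
scale rests on `V₂² ≤ 2 · sup · V₁` (`qVariation_two_sq_le`). The total variation `V₁` of `r ↦ A_r f
(x)` over `[ρ, δ ρ)` is at most a multiple of an average of `‖f‖`, since it is controlled by
integrals over disjoint shells. Hence any gain in the size of the averages themselves is a gain for
`V₂`. Such a gain comes from cancellation: if `f` has mean zero over cubes of size `s`, much smaller
than `r`, its integral over a ball of radius `r` sees only the cubes meeting the sphere, which lie
in an annulus of relative mass at most a multiple of `(s / r) ^ ε`.

For `L²` (`exists_lintegral_squareVariation_le`), a nested system of cubes is built and `f` is
expanded into martingale differences. At scale `i`, a difference of generation `k ≤ i` gains from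
annular decay. A difference of generation `k > i` is constant on cubes of generation `k - 1`, so it
contributes only at points near the boundary of such a cube. These points are exponentially rare,
because at each intermediate generation a fixed proportion of every cube lies well inside it
(`CubeSystem.exists_setLIntegral_peripheral_le`). A Schur test sums the decay in `|i - k|`.

The weak type `(1, 1)` bound (`exists_measure_squareVariation_le`) uses a Calderón–Zygmund
decomposition stopped at the largest cubes with large average. Away from neighbourhoods of those
cubes only scales `i ≥ k` see the bad part of generation `k`, and there its mean zero and bounded
density give the same decay. Interpolation covers `1 < p < 2`.

For `p > 2`, the `s`-th power of the square sum, `s = p / 2`, is expanded into terms weighted by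
tail sums over larger scales (`exists_lintegral_squareVariation_rpow_le_maximal`). The tails are
almost constant on cubes, up to a maximal function of `‖f‖²`, so the `L²` bound localised to cubes
applies under the weight. The resulting error is absorbed.

Three initial scales remain. Below `r₀` there is no doubling of the measure, so their total
variation is bounded by Hölder's inequality on shells, and integrated by means of the covering
numbers that geometric doubling supplies (`CoarseAnnular.exists_lintegral_qVariation_one_rpow_le`).

For `BMO` (`exists_dyadicSharp_shortVariation_le`), the scales above the size of a dyadic cube
oscillate by at most a multiple of `‖f‖_∞` on it, and the scales below it are controlled in mean
square by the `L²` bound for `f` cut off near the cube. -/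

lemma qVariation_mono {q : ℝ} {I J : Set ℝ} (h : I ⊆ J) (a : ℝ → ℂ) :
    qVariation q I a ≤ qVariation q J a := by
  unfold qVariation
  refine iSup_mono fun k => iSup_mono fun r => iSup_mono fun hr => ?_
  exact iSup_le fun hI => le_iSup (f := fun _ : ∀ j, r j ∈ J => _) (fun j => h (hI j))

lemma qVariation_congr {q : ℝ} {I : Set ℝ} {a b : ℝ → ℂ} (h : ∀ r ∈ I, a r = b r) :
    qVariation q I a = qVariation q I b := by
  unfold qVariation
  refine iSup_congr fun k => iSup_congr fun r => iSup_congr fun hr => iSup_congr fun hI => ?_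
  simp only [h _ (hI _)]

lemma le_qVariation {q : ℝ} {I : Set ℝ} (a : ℝ → ℂ) {J : ℕ} {r : Fin (J + 1) → ℝ}
    (hr : StrictMono r) (hI : ∀ j, r j ∈ I) :
    (∑ j : Fin J, ‖a (r j.succ) - a (r j.castSucc)‖ₑ ^ q) ^ (1 / q) ≤ qVariation q I a :=
  le_iSup_of_le J <| le_iSup_of_le r <| le_iSup_of_le hr <| le_iSup_of_le hI le_rfl

lemma qVariation_le {q : ℝ} {I : Set ℝ} {a : ℝ → ℂ} {C : ℝ≥0∞}
    (h : ∀ (J : ℕ) (r : Fin (J + 1) → ℝ), StrictMono r → (∀ j, r j ∈ I) →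
      (∑ j : Fin J, ‖a (r j.succ) - a (r j.castSucc)‖ₑ ^ q) ^ (1 / q) ≤ C) :
    qVariation q I a ≤ C :=
  iSup_le fun J => iSup_le fun r => iSup_le fun hr => iSup_le fun hI => h J r hr hI

lemma qVariation_const {q : ℝ} (hq : 0 < q) {I : Set ℝ} {a : ℝ → ℂ} {c : ℂ}
    (h : ∀ r ∈ I, a r = c) : qVariation q I a = 0 := by
  refine le_antisymm (qVariation_le fun J r _ hI => ?_) bot_le
  simp [h _ (hI _), hq]

lemma qVariation_two_add_le {I : Set ℝ} (a b : ℝ → ℂ) :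
    qVariation 2 I (fun r => a r + b r) ≤ qVariation 2 I a + qVariation 2 I b := by
  refine qVariation_le fun J r hr hI => ?_
  refine le_trans ?_ (add_le_add (le_qVariation a hr hI) (le_qVariation b hr hI))
  refine le_trans ?_ (ENNReal.Lp_add_le Finset.univ _ _ (by norm_num : (1 : ℝ) ≤ 2))
  gcongr with j
  rw [add_sub_add_comm]
  exact enorm_add_le _ _

/-- A squared increment is the increment times at most `2 * S`. So smallness is needed only for the
supremum of the averages; for the total variation a bound without any gain suffices. -/
lemma qVariation_two_sq_le {I : Set ℝ} {a : ℝ → ℂ} {S V : ℝ≥0∞} (hS : ∀ r ∈ I, ‖a r‖ₑ ≤ S)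
    (hV : qVariation 1 I a ≤ V) : qVariation 2 I a ^ 2 ≤ 2 * S * V := by
  have key : ∀ (J : ℕ) (r : Fin (J + 1) → ℝ), StrictMono r → (∀ j, r j ∈ I) →
      (∑ j : Fin J, ‖a (r j.succ) - a (r j.castSucc)‖ₑ ^ (2 : ℝ)) ≤ 2 * S * V := by
    intro J r hr hI
    have h1 := (le_qVariation (q := 1) a hr hI).trans hV
    simp only [ENNReal.rpow_one, div_one] at h1
    calc _ ≤ ∑ j : Fin J, 2 * S * ‖a (r j.succ) - a (r j.castSucc)‖ₑ := by
          refine Finset.sum_le_sum fun j _ => ?_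
          rw [ENNReal.rpow_two, pow_two]
          gcongr
          refine (enorm_sub_le).trans ?_
          rw [two_mul]
          exact add_le_add (hS _ (hI _)) (hS _ (hI _))
      _ ≤ _ := by rw [← Finset.mul_sum]; gcongr
  have : qVariation 2 I a ≤ (2 * S * V) ^ (1 / 2 : ℝ) :=
    qVariation_le fun J r hr hI => ENNReal.rpow_le_rpow (key J r hr hI) (by norm_num)
  calc _ ≤ ((2 * S * V) ^ (1 / 2 : ℝ)) ^ 2 := by gcongr
    _ = _ := by
      rw [← ENNReal.rpow_two, ← ENNReal.rpow_mul]; norm_num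

lemma qVariation_two_le_one (I : Set ℝ) (a : ℝ → ℂ) : qVariation 2 I a ≤ qVariation 1 I a := by
  refine qVariation_le fun J r hr hI => ?_
  refine le_trans ?_ (le_qVariation (q := 1) a hr hI)
  simp only [ENNReal.rpow_one, div_one]
  have : ∀ s : Finset (Fin J), (∑ j ∈ s, ‖a (r j.succ) - a (r j.castSucc)‖ₑ ^ (2 : ℝ))
      ≤ (∑ j ∈ s, ‖a (r j.succ) - a (r j.castSucc)‖ₑ) ^ (2 : ℝ) := by
    intro s
    induction s using Finset.cons_induction with
    | empty => simp
    | cons i s hi ih =>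
      rw [Finset.sum_cons, Finset.sum_cons]
      exact (add_le_add le_rfl ih).trans (ENNReal.add_rpow_le_rpow_add _ _ (by norm_num))
  calc _ ≤ ((∑ j : Fin J, ‖a (r j.succ) - a (r j.castSucc)‖ₑ) ^ (2 : ℝ)) ^ (1 / 2 : ℝ) :=
        ENNReal.rpow_le_rpow (this _) (by norm_num)
    _ = _ := by rw [← ENNReal.rpow_mul]; norm_num

lemma qVariation_one_le {I : Set ℝ} {a : ℝ → ℂ} {C : ℝ≥0∞}
    (h : ∀ (J : ℕ) (r : Fin (J + 1) → ℝ), StrictMono r → (∀ j, r j ∈ I) →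
      ∑ j : Fin J, ‖a (r j.succ) - a (r j.castSucc)‖ₑ ≤ C) :
    qVariation 1 I a ≤ C :=
  qVariation_le fun J r hr hI => by simpa using h J r hr hI

/-- For a right-continuous function the variation over `[α, β)` is attained along rationals. -/
lemma qVariation_Ico_eq_rat {q : ℝ} {α β : ℝ} {a : ℝ → ℂ}
    (ha : ∀ r ∈ Ico α β, ContinuousWithinAt a (Ici r) r) :
    qVariation q (Ico α β) a = ⨆ (J : ℕ) (t : Fin (J + 1) → ℚ) (_ : StrictMono t)
      (_ : ∀ j, (t j : ℝ) ∈ Ico α β),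
      (∑ j : Fin J, ‖a (t j.succ) - a (t j.castSucc)‖ₑ ^ q) ^ (1 / q) := by
  refine le_antisymm (qVariation_le fun J r hr hI => ?_) ?_
  -- Approximation strictly from the right: it matches the one-sided continuity, and it stays inside
  -- the interval because that is open on the right.
  · have hex : ∀ (n : ℕ) (j : Fin (J + 1)), ∃ t : ℚ, r j < t ∧ (t : ℝ) < r j + 1 / ((n : ℝ) + 1) :=
      fun n j => exists_rat_btwn (by have : 0 < 1 / ((n : ℝ) + 1) := by positivity
                                     linarith)
    choose t ht1 ht2 using hex
    have hlim : ∀ j, Tendsto (fun n => (t n j : ℝ)) atTop (𝓝 (r j)) := fun j => by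
      refine tendsto_of_tendsto_of_tendsto_of_le_of_le tendsto_const_nhds ?_
        (fun n => (ht1 n j).le) (fun n => (ht2 n j).le)
      simpa using tendsto_const_nhds.add (tendsto_one_div_add_atTop_nhds_zero_nat (𝕜 := ℝ))
    have hlim' : ∀ j, Tendsto (fun n => a (t n j)) atTop (𝓝 (a (r j))) := fun j => by
      refine (ha _ (hI j)).tendsto.comp ?_
      refine tendsto_nhdsWithin_iff.2 ⟨hlim j, Eventually.of_forall fun n => (ht1 n j).le⟩
    have hsum : Tendsto (fun n => (∑ j : Fin J, ‖a (t n j.succ) - a (t n j.castSucc)‖ₑ ^ q) ^ (1 / q))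
        atTop (𝓝 ((∑ j : Fin J, ‖a (r j.succ) - a (r j.castSucc)‖ₑ ^ q) ^ (1 / q))) := by
      refine (ENNReal.continuous_rpow_const.tendsto _).comp ?_
      refine tendsto_finsetSum _ fun j _ => ?_
      refine (ENNReal.continuous_rpow_const.tendsto _).comp ?_
      exact ((hlim' _).sub (hlim' _)).enorm
    refine le_of_tendsto hsum ?_
    have e1 : ∀ᶠ n in atTop, ∀ j, (t n j : ℝ) ∈ Ico α β := by
      rw [eventually_all]
      intro j
      filter_upwards [(hlim j).eventually (gt_mem_nhds (hI j).2)] with n hn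
      exact ⟨(hI j).1.trans (ht1 n j).le, hn⟩
    have e2 : ∀ᶠ n in atTop, StrictMono (t n) := by
      have : ∀ᶠ n in atTop, ∀ i j : Fin (J + 1), i < j → t n i < t n j := by
        rw [eventually_all]; intro i
        rw [eventually_all]; intro j
        by_cases hij : i < j
        · filter_upwards [(hlim i).eventually_lt (hlim j) (hr hij)] with n hn _
          exact_mod_cast hn
        · exact Eventually.of_forall fun n h => absurd h hij
      filter_upwards [this] with n hn i j hij using hn i j hij
    filter_upwards [e1, e2] with n h1 h2
    exact le_iSup_of_le J <| le_iSup_of_le (t n) <| le_iSup_of_le h2 <| le_iSup_of_le h1 le_rfl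
  · refine iSup_le fun J => iSup_le fun t => iSup_le fun ht => iSup_le fun hI => ?_
    exact le_qVariation (r := fun j => (t j : ℝ)) a (fun i j hij => Rat.cast_lt.2 (ht hij)) hI

lemma measurable_iSup_rat_variation {Ω : Type*} [MeasurableSpace Ω] (q α β : ℝ) {a : ℝ → Ω → ℂ}
    (ha : ∀ r, Measurable (a r)) :
    Measurable fun x => ⨆ (J : ℕ) (t : Fin (J + 1) → ℚ) (_ : StrictMono t)
      (_ : ∀ j, (t j : ℝ) ∈ Ico α β),
      (∑ j : Fin J, ‖a (t j.succ) x - a (t j.castSucc) x‖ₑ ^ q) ^ (1 / q) := by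
  refine Measurable.iSup fun J => Measurable.iSup fun t => Measurable.iSup_Prop _ <|
    Measurable.iSup_Prop _ ?_
  refine Measurable.pow_const (Finset.measurable_fun_sum _ fun j _ => ?_) _
  exact (((ha _).sub (ha _)).enorm).pow_const _

lemma measurable_qVariation {Ω : Type*} [MeasurableSpace Ω] {q : ℝ} {α β : ℝ}
    {a : ℝ → Ω → ℂ} (ha : ∀ r, Measurable (a r))
    (hc : ∀ x, ∀ r ∈ Ico α β, ContinuousWithinAt (fun r => a r x) (Ici r) r) :
    Measurable fun x => qVariation q (Ico α β) (fun r => a r x) := by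
  rw [show (fun x => qVariation q (Ico α β) (fun r => a r x)) = _ from
    funext fun x => qVariation_Ico_eq_rat (hc x)]
  exact measurable_iSup_rat_variation q α β ha

lemma aemeasurable_qVariation {Ω : Type*} [MeasurableSpace Ω] {μ : Measure Ω} {q : ℝ}
    {α β : ℝ} {a : ℝ → Ω → ℂ} (ha : ∀ r, Measurable (a r))
    (hc : ∀ᵐ x ∂μ, ∀ r ∈ Ico α β, ContinuousWithinAt (fun r => a r x) (Ici r) r) :
    AEMeasurable (fun x => qVariation q (Ico α β) (fun r => a r x)) μ := by
  refine ⟨_, measurable_iSup_rat_variation q α β ha, ?_⟩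
  filter_upwards [hc] with x hx using qVariation_Ico_eq_rat hx

/-- The discrete form of the bound for the total variation of averages. -/
lemma sum_abs_average_sub_le {J : ℕ} {M F : ℕ → ℝ} {A : ℕ → ℂ}
    (hM : ∀ j ≤ J, 0 < M j) (hMm : ∀ j < J, M j ≤ M (j + 1))
    (hA : ∀ j < J, ‖M (j + 1) * A (j + 1) - M j * A j‖ ≤ F (j + 1) - F j)
    (hF : ∀ j ≤ J, ‖M j * A j‖ ≤ F j) :
    ∑ j ∈ Finset.range J, ‖A (j + 1) - A j‖ ≤
      2 * (∑ j ∈ Finset.range J, (F (j + 1) - F j) / M (j + 1)) + F 0 / M 0 := by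
  have key : ∀ j < J, ‖A (j + 1) - A j‖ ≤
      2 * ((F (j + 1) - F j) / M (j + 1)) + (F j / M j - F (j + 1) / M (j + 1)) := by
    intro j hj
    have h0 := hM j hj.le
    have h1 := hM (j + 1) hj
    -- The increment is split into the change of the integral and the change of the normalisation.
    -- Bounding the second part through `F j` produces the first part once more, whence the factor
    -- `2`, and a remainder `F / M` that telescopes.
    have e : A (j + 1) - A j = (M (j + 1) * A (j + 1) - M j * A j) / M (j + 1)
        - (M j * A j) * ((1 / M j - 1 / M (j + 1) : ℝ) : ℂ) := by
      have h0' : (M j : ℂ) ≠ 0 := by exact_mod_cast h0.ne'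
      have h1' : (M (j + 1) : ℂ) ≠ 0 := by exact_mod_cast h1.ne'
      push_cast
      field_simp
      ring
    have hnn : 0 ≤ 1 / M j - 1 / M (j + 1) := sub_nonneg.2 (one_div_le_one_div_of_le h0 (hMm j hj))
    rw [e]
    refine (norm_sub_le _ _).trans ?_
    rw [norm_div, norm_mul (_ * _), Complex.norm_real, Complex.norm_real, Real.norm_of_nonneg hnn,
      Real.norm_of_nonneg h1.le]
    have t1 := div_le_div_of_nonneg_right (hA j hj) h1.le
    have t2 := mul_le_mul_of_nonneg_right (hF j hj.le) hnn
    have e2 : F j * (1 / M j - 1 / M (j + 1)) =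
      (F (j + 1) - F j) / M (j + 1) + (F j / M j - F (j + 1) / M (j + 1)) := by
      field_simp; ring
    linarith
  calc _ ≤ ∑ j ∈ Finset.range J, (2 * ((F (j + 1) - F j) / M (j + 1))
          + (F j / M j - F (j + 1) / M (j + 1))) :=
        Finset.sum_le_sum fun j hj => key j (Finset.mem_range.1 hj)
    _ = 2 * (∑ j ∈ Finset.range J, (F (j + 1) - F j) / M (j + 1)) + (F 0 / M 0 - F J / M J) := by
        rw [Finset.sum_add_distrib, Finset.sum_range_sub' (fun j => F j / M j), Finset.mul_sum]
    _ ≤ _ := by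
        have : 0 ≤ F J / M J := div_nonneg ((norm_nonneg _).trans (hF J le_rfl)) (hM J le_rfl).le
        linarith

lemma qVariation_one_sub_le {I : Set ℝ} (a b : ℝ → ℂ) :
    qVariation 1 I (fun r => a r - b r) ≤ qVariation 1 I a + qVariation 1 I b := by
  refine qVariation_one_le fun J r hr hI => ?_
  have h1 := le_qVariation (q := 1) a hr hI
  have h2 := le_qVariation (q := 1) b hr hI
  simp only [ENNReal.rpow_one, div_one] at h1 h2
  refine le_trans ?_ (add_le_add h1 h2)
  rw [← Finset.sum_add_distrib]
  gcongr with j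
  rw [sub_sub_sub_comm]
  exact enorm_sub_le

end

section

/-! ### Averages over balls -/

variable {G : Type*} [MetricSpace G] [MeasurableSpace G] [OpensMeasurableSpace G]

/-- Integrability on all balls. -/
def BallIntegrable (m : Measure G) (f : G → ℂ) : Prop :=
  ∀ x r, IntegrableOn f (closedBall x r) m

/-- The average over a closed ball of a function with values in `[0, ∞]`. -/
def ballLAverage (m : Measure G) (R : ℝ) (u : G → ℝ≥0∞) (x : G) : ℝ≥0∞ :=
  (m (closedBall x R))⁻¹ * ∫⁻ y in closedBall x R, u y ∂m

/-- The data of a measure with annular decay and positive mass at scales at least `r₀`. -/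
structure CoarseAnnular (m : Measure G) (r₀ ε K : ℝ) : Prop where
  r₀_pos : 0 < r₀
  ε_pos : 0 < ε
  ε_le : ε ≤ 1
  K_nonneg : 0 ≤ K
  lt_top : ∀ x r, m (closedBall x r) < ∞
  pos : ∀ x r, r₀ ≤ r → 0 < m.real (closedBall x r)
  decay : ∀ x r s, r₀ ≤ r → 0 < s → s ≤ r →
    m.real (closedBall x (r + s)) - m.real (closedBall x r) ≤
      K * (s / r) ^ ε * m.real (closedBall x r)

lemma ballAverage_eq (m : Measure G) (r : ℝ) (f : G → ℂ) (x : G) :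
    ballAverage m r f x = (m.real (closedBall x r))⁻¹ • ∫ y in closedBall x r, f y ∂m :=
  setAverage_eq _ _ _

lemma ballAverage_congr_ae {m : Measure G} {f g : G → ℂ} (h : f =ᵐ[m] g) (r : ℝ) (x : G) :
    ballAverage m r f x = ballAverage m r g x := by
  rw [ballAverage_eq, ballAverage_eq, integral_congr_ae (ae_restrict_of_ae h)]

lemma ballAverage_add {m : Measure G} {f g : G → ℂ} (hf : BallIntegrable m f)
    (hg : BallIntegrable m g) (r : ℝ) (x : G) :
    ballAverage m r (fun y => f y + g y) x = ballAverage m r f x + ballAverage m r g x := by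
  simp only [ballAverage_eq]
  rw [integral_add (hf x r) (hg x r), smul_add]

lemma ballAverage_congr_on {m : Measure G} {f g : G → ℂ} {r : ℝ} {x : G}
    (h : ∀ y ∈ closedBall x r, f y = g y) : ballAverage m r f x = ballAverage m r g x := by
  rw [ballAverage_eq, ballAverage_eq, setIntegral_congr_fun measurableSet_closedBall h]

lemma BallIntegrable.add {m : Measure G} {f g : G → ℂ} (hf : BallIntegrable m f)
    (hg : BallIntegrable m g) : BallIntegrable m (fun y => f y + g y) :=
  fun x r => (hf x r).add (hg x r)

lemma MeasureTheory.MemLp.ballIntegrable {m : Measure G}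
    (hm : ∀ x r, m (closedBall x r) < ∞) {f : G → ℂ} {p : ℝ≥0∞} (hp : 1 ≤ p) (hf : MemLp f p m) :
    BallIntegrable m f := fun x r => by
  have : IsFiniteMeasure (m.restrict (closedBall x r)) := ⟨by simpa using hm x r⟩
  exact (hf.restrict _).integrable hp

/-- The total variation of `r ↦ A_r f (x)` along a finite sequence of radii. -/
lemma sum_enorm_ballAverage_sub_le {m : Measure G} (hm : ∀ x r, m (closedBall x r) < ∞)
    {f : G → ℂ} (hf : BallIntegrable m f) {x : G} {J : ℕ} {r : ℕ → ℝ} (hr : Monotone r)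
    (h0 : 0 < m.real (closedBall x (r 0))) :
    ∑ j ∈ Finset.range J, ‖ballAverage m (r (j + 1)) f x - ballAverage m (r j) f x‖ ≤
      2 * (∑ j ∈ Finset.range J, (∫ y in closedBall x (r (j + 1)) \ closedBall x (r j), ‖f y‖ ∂m)
        / m.real (closedBall x (r (j + 1))))
        + (∫ y in closedBall x (r 0), ‖f y‖ ∂m) / m.real (closedBall x (r 0)) := by
  have hM : ∀ j, 0 < m.real (closedBall x (r j)) := fun j =>
    h0.trans_le (measureReal_mono (closedBall_subset_closedBall (hr (Nat.zero_le j))) (hm _ _).ne)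
  have hMA : ∀ j, (m.real (closedBall x (r j)) : ℂ) * ballAverage m (r j) f x =
      ∫ y in closedBall x (r j), f y ∂m := fun j => by
    rw [ballAverage_eq, Complex.real_smul, ← mul_assoc, Complex.ofReal_inv, mul_inv_cancel₀, one_mul]
    exact_mod_cast (hM j).ne'
  have hsub : ∀ j, closedBall x (r j) ⊆ closedBall x (r (j + 1)) := fun j =>
    closedBall_subset_closedBall (hr (Nat.le_succ j))
  have hd : ∀ j, (∫ y in closedBall x (r (j + 1)), ‖f y‖ ∂m) - ∫ y in closedBall x (r j), ‖f y‖ ∂m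
      = ∫ y in closedBall x (r (j + 1)) \ closedBall x (r j), ‖f y‖ ∂m := fun j => by
    rw [setIntegral_sdiff measurableSet_closedBall (hf x _).norm (hsub j)]
  have := sum_abs_average_sub_le (J := J) (M := fun j => m.real (closedBall x (r j)))
    (F := fun j => ∫ y in closedBall x (r j), ‖f y‖ ∂m) (A := fun j => ballAverage m (r j) f x)
    (fun j _ => hM j) (fun j _ => measureReal_mono (hsub j) (hm _ _).ne)
    (fun j _ => by
      simp only [hMA, hd]
      rw [← setIntegral_sdiff measurableSet_closedBall (hf x _) (hsub j)]
      exact norm_integral_le_integral_norm _)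
    (fun j _ => by simp only [hMA]; exact norm_integral_le_integral_norm _)
  simpa only [hd] using this

/-- Extend a finite sequence to all of `ℕ` by its last value. -/
def finExtend {J : ℕ} (r : Fin (J + 1) → ℝ) (n : ℕ) : ℝ :=
  r ⟨min n J, Nat.lt_succ_of_le (min_le_right _ _)⟩

lemma finExtend_monotone {J : ℕ} {r : Fin (J + 1) → ℝ} (hr : StrictMono r) :
    Monotone (finExtend r) := fun i j hij => hr.monotone (by
      simpa [Fin.le_def] using Or.inl hij)

lemma sum_fin_eq_sum_range_finExtend {J : ℕ} (r : Fin (J + 1) → ℝ) {α : Type*} [AddCommMonoid α]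
    (Φ : ℝ → ℝ → α) : ∑ j : Fin J, Φ (r j.succ) (r j.castSucc) =
      ∑ j ∈ Finset.range J, Φ (finExtend r (j + 1)) (finExtend r j) := by
  rw [Finset.sum_range]
  refine Finset.sum_congr rfl fun j _ => ?_
  have h1 : j.succ = ⟨min ((j : ℕ) + 1) J, Nat.lt_succ_of_le (min_le_right _ _)⟩ := by
    ext; simp
  have h2 : j.castSucc = ⟨min (j : ℕ) J, Nat.lt_succ_of_le (min_le_right _ _)⟩ := by
    ext; simp
  rw [finExtend, finExtend, ← h1, ← h2]

/-- Every denominator is at least `m (closedBall x ρ)`; once they are all replaced by it, the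
integrals over shells telescope. -/
lemma qVariation_one_ballAverage_le {m : Measure G} (hm : ∀ x r, m (closedBall x r) < ∞)
    {f : G → ℂ} (hf : BallIntegrable m f) {x : G} {ρ R : ℝ}
    (h0 : 0 < m.real (closedBall x ρ)) :
    qVariation 1 (Ico ρ R) (fun r => ballAverage m r f x) ≤
      2 * ((m (closedBall x ρ))⁻¹ * ∫⁻ y in closedBall x R, ‖f y‖ₑ ∂m) := by
  refine qVariation_one_le fun J r hr hI => ?_
  have hmono := finExtend_monotone hr
  set t := finExtend r with ht
  have htI : ∀ j, t j ∈ Ico ρ R := fun j => hI _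
  rw [sum_fin_eq_sum_range_finExtend r (fun a b => ‖ballAverage m a f x - ballAverage m b f x‖ₑ)]
  have hle : ∀ j, m.real (closedBall x ρ) ≤ m.real (closedBall x (t j)) := fun j =>
    measureReal_mono (closedBall_subset_closedBall (htI j).1) (hm _ _).ne
  have hsub : ∀ j, closedBall x (t j) ⊆ closedBall x (t (j + 1)) := fun j =>
    closedBall_subset_closedBall (hmono (Nat.le_succ j))
  have h1 := sum_enorm_ballAverage_sub_le (J := J) hm hf (x := x) hmono (h0.trans_le (hle 0))
  have hint0 : ∀ s : Set G, 0 ≤ ∫ y in s, ‖f y‖ ∂m := fun s => integral_nonneg fun y => norm_nonneg _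
  have h2 : 2 * (∑ j ∈ Finset.range J, (∫ y in closedBall x (t (j + 1)) \ closedBall x (t j), ‖f y‖ ∂m)
        / m.real (closedBall x (t (j + 1))))
        + (∫ y in closedBall x (t 0), ‖f y‖ ∂m) / m.real (closedBall x (t 0)) ≤
      2 * ((m.real (closedBall x ρ))⁻¹ * ∫ y in closedBall x R, ‖f y‖ ∂m) := by
    have hF : ∀ j, ∫ y in closedBall x (t (j + 1)) \ closedBall x (t j), ‖f y‖ ∂m =
        (∫ y in closedBall x (t (j + 1)), ‖f y‖ ∂m) - ∫ y in closedBall x (t j), ‖f y‖ ∂m :=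
      fun j => setIntegral_sdiff measurableSet_closedBall (hf x _).norm (hsub j)
    calc _ ≤ 2 * (∑ j ∈ Finset.range J,
          (∫ y in closedBall x (t (j + 1)) \ closedBall x (t j), ‖f y‖ ∂m)
          / m.real (closedBall x ρ))
          + (∫ y in closedBall x (t 0), ‖f y‖ ∂m) / m.real (closedBall x ρ) := by
          refine add_le_add (mul_le_mul_of_nonneg_left (Finset.sum_le_sum fun j _ => ?_) zero_le_two) ?_
          · exact div_le_div_of_nonneg_left (hint0 _) h0 (hle _)
          · exact div_le_div_of_nonneg_left (hint0 _) h0 (hle _)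
      _ = (2 * ((∫ y in closedBall x (t J), ‖f y‖ ∂m) - ∫ y in closedBall x (t 0), ‖f y‖ ∂m)
          + (∫ y in closedBall x (t 0), ‖f y‖ ∂m)) / m.real (closedBall x ρ) := by
          rw [← Finset.sum_div, Finset.sum_congr rfl (fun j _ => hF j),
            Finset.sum_range_sub (fun j => ∫ y in closedBall x (t j), ‖f y‖ ∂m)]
          ring
      _ ≤ (2 * ∫ y in closedBall x R, ‖f y‖ ∂m) / m.real (closedBall x ρ) := by
          gcongr
          have := hint0 (closedBall x (t 0))
          have h3 : ∫ y in closedBall x (t J), ‖f y‖ ∂m ≤ ∫ y in closedBall x R, ‖f y‖ ∂m :=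
            setIntegral_mono_set (hf x R).norm (ae_of_all _ fun y => norm_nonneg _)
              (LE.le.eventuallyLE (closedBall_subset_closedBall (htI J).2.le))
          linarith
      _ = _ := by ring
  calc ∑ j ∈ Finset.range J, ‖ballAverage m (t (j + 1)) f x - ballAverage m (t j) f x‖ₑ
      = ENNReal.ofReal (∑ j ∈ Finset.range J, ‖ballAverage m (t (j + 1)) f x
          - ballAverage m (t j) f x‖) := by
        rw [ENNReal.ofReal_sum_of_nonneg fun _ _ => norm_nonneg _]
        simp [ofReal_norm]
    _ ≤ ENNReal.ofReal (2 * ((m.real (closedBall x ρ))⁻¹ * ∫ y in closedBall x R, ‖f y‖ ∂m)) :=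
        ENNReal.ofReal_le_ofReal (h1.trans h2)
    _ = _ := by
        rw [ENNReal.ofReal_mul (by norm_num), ENNReal.ofReal_mul (by positivity),
          ENNReal.ofReal_inv_of_pos h0, ofReal_integral_norm_eq_lintegral_enorm (hf x R),
          Measure.real, ENNReal.ofReal_toReal (hm _ _).ne]
        norm_num

/-! ### Measurability and right continuity -/

lemma measurable_ballLAverage [SecondCountableTopology G] {m : Measure G} [SFinite m] (R : ℝ)
    {u : G → ℝ≥0∞} (hu : Measurable u) : Measurable (ballLAverage m R u) := by
  have hS : MeasurableSet {z : G × G | dist z.2 z.1 ≤ R} :=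
    measurableSet_le (measurable_snd.dist measurable_fst) measurable_const
  have key : ∀ v : G → ℝ≥0∞, Measurable v →
      Measurable fun x => ∫⁻ y in closedBall x R, v y ∂m := fun v hv => by
    have : ∀ x, ∫⁻ y in closedBall x R, v y ∂m =
        ∫⁻ y, {z : G × G | dist z.2 z.1 ≤ R}.indicator (fun z => v z.2) (x, y) ∂m := fun x => by
      rw [← lintegral_indicator measurableSet_closedBall]
      rfl
    simp_rw [this]
    exact ((hv.comp measurable_snd).indicator hS).lintegral_prod_right'
  have h1 : Measurable fun x => m (closedBall x R) := by
    simpa using key 1 measurable_one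
  exact h1.inv.mul (key u hu)

lemma measurable_ballAverage [SecondCountableTopology G] {m : Measure G} [SFinite m] (R : ℝ)
    {f : G → ℂ} (hf : Measurable f) : Measurable (ballAverage m R f) := by
  have hS : MeasurableSet {z : G × G | dist z.2 z.1 ≤ R} :=
    measurableSet_le (measurable_snd.dist measurable_fst) measurable_const
  have h1 : Measurable fun x => m (closedBall x R) := by
    have := measurable_measure_prodMk_left (ν := m) hS
    exact this
  have h2 : Measurable fun x => ∫ y in closedBall x R, f y ∂m := by
    have : ∀ x, ∫ y in closedBall x R, f y ∂m =
        ∫ y, {z : G × G | dist z.2 z.1 ≤ R}.indicator (fun z => f z.2) (x, y) ∂m := fun x => by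
      rw [← integral_indicator measurableSet_closedBall]
      rfl
    simp_rw [this]
    exact (((hf.comp measurable_snd).indicator hS).stronglyMeasurable.integral_prod_right').measurable
  have : ballAverage m R f = fun x => (m (closedBall x R)).toReal⁻¹ •
      ∫ y in closedBall x R, f y ∂m := funext fun x => ballAverage_eq m R f x
  rw [this]
  exact h1.ennreal_toReal.inv.smul h2

/-- Closed balls decrease to `closedBall x r` as the radius decreases to `r`, which gives continuity
from the right. From the left, a sphere of positive mass could be an obstacle. -/
lemma continuousWithinAt_setIntegral_closedBall {E : Type*} [NormedAddCommGroup E]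
    [NormedSpace ℝ E] {m : Measure G} {f : G → E} {x : G}
    (hf : ∀ r, IntegrableOn f (closedBall x r) m) (r : ℝ) :
    ContinuousWithinAt (fun r => ∫ y in closedBall x r, f y ∂m) (Ici r) r := by
  simp_rw [← integral_indicator (measurableSet_closedBall : MeasurableSet (closedBall x _))]
  refine tendsto_integral_filter_of_dominated_convergence
    ((closedBall x (r + 1)).indicator fun y => ‖f y‖) ?_ ?_ ?_ ?_
  · exact Eventually.of_forall fun t =>
      (aestronglyMeasurable_indicator_iff measurableSet_closedBall).2 (hf t).1
  · have : ∀ᶠ t in 𝓝[≥] r, t < r + 1 := nhdsWithin_le_nhds (gt_mem_nhds (by linarith))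
    filter_upwards [this] with t ht
    refine ae_of_all _ fun y => ?_
    rw [norm_indicator_eq_indicator_norm]
    exact indicator_le_indicator_of_subset (closedBall_subset_closedBall ht.le)
      (fun _ => norm_nonneg _) y
  · exact (integrable_indicator_iff measurableSet_closedBall).2 (hf _).norm
  · refine ae_of_all _ fun y => ?_
    refine tendsto_const_nhds.congr' ?_
    by_cases hy : dist y x ≤ r
    · filter_upwards [self_mem_nhdsWithin] with t ht
      rw [indicator_of_mem (by simpa using hy),
        indicator_of_mem (by simpa using hy.trans ht)]
    · have : ∀ᶠ t in 𝓝[≥] r, t < dist y x := nhdsWithin_le_nhds (gt_mem_nhds (not_le.1 hy))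
      filter_upwards [this] with t ht
      rw [indicator_of_notMem (by simpa using hy), indicator_of_notMem (by simpa using ht)]

lemma continuousWithinAt_measureReal_closedBall {m : Measure G}
    (hm : ∀ x r, m (closedBall x r) < ∞) (x : G) (r : ℝ) :
    ContinuousWithinAt (fun r => m.real (closedBall x r)) (Ici r) r := by
  have := continuousWithinAt_setIntegral_closedBall (m := m) (f := fun _ : G => (1 : ℝ)) (x := x)
    (fun r => integrableOn_const (hm x r).ne) r
  simpa using this

lemma continuousWithinAt_ballAverage {m : Measure G} (hm : ∀ x r, m (closedBall x r) < ∞)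
    {f : G → ℂ} (hf : BallIntegrable m f) {x : G} {r : ℝ} (h0 : 0 < m.real (closedBall x r)) :
    ContinuousWithinAt (fun r => ballAverage m r f x) (Ici r) r := by
  simp_rw [ballAverage_eq]
  exact ((continuousWithinAt_measureReal_closedBall hm x r).inv₀ h0.ne').smul
    (continuousWithinAt_setIntegral_closedBall (hf x) r)

end

section

/-! ### Geometry of measures with annular decay -/

lemma ENNReal.inv_le_const_mul_inv {a b : ℝ≥0∞} {C : ℝ≥0} (hC : C ≠ 0) (h : a ≤ C * b) :
    b⁻¹ ≤ C * a⁻¹ := by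
  have hC' : (C : ℝ≥0∞) ≠ 0 := by exact_mod_cast hC
  calc b⁻¹ = C * (C * b)⁻¹ := by
        rw [ENNReal.mul_inv (Or.inl hC') (Or.inl ENNReal.coe_ne_top), ← mul_assoc,
          ENNReal.mul_inv_cancel hC' ENNReal.coe_ne_top, one_mul]
    _ ≤ _ := by gcongr

lemma lintegral_rpow_le_measure_mul {α : Type*} [MeasurableSpace α] (μ : Measure α) {u : α → ℝ≥0∞}
    (hu : AEMeasurable u μ) {p : ℝ} (hp : 1 ≤ p) :
    (∫⁻ y, u y ∂μ) ^ p ≤ μ univ ^ (p - 1) * ∫⁻ y, u y ^ p ∂μ := by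
  rcases hp.eq_or_lt with rfl | hp
  · simp
  have hq := Real.HolderConjugate.conjExponent hp
  have := ENNReal.lintegral_mul_le_Lp_mul_Lq μ hq hu (aemeasurable_const (b := (1 : ℝ≥0∞)))
  simp only [Pi.mul_apply, mul_one, ENNReal.one_rpow, lintegral_const, one_mul] at this
  have hp0 : 0 < p := by linarith
  calc _ ≤ ((∫⁻ y, u y ^ p ∂μ) ^ (1 / p) * μ univ ^ (1 / p.conjExponent)) ^ p := by gcongr
    _ = _ := by
      rw [ENNReal.mul_rpow_of_nonneg _ _ hp0.le, ← ENNReal.rpow_mul, ← ENNReal.rpow_mul,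
        one_div_mul_cancel hp0.ne', ENNReal.rpow_one, mul_comm, Real.conjExponent]
      congr 2
      have : p - 1 ≠ 0 := by linarith
      field_simp

lemma lintegral_sq_le_measure_mul {α : Type*} [MeasurableSpace α] (μ : Measure α) {u : α → ℝ≥0∞}
    (hu : AEMeasurable u μ) : (∫⁻ y, u y ∂μ) ^ 2 ≤ μ univ * ∫⁻ y, u y ^ 2 ∂μ := by
  have := lintegral_rpow_le_measure_mul μ hu (p := 2) (by norm_num)
  norm_num at this
  exact this

variable {G : Type*} [MetricSpace G] [MeasurableSpace G] [OpensMeasurableSpace G]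

lemma ballLAverage_rpow_le {m : Measure G} (hm : ∀ x r, m (closedBall x r) < ∞) {u : G → ℝ≥0∞}
    (hu : Measurable u) {p : ℝ} (hp : 1 ≤ p) (R : ℝ) (x : G) :
    ballLAverage m R u x ^ p ≤ ballLAverage m R (fun y => u y ^ p) x := by
  have hp0 : 0 < p := by linarith
  unfold ballLAverage
  rcases eq_or_ne (m (closedBall x R)) 0 with h0 | h0
  · simp [Measure.restrict_eq_zero.2 h0, hp0]
  rw [ENNReal.mul_rpow_of_nonneg _ _ hp0.le]
  calc _ ≤ (m (closedBall x R))⁻¹ ^ p * (m (closedBall x R) ^ (p - 1) *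
        ∫⁻ y in closedBall x R, u y ^ p ∂m) := by
        gcongr
        simpa using lintegral_rpow_le_measure_mul (m.restrict (closedBall x R)) hu.aemeasurable hp
    _ = _ := by
        rw [← mul_assoc, ENNReal.inv_rpow, ← ENNReal.rpow_neg, ← ENNReal.rpow_add _ _ h0 (hm _ _).ne,
          ← ENNReal.rpow_neg_one]
        congr 2; ring

lemma ballLAverage_sq_le {m : Measure G} (hm : ∀ x r, m (closedBall x r) < ∞) {u : G → ℝ≥0∞}
    (hu : Measurable u) (R : ℝ) (x : G) :
    ballLAverage m R u x ^ 2 ≤ ballLAverage m R (fun y => u y ^ 2) x := by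
  have := ballLAverage_rpow_le hm hu (p := 2) (by norm_num) R x
  simpa only [ENNReal.rpow_two] using this

namespace CoarseAnnular

variable {m : Measure G} {r₀ ε K : ℝ}

lemma pos' (h : CoarseAnnular m r₀ ε K) (x : G) {r : ℝ} (hr : r₀ ≤ r) : m (closedBall x r) ≠ 0 :=
  fun h0 => (h.pos x r hr).ne' (by simp [Measure.real, h0])

/-- Annular decay with `s = r` is doubling with constant `1 + K`. -/
lemma two_pow (h : CoarseAnnular m r₀ ε K) (t : ℕ) (x : G) {r : ℝ} (hr : r₀ ≤ r) :
    m.real (closedBall x (2 ^ t * r)) ≤ (1 + K) ^ t * m.real (closedBall x r) := by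
  induction t with
  | zero => simp
  | succ t ih =>
    have hr0 : 0 < r := h.r₀_pos.trans_le hr
    have h2 : r₀ ≤ 2 ^ t * r := hr.trans (le_mul_of_one_le_left hr0.le (one_le_pow₀ (by norm_num)))
    have := h.decay x (2 ^ t * r) (2 ^ t * r) h2 (by positivity) le_rfl
    rw [div_self (by positivity), Real.one_rpow, mul_one] at this
    calc _ = m.real (closedBall x (2 ^ t * r + 2 ^ t * r)) := by congr 2; ring
      _ ≤ (1 + K) * m.real (closedBall x (2 ^ t * r)) := by linarith
      _ ≤ (1 + K) * ((1 + K) ^ t * m.real (closedBall x r)) := by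
          have := h.K_nonneg; gcongr
      _ = _ := by ring

/-- The smallest power of two beyond `Λ` would do, by the triangle inequality. Only the ball on the
right must have radius at least `r₀`; the other may have any centre and radius. -/
lemma exists_doubling (h : CoarseAnnular m r₀ ε K) (Λ : ℝ) : ∃ C : ℝ≥0, 1 ≤ C ∧
    ∀ x y r R, r₀ ≤ r → dist x y + R ≤ Λ * r →
      m (closedBall y R) ≤ C * m (closedBall x r) := by
  obtain ⟨t, ht⟩ := pow_unbounded_of_one_lt Λ (one_lt_two)
  have hK := h.K_nonneg
  refine ⟨((1 + K) ^ t).toNNReal, ?_, ?_⟩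
  · rw [Real.one_le_toNNReal]
    exact one_le_pow₀ (by linarith)
  · intro x y r R hr hR
    have hr0 : 0 < r := h.r₀_pos.trans_le hr
    have hsub : closedBall y R ⊆ closedBall x (2 ^ t * r) := by
      refine closedBall_subset_closedBall' ?_
      rw [dist_comm]
      have : Λ * r ≤ 2 ^ t * r := by gcongr
      linarith
    refine (measure_mono hsub).trans ?_
    have h1 := h.two_pow t x hr
    rw [← ENNReal.ofReal_toReal (h.lt_top x (2 ^ t * r)).ne, ← ENNReal.ofReal_toReal (h.lt_top x r).ne,
      ← ENNReal.ofReal, ← ENNReal.ofReal_mul (by positivity)]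
    exact ENNReal.ofReal_le_ofReal h1

/-- Decay is applied at radius `r - s` with thickness `2 * s`. The condition `3 * s ≤ r` gives `2 *
s ≤ r - s` and, with `2 * r₀ ≤ r`, also `r₀ ≤ r - s`; the constant `4` comes from `2 * s / (r - s) ≤
4 * (s / r)` and `ε ≤ 1`. -/
lemma measure_annulus_le (h : CoarseAnnular m r₀ ε K) (x : G) {r s : ℝ} (hr : 2 * r₀ ≤ r)
    (hs : 0 < s) (hsr : 3 * s ≤ r) : m (closedBall x (r + s) \ closedBall x (r - s)) ≤
      ENNReal.ofReal (4 * K * (s / r) ^ ε) * m (closedBall x r) := by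
  have h0 := h.r₀_pos
  have hK := h.K_nonneg
  have hε := h.ε_pos
  have h1 := h.decay x (r - s) (2 * s) (by linarith) (by linarith) (by linarith)
  have hrs : r - s + 2 * s = r + s := by ring
  rw [hrs] at h1
  have hsub : closedBall x (r - s) ⊆ closedBall x (r + s) := closedBall_subset_closedBall (by linarith)
  have h2 : m.real (closedBall x (r + s) \ closedBall x (r - s)) ≤
      4 * K * (s / r) ^ ε * m.real (closedBall x r) := by
    rw [measureReal_sdiff hsub measurableSet_closedBall (h.lt_top _ _).ne]
    refine h1.trans ?_
    have h3 : (2 * s / (r - s)) ^ ε ≤ 4 * (s / r) ^ ε := by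
      calc (2 * s / (r - s)) ^ ε ≤ (4 * (s / r)) ^ ε := by
            have : 0 < r - s := by linarith
            have hr0 : 0 < r := by linarith
            gcongr
            rw [div_le_iff₀ this, mul_assoc, div_mul_eq_mul_div, mul_div_assoc', le_div_iff₀ hr0]
            nlinarith
        _ = 4 ^ ε * (s / r) ^ ε := Real.mul_rpow (by norm_num)
            (div_nonneg hs.le (by linarith))
        _ ≤ 4 ^ (1 : ℝ) * (s / r) ^ ε := by
            have : 0 ≤ s / r := div_nonneg hs.le (by linarith)
            gcongr
            · norm_num
            · exact h.ε_le
        _ = _ := by norm_num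
    have h4 : m.real (closedBall x (r - s)) ≤ m.real (closedBall x r) :=
      measureReal_mono (closedBall_subset_closedBall (by linarith)) (h.lt_top _ _).ne
    calc K * (2 * s / (r - s)) ^ ε * m.real (closedBall x (r - s))
        ≤ K * (4 * (s / r) ^ ε) * m.real (closedBall x r) := by
          gcongr
          have : 0 ≤ s / r := div_nonneg hs.le (by linarith)
          positivity
      _ = _ := by ring
  rw [← ENNReal.ofReal_toReal (h.lt_top x r).ne, ← ENNReal.ofReal_mul (by
      have : 0 ≤ s / r := div_nonneg hs.le (by linarith)
      positivity), ← ENNReal.ofReal_toReal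
      (((measure_mono sdiff_subset).trans_lt (h.lt_top x (r + s))).ne)]
  exact ENNReal.ofReal_le_ofReal h2

lemma sigmaFinite (h : CoarseAnnular m r₀ ε K) : SigmaFinite m := by
  rcases isEmpty_or_nonempty G with hG | ⟨⟨x⟩⟩
  · have : m = 0 := by
      ext s _
      simp [eq_empty_of_isEmpty s]
    rw [this]; infer_instance
  refine ⟨⟨⟨fun n => closedBall x n, fun _ => trivial, fun n => h.lt_top x n, ?_⟩⟩⟩
  exact iUnion_closedBall_nat x

/-- Averaging operators are bounded on `L¹`. -/
lemma exists_lintegral_ballLAverage_le [SecondCountableTopology G] (h : CoarseAnnular m r₀ ε K) :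
    ∃ C : ℝ≥0, ∀ R, r₀ ≤ R → ∀ u : G → ℝ≥0∞, Measurable u →
      ∫⁻ x, ballLAverage m R u x ∂m ≤ C * ∫⁻ x, u x ∂m := by
  obtain ⟨C, hC1, hC⟩ := h.exists_doubling 2
  have := h.sigmaFinite
  refine ⟨C, fun R hR u hu => ?_⟩
  have hS : MeasurableSet {z : G × G | dist z.2 z.1 ≤ R} :=
    measurableSet_le (measurable_snd.dist measurable_fst) measurable_const
  have hmB : Measurable fun x => m (closedBall x R) := measurable_measure_prodMk_left (ν := m) hS
  set Φ : G × G → ℝ≥0∞ := {z : G × G | dist z.2 z.1 ≤ R}.indicator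
    (fun z => (m (closedBall z.1 R))⁻¹ * u z.2) with hΦ
  have hΦm : Measurable Φ :=
    ((hmB.comp measurable_fst).inv.mul (hu.comp measurable_snd)).indicator hS
  have e1 : ∀ x, ballLAverage m R u x = ∫⁻ y, Φ (x, y) ∂m := fun x => by
    rw [ballLAverage, ← lintegral_const_mul _ hu, ← lintegral_indicator measurableSet_closedBall]
    rfl
  simp_rw [e1]
  -- After the exchange, `x` and `y` are at distance at most `R`, so doubling replaces the mass of
  -- the ball about `x` by that of the ball about `y`.
  rw [lintegral_lintegral_swap (f := fun x y => Φ (x, y)) hΦm.aemeasurable,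
    ← lintegral_const_mul _ hu]
  refine lintegral_mono fun y => ?_
  calc ∫⁻ x, Φ (x, y) ∂m ≤ ∫⁻ x, (closedBall y R).indicator
        (fun _ => C * (m (closedBall y R))⁻¹ * u y) x ∂m := by
        refine lintegral_mono fun x => ?_
        by_cases hxy : dist y x ≤ R
        · rw [hΦ, indicator_of_mem (by exact hxy),
            indicator_of_mem (by simpa [dist_comm] using hxy)]
          dsimp only
          gcongr
          exact ENNReal.inv_le_const_mul_inv (by positivity)
            (hC x y R R hR (by rw [dist_comm]; linarith))
        · rw [hΦ, indicator_of_notMem (by exact hxy)]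
          exact bot_le
    _ = C * u y := by
        rw [lintegral_indicator measurableSet_closedBall, lintegral_const, Measure.restrict_apply_univ,
          mul_right_comm, mul_assoc (C : ℝ≥0∞), ENNReal.inv_mul_cancel (h.pos' y hR) (h.lt_top y R).ne,
          mul_one]

/-- Short variations at large scales are controlled by an average. -/
lemma exists_qVariation_one_le (h : CoarseAnnular m r₀ ε K) (Λ : ℝ) : ∃ C : ℝ≥0, 1 ≤ C ∧
    ∀ f : G → ℂ, BallIntegrable m f → ∀ x x' ρ R R', r₀ ≤ ρ → dist x x' + R ≤ R' →
      dist x x' + R' ≤ Λ * ρ →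
      qVariation 1 (Ico ρ R) (fun r => ballAverage m r f x') ≤
        C * ballLAverage m R' (fun y => ‖f y‖ₑ) x := by
  obtain ⟨C, hC1, hC⟩ := h.exists_doubling Λ
  refine ⟨2 * C, by linarith [hC1, (2 : ℝ≥0).2], fun f hf x x' ρ R R' hρ hR hR' => ?_⟩
  refine (qVariation_one_ballAverage_le h.lt_top hf (h.pos x' ρ hρ)).trans ?_
  have h1 : (m (closedBall x' ρ))⁻¹ ≤ C * (m (closedBall x R'))⁻¹ :=
    ENNReal.inv_le_const_mul_inv (by positivity) (hC x' x ρ R' hρ (by rwa [dist_comm]))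
  calc _ ≤ 2 * ((C * (m (closedBall x R'))⁻¹) * ∫⁻ y in closedBall x R', ‖f y‖ₑ ∂m) := by
        gcongr
        exact closedBall_subset_closedBall' (by rw [dist_comm]; linarith)
    _ = _ := by
        rw [ballLAverage]; push_cast; ring

end CoarseAnnular

end

/-! ### The variation at one scale: gains from cancellation and from nearby centres. -/

section

variable {G : Type*} [MetricSpace G] [MeasurableSpace G] [OpensMeasurableSpace G]

lemma ENNReal.le_of_sq_le_sq {a b : ℝ≥0∞} (h : a ^ 2 ≤ b ^ 2) : a ≤ b :=
  (ENNReal.pow_le_pow_left_iff two_ne_zero).1 h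

lemma ENNReal.sqrt_sq (a : ℝ≥0∞) : (a ^ (1 / 2 : ℝ)) ^ 2 = a := by
  rw [← ENNReal.rpow_two, ← ENNReal.rpow_mul]; norm_num

lemma ENNReal.ofReal_rpow_half_sq {x ε : ℝ} (hx : 0 ≤ x) :
    ENNReal.ofReal (x ^ (ε / 2)) ^ 2 = ENNReal.ofReal (x ^ ε) := by
  rw [← ENNReal.ofReal_pow (Real.rpow_nonneg hx _), ← Real.rpow_natCast, ← Real.rpow_mul hx]
  norm_num

lemma enorm_inv_measureReal {m : Measure G} {s : Set G} (h0 : m s ≠ 0) (h1 : m s ≠ ∞) :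
    ‖(m.real s)⁻¹‖ₑ = (m s)⁻¹ := by
  rw [enorm_inv, Measure.real, Real.enorm_eq_ofReal ENNReal.toReal_nonneg, ENNReal.ofReal_toReal h1]
  exact (ENNReal.toReal_pos h0 h1).ne'

namespace CoarseAnnular

variable {m : Measure G} {r₀ ε K : ℝ}

/-- The square root of the mass of a thin annulus controls the integral over the annulus. -/
lemma exists_annulus_average_le (h : CoarseAnnular m r₀ ε K) (Λ : ℝ) : ∃ C : ℝ≥0,
    ∀ u : G → ℝ≥0∞, Measurable u → ∀ x s ρ r R, 2 * r₀ ≤ ρ → 0 < s → 3 * s ≤ ρ → ρ ≤ r →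
      r + s ≤ R → R ≤ Λ * ρ →
      (m (closedBall x r))⁻¹ * ∫⁻ y in closedBall x (r + s) \ closedBall x (r - s), u y ∂m ≤
        C * ENNReal.ofReal ((s / ρ) ^ (ε / 2)) *
          ballLAverage m R (fun y => u y ^ 2) x ^ (1 / 2 : ℝ) := by
  obtain ⟨C, hC1, hC⟩ := h.exists_doubling Λ
  have hK := h.K_nonneg
  have hr₀ := h.r₀_pos
  refine ⟨(4 * K).toNNReal * C + 1, fun u hu x s ρ r R hρ hs hsρ hρr hrR hR => ?_⟩
  have hsρ0 : 0 ≤ s / ρ := div_nonneg hs.le (by linarith)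
  apply ENNReal.le_of_sq_le_sq
  set A := closedBall x (r + s) \ closedBall x (r - s)
  have hAm : m A ≤ ENNReal.ofReal (4 * K) * ENNReal.ofReal ((s / ρ) ^ ε) * m (closedBall x r) := by
    rw [← ENNReal.ofReal_mul (by positivity)]
    refine (h.measure_annulus_le x (by linarith) hs (by linarith)).trans ?_
    have := h.ε_pos
    have : 0 < r := by linarith
    have : 0 < ρ := by linarith
    gcongr
  -- Cauchy–Schwarz on the annulus: its mass decays like `(s / ρ) ^ ε` and enters under a square
  -- root, which halves the exponent.
  have h1 : (∫⁻ y in A, u y ∂m) ^ 2 ≤ m A * ∫⁻ y in closedBall x R, u y ^ 2 ∂m := by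
    refine (lintegral_sq_le_measure_mul _ hu.aemeasurable).trans ?_
    rw [Measure.restrict_apply_univ]
    gcongr
    exact sdiff_subset.trans (closedBall_subset_closedBall hrR)
  have hB0 := h.pos' x (r := r) (by linarith)
  have hBt := (h.lt_top x r).ne
  have h2 : (m (closedBall x r))⁻¹ ≤ C * (m (closedBall x R))⁻¹ :=
    ENNReal.inv_le_const_mul_inv (by positivity) (hC x x r R (by linarith) (by
      rw [dist_self]
      have : 0 ≤ Λ := by
        by_contra hΛ
        nlinarith
      nlinarith))
  calc _ = (m (closedBall x r))⁻¹ ^ 2 * (∫⁻ y in A, u y ∂m) ^ 2 := mul_pow _ _ _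
    _ ≤ (m (closedBall x r))⁻¹ ^ 2 * ((ENNReal.ofReal (4 * K) * ENNReal.ofReal ((s / ρ) ^ ε)
          * m (closedBall x r)) * ∫⁻ y in closedBall x R, u y ^ 2 ∂m) := by
        gcongr
        exact h1.trans (by gcongr)
    _ = (ENNReal.ofReal (4 * K) * ENNReal.ofReal ((s / ρ) ^ ε)) *
          ((m (closedBall x r))⁻¹ * ∫⁻ y in closedBall x R, u y ^ 2 ∂m) *
          (m (closedBall x r) * (m (closedBall x r))⁻¹) := by ring
    _ ≤ (ENNReal.ofReal (4 * K) * ENNReal.ofReal ((s / ρ) ^ ε)) *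
          ((C * (m (closedBall x R))⁻¹) * ∫⁻ y in closedBall x R, u y ^ 2 ∂m) * 1 := by
        gcongr
        exact (ENNReal.mul_inv_cancel hB0 hBt).le
    _ = (ENNReal.ofReal (4 * K) * C) * ENNReal.ofReal ((s / ρ) ^ ε) *
          ballLAverage m R (fun y => u y ^ 2) x := by
        rw [ballLAverage]; ring
    _ ≤ ((((4 * K).toNNReal * C + 1 : ℝ≥0) : ℝ≥0∞)) ^ 2 * ENNReal.ofReal ((s / ρ) ^ ε) *
          ballLAverage m R (fun y => u y ^ 2) x := by
        gcongr
        rw [ENNReal.ofReal, ← ENNReal.coe_mul, ← ENNReal.coe_pow, ENNReal.coe_le_coe]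
        rw [sq]
        set z := (4 * K).toNNReal * C
        calc z ≤ z + 1 := le_self_add
          _ = 1 * (z + 1) := (one_mul _).symm
          _ ≤ (z + 1) * (z + 1) := by gcongr; exact le_add_self
    _ = _ := by
        rw [mul_pow, mul_pow, ENNReal.ofReal_rpow_half_sq hsρ0, ENNReal.sqrt_sq]

/-- The short variation of a function with cancellation at scale `s`. -/
lemma exists_qVariation_sq_le_of_cancel (h : CoarseAnnular m r₀ ε K) (Λ : ℝ) : ∃ C : ℝ≥0,
    ∀ f : G → ℂ, Measurable f → BallIntegrable m f → ∀ x s ρ R R', 2 * r₀ ≤ ρ → 0 < s → 3 * s ≤ ρ →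
      R + s ≤ R' → R' ≤ Λ * ρ →
      (∀ r ∈ Ico ρ R, ‖∫ y in closedBall x r, f y ∂m‖ₑ ≤
        ∫⁻ y in closedBall x (r + s) \ closedBall x (r - s), ‖f y‖ₑ ∂m) →
      qVariation 2 (Ico ρ R) (fun r => ballAverage m r f x) ^ 2 ≤
        C * ENNReal.ofReal ((s / ρ) ^ (ε / 2)) * ballLAverage m R' (fun y => ‖f y‖ₑ ^ 2) x := by
  obtain ⟨C1, hC1⟩ := h.exists_annulus_average_le Λ
  obtain ⟨C2, -, hC2⟩ := h.exists_qVariation_one_le Λ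
  have hr₀ := h.r₀_pos
  refine ⟨2 * C1 * C2, fun f hf hfB x s ρ R R' hρ hs hsρ hR hR' hc => ?_⟩
  set X := ballLAverage m R' (fun y => ‖f y‖ₑ ^ 2) x ^ (1 / 2 : ℝ) with hX
  have hX2 : X ^ 2 = ballLAverage m R' (fun y => ‖f y‖ₑ ^ 2) x := ENNReal.sqrt_sq _
  -- The whole gain is in the supremum of the averages; the total variation is merely bounded.
  have hS : ∀ r ∈ Ico ρ R, ‖ballAverage m r f x‖ₑ ≤ C1 * ENNReal.ofReal ((s / ρ) ^ (ε / 2)) * X := by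
    intro r hr
    rw [ballAverage_eq, enorm_smul, enorm_inv_measureReal (h.pos' x (by linarith [hr.1]))
      (h.lt_top x r).ne]
    refine le_trans (by gcongr; exact hc r hr)
      (hC1 _ hf.enorm x s ρ r R' hρ hs hsρ hr.1 (by linarith [hr.2]) hR')
  have hV : qVariation 1 (Ico ρ R) (fun r => ballAverage m r f x) ≤ C2 * X := by
    refine (hC2 f hfB x x ρ R R' (by linarith) (by rw [dist_self]; linarith)
      (by rw [dist_self]; linarith)).trans ?_
    gcongr
    apply ENNReal.le_of_sq_le_sq
    rw [hX2]
    exact ballLAverage_sq_le h.lt_top hf.enorm _ _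
  refine (qVariation_two_sq_le hS hV).trans (le_of_eq ?_)
  rw [← hX2]; push_cast; ring

/-- The short variation of a function with cancellation at scale `s` and controlled density. -/
lemma exists_qVariation_sq_le_of_cancel_of_density (h : CoarseAnnular m r₀ ε K) (Λ : ℝ) : ∃ C : ℝ≥0,
    ∀ f : G → ℂ, BallIntegrable m f → ∀ (l : ℝ≥0∞) x s ρ R, 2 * r₀ ≤ ρ → 0 < s → 3 * s ≤ ρ →
      R ≤ Λ * ρ →
      (∀ r ∈ Ico ρ R, ‖∫ y in closedBall x r, f y ∂m‖ₑ ≤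
        l * m (closedBall x (r + s) \ closedBall x (r - s))) →
      qVariation 2 (Ico ρ R) (fun r => ballAverage m r f x) ^ 2 ≤
        C * ENNReal.ofReal ((s / ρ) ^ ε) * l * ballLAverage m R (fun y => ‖f y‖ₑ) x := by
  obtain ⟨C2, -, hC2⟩ := h.exists_qVariation_one_le Λ
  have hr₀ := h.r₀_pos
  have hK := h.K_nonneg
  refine ⟨2 * (4 * K).toNNReal * C2, fun f hfB l x s ρ R hρ hs hsρ hR hc => ?_⟩
  -- The density `l` takes the place of Cauchy–Schwarz. One factor becomes `l`, so the final bound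
  -- is linear in `‖f‖` and usable for integrable functions.
  have hS : ∀ r ∈ Ico ρ R, ‖ballAverage m r f x‖ₑ ≤
      ENNReal.ofReal (4 * K) * ENNReal.ofReal ((s / ρ) ^ ε) * l := by
    intro r hr
    have hr1 := hr.1
    have hB0 := h.pos' x (r := r) (by linarith)
    have hBt := (h.lt_top x r).ne
    rw [ballAverage_eq, enorm_smul, enorm_inv_measureReal hB0 hBt]
    calc _ ≤ (m (closedBall x r))⁻¹ * (l * (ENNReal.ofReal (4 * K * (s / ρ) ^ ε)
          * m (closedBall x r))) := by
          gcongr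
          refine (hc r hr).trans ?_
          gcongr
          refine (h.measure_annulus_le x (by linarith) hs (by linarith)).trans ?_
          have := h.ε_pos
          have : 0 < r := by linarith
          have : 0 < ρ := by linarith
          gcongr
      _ = (ENNReal.ofReal (4 * K * (s / ρ) ^ ε) * l) * ((m (closedBall x r))⁻¹ *
            m (closedBall x r)) := by ring
      _ = _ := by
        rw [ENNReal.inv_mul_cancel hB0 hBt, mul_one, ENNReal.ofReal_mul (by positivity)]
  have hV := hC2 f hfB x x ρ R R (by linarith) (by rw [dist_self]; linarith)
      (by rw [dist_self]; linarith)
  refine (qVariation_two_sq_le hS hV).trans (le_of_eq ?_)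
  rw [ENNReal.ofReal]; push_cast; ring

/-- The short variation of the difference of the averages at two nearby points. -/
lemma exists_qVariation_sub_sq_le (h : CoarseAnnular m r₀ ε K) (Λ : ℝ) : ∃ C : ℝ≥0,
    ∀ f : G → ℂ, Measurable f → BallIntegrable m f → ∀ x x' s ρ R, 2 * r₀ ≤ ρ → 0 < s → 3 * s ≤ ρ →
      ρ ≤ R → R ≤ Λ * ρ → dist x x' ≤ s →
      qVariation 2 (Ico ρ R) (fun r => ballAverage m r f x - ballAverage m r f x') ^ 2 ≤
        C * ENNReal.ofReal ((s / ρ) ^ (ε / 2)) * ballLAverage m (3 * R) (fun y => ‖f y‖ₑ ^ 2) x := by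
  obtain ⟨C1, hC1⟩ := h.exists_annulus_average_le (3 * Λ)
  obtain ⟨C2, -, hC2⟩ := h.exists_qVariation_one_le (3 * Λ + 1)
  obtain ⟨D, hD1, hD⟩ := h.exists_doubling (3 * Λ + 1)
  have hr₀ := h.r₀_pos
  have hK := h.K_nonneg
  have hε := h.ε_pos
  refine ⟨2 * (C1 + (4 * K).toNNReal * D) * (C2 + C2),
    fun f hf hfB x x' s ρ R hρ hs hsρ hρR hR hxx => ?_⟩
  set X := ballLAverage m (3 * R) (fun y => ‖f y‖ₑ ^ 2) x ^ (1 / 2 : ℝ) with hX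
  have hX2 : X ^ 2 = ballLAverage m (3 * R) (fun y => ‖f y‖ₑ ^ 2) x := ENNReal.sqrt_sq _
  have hXl : ballLAverage m (3 * R) (fun y => ‖f y‖ₑ) x ≤ X := by
    apply ENNReal.le_of_sq_le_sq
    rw [hX2]
    exact ballLAverage_sq_le h.lt_top hf.enorm _ _
  set t := ENNReal.ofReal ((s / ρ) ^ (ε / 2)) with ht
  have hρ0 : 0 < ρ := by linarith
  have hS : ∀ r ∈ Ico ρ R, ‖ballAverage m r f x - ballAverage m r f x'‖ₑ ≤
      (C1 + ENNReal.ofReal (4 * K) * D) * t * X := by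
    intro r hr
    have hr1 := hr.1
    have hr2 := hr.2
    set B := closedBall x r
    set B' := closedBall x' r
    set A := closedBall x (r + s) \ closedBall x (r - s) with hA
    have hAm : MeasurableSet A := measurableSet_closedBall.diff measurableSet_closedBall
    have hB0 : m B ≠ 0 := h.pos' x (by linarith)
    have hBt : m B ≠ ∞ := (h.lt_top x r).ne
    have hB0' : m B' ≠ 0 := h.pos' x' (by linarith)
    have hBt' : m B' ≠ ∞ := (h.lt_top x' r).ne
    have hMB : 0 < m.real B := ENNReal.toReal_pos hB0 hBt
    have hMB' : 0 < m.real B' := ENNReal.toReal_pos hB0' hBt'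
    -- Since the centres are at distance at most `s`, the two balls of radius `r` differ only inside
    -- `A`.
    have hsub1 : B \ B' ⊆ A := fun y hy => by
      have h1 : dist y x ≤ r := hy.1
      have h2 : ¬ dist y x' ≤ r := hy.2
      refine ⟨mem_closedBall.2 (by linarith), fun h3 => h2 ?_⟩
      have := dist_triangle y x x'
      rw [mem_closedBall] at h3
      linarith
    have hsub2 : B' \ B ⊆ A := fun y hy => by
      have h1 : dist y x' ≤ r := hy.1
      have h2 : ¬ dist y x ≤ r := hy.2
      refine ⟨mem_closedBall.2 ?_, fun h3 => h2 ?_⟩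
      · have := dist_triangle y x' x
        rw [dist_comm x' x] at this
        linarith
      · rw [mem_closedBall] at h3
        linarith
    have hdiff : ∀ {E : Type} [NormedAddCommGroup E] [NormedSpace ℝ E] (g : G → E),
        (∀ x r, IntegrableOn g (closedBall x r) m) →
        ‖(∫ y in B, g y ∂m) - ∫ y in B', g y ∂m‖ₑ ≤ ∫⁻ y in A, ‖g y‖ₑ ∂m := by
      intro E _ _ g hg
      rw [← integral_indicator measurableSet_closedBall, ← integral_indicator measurableSet_closedBall,
        ← integral_sub ((integrable_indicator_iff measurableSet_closedBall).2 (hg _ _))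
          ((integrable_indicator_iff measurableSet_closedBall).2 (hg _ _)),
        ← lintegral_indicator hAm]
      refine (enorm_integral_le_lintegral_enorm _).trans (lintegral_mono fun y => ?_)
      by_cases h1 : y ∈ B <;> by_cases h2 : y ∈ B'
      · simp [B, B', indicator_of_mem h1, indicator_of_mem h2]
      · rw [indicator_of_mem h1, indicator_of_notMem h2, indicator_of_mem (hsub1 ⟨h1, h2⟩), sub_zero]
      · rw [indicator_of_notMem h1, indicator_of_mem h2, indicator_of_mem (hsub2 ⟨h2, h1⟩), zero_sub,
          enorm_neg]
      · simp [B, B', indicator_of_notMem h1, indicator_of_notMem h2]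
    have d1 := hdiff f hfB
    have d2 : ‖m.real B - m.real B'‖ₑ ≤ m A := by
      have := hdiff (fun _ => (1 : ℝ)) (fun x r => integrableOn_const (h.lt_top x r).ne)
      simpa using this
    -- The difference of the integrals, and the difference of the normalisations times the average
    -- at `x'`. Both are controlled by `A`, the second through the case `f = 1`.
    have e : ballAverage m r f x - ballAverage m r f x' =
        (m.real B)⁻¹ • ((∫ y in B, f y ∂m) - ∫ y in B', f y ∂m) -
        ((m.real B)⁻¹ * (m.real B - m.real B')) • ((m.real B')⁻¹ • ∫ y in B', f y ∂m) := by
      have e1 : ballAverage m r f x = (m.real B)⁻¹ • ∫ y in B, f y ∂m := ballAverage_eq m r f x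
      have e2 : ballAverage m r f x' = (m.real B')⁻¹ • ∫ y in B', f y ∂m := ballAverage_eq m r f x'
      rw [e1, e2, smul_sub, smul_smul, sub_sub, ← add_smul]
      congr 2
      field_simp
      ring
    have hlast : ‖(m.real B')⁻¹ • ∫ y in B', f y ∂m‖ₑ ≤ D * X := by
      rw [enorm_smul, enorm_inv_measureReal hB0' hBt']
      calc _ ≤ (D * (m (closedBall x (3 * R)))⁻¹) * ∫⁻ y in closedBall x (3 * R), ‖f y‖ₑ ∂m := by
            gcongr
            · exact ENNReal.inv_le_const_mul_inv (by positivity) (hD x' x r (3 * R) (by linarith) (by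
                have : 0 ≤ Λ := by
                  by_contra hΛ
                  nlinarith
                rw [dist_comm]; nlinarith))
            · refine (enorm_integral_le_lintegral_enorm _).trans (lintegral_mono_set ?_)
              refine closedBall_subset_closedBall' ?_
              rw [dist_comm]; linarith
        _ = D * ballLAverage m (3 * R) (fun y => ‖f y‖ₑ) x := by rw [ballLAverage]; ring
        _ ≤ _ := by gcongr
    have hmA : (m B)⁻¹ * m A ≤ ENNReal.ofReal (4 * K) * t := by
      have hsρ : s / ρ ≤ 1 := (div_le_one hρ0).2 (by linarith)
      have hsρ0 : 0 < s / ρ := div_pos hs hρ0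
      have : m A ≤ ENNReal.ofReal (4 * K * (s / ρ) ^ (ε / 2)) * m B := by
        refine (h.measure_annulus_le x (by linarith) hs (by linarith)).trans ?_
        gcongr
        calc (s / r) ^ ε ≤ (s / ρ) ^ ε := by
              have : 0 < r := by linarith
              gcongr
          _ ≤ _ := Real.rpow_le_rpow_of_exponent_ge hsρ0 hsρ (by linarith)
      calc _ ≤ (m B)⁻¹ * (ENNReal.ofReal (4 * K * (s / ρ) ^ (ε / 2)) * m B) := by gcongr
        _ = ENNReal.ofReal (4 * K * (s / ρ) ^ (ε / 2)) * ((m B)⁻¹ * m B) := by ring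
        _ = _ := by
          rw [ENNReal.inv_mul_cancel hB0 hBt, mul_one, ENNReal.ofReal_mul (by positivity)]
    rw [e]
    refine enorm_sub_le.trans ?_
    rw [enorm_smul, enorm_smul, enorm_mul, enorm_inv_measureReal hB0 hBt]
    calc _ ≤ (m B)⁻¹ * (∫⁻ y in A, ‖f y‖ₑ ∂m) + ((m B)⁻¹ * m A) * (D * X) := by
          gcongr
      _ ≤ C1 * t * X + (ENNReal.ofReal (4 * K) * t) * (D * X) := by
          refine add_le_add ?_ (mul_le_mul_left hmA _)
          exact hC1 _ hf.enorm x s ρ r (3 * R) hρ hs hsρ hr.1 (by linarith) (by linarith)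
      _ = _ := by ring
  have hV : qVariation 1 (Ico ρ R) (fun r => ballAverage m r f x - ballAverage m r f x') ≤
      (C2 + C2) * X := by
    refine (qVariation_one_sub_le _ _).trans ?_
    rw [add_mul]
    refine add_le_add ((hC2 f hfB x x ρ R (3 * R) (by linarith) ?_ ?_).trans (by gcongr))
      ((hC2 f hfB x x' ρ R (3 * R) (by linarith) ?_ ?_).trans (by gcongr))
    · rw [dist_self]; linarith
    · rw [dist_self]; linarith
    · linarith
    · linarith
  refine (qVariation_two_sq_le hS hV).trans (le_of_eq ?_)
  rw [← hX2, ENNReal.ofReal]; push_cast; ring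

end CoarseAnnular

end

section

/-! ### Nested partitions into cubes -/

/-- A nested sequence of countable measurable partitions of `G` into cubes of size comparable to
`a * δ ^ k`. The cubes of generation `k` are the fibres of the map `π k`, which sends a point to the
centre of its cube. -/
structure CubeSystem (G : Type*) [MetricSpace G] [MeasurableSpace G] (a δ : ℝ) where
  π : ℕ → G → G
  measurableSet_fiber : ∀ k z, MeasurableSet (π k ⁻¹' {z})
  countable_range : ∀ k, (range (π k)).Countable
  succ : ∀ k x y, π k x = π k y → π (k + 1) x = π (k + 1) y
  dist_le : ∀ k x, dist x (π k x) ≤ 5 / 4 * (a * δ ^ k)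
  inner : ∀ k x y, dist y (π k x) ≤ a * δ ^ k / 3 → π k y = π k x

section Existence

variable {G : Type*} [MetricSpace G]

/-- Maximality among separated sets makes the set a net; it is countable because the balls of radius
`σ / 2` about its points are disjoint open sets. -/
lemma exists_maximal_separated [SecondCountableTopology G] {σ : ℝ} (hσ : 0 < σ) :
    ∃ Z : Set G, Z.Countable ∧ (∀ z ∈ Z, ∀ w ∈ Z, z ≠ w → σ ≤ dist z w) ∧
      ∀ x, ∃ z ∈ Z, dist x z ≤ σ := by
  obtain ⟨Z, hZ⟩ := zorn_subset {S : Set G | S.Pairwise fun z w => σ ≤ dist z w} (by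
    intro c hc hch
    refine ⟨⋃₀ c, ?_, fun s hs => subset_sUnion_of_mem hs⟩
    exact (pairwise_sUnion hch.directedOn).2 fun s hs => hc hs)
  have hsep : Z.Pairwise fun z w => σ ≤ dist z w := hZ.prop
  refine ⟨Z, ?_, fun z hz w hw hne => hsep hz hw hne, fun x => ?_⟩
  · have hd : Z.PairwiseDisjoint fun z => ball z (σ / 2) := by
      intro z hz w hw hne
      exact ball_disjoint_ball (by linarith [hsep hz hw hne])
    exact hd.countable_of_isOpen (fun z _ => isOpen_ball) fun z _ => ⟨z, mem_ball_self (by linarith)⟩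
  · by_contra! hx
    have hx' : x ∉ Z := fun h => by
      have := hx x h
      rw [dist_self] at this
      linarith
    have : insert x Z ⊆ Z := hZ.2 ((pairwise_insert_of_notMem hx').2 ⟨hsep, fun w hw =>
      ⟨(hx w hw).le, by rw [dist_comm]; exact (hx w hw).le⟩⟩) (subset_insert _ _)
    exact hx' (this (mem_insert _ _))

/-- A point within `σ / 2` of a net point is sent there, unambiguously by separation; any other
point is sent to the first net point within `σ` in an enumeration. The first rule keeps a ball about
each chosen centre inside its own cell. -/
lemma exists_center_selection [Nonempty G] [SecondCountableTopology G] [MeasurableSpace G]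
    [OpensMeasurableSpace G] {σ : ℝ} (hσ : 0 < σ) :
    ∃ f : G → G, (∀ z, MeasurableSet (f ⁻¹' {z})) ∧ (range f).Countable ∧ (∀ x, dist x (f x) ≤ σ) ∧
      ∀ x y, dist y (f x) < σ / 2 → f y = f x := by
  obtain ⟨Z, hZc, hZs, hZd⟩ := exists_maximal_separated (G := G) hσ
  have hne : Z.Nonempty := by
    obtain ⟨z, hz, -⟩ := hZd (Classical.arbitrary G)
    exact ⟨z, hz⟩
  obtain ⟨e, rfl⟩ := hZc.exists_eq_range hne
  set p : G → ℕ → Prop := fun x j => dist x (e j) < σ / 2 ∨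
    ((∀ i, σ / 2 ≤ dist x (e i)) ∧ dist x (e j) ≤ σ) with hp
  have hex : ∀ x, ∃ j, p x j := by
    intro x
    by_cases h : ∃ j, dist x (e j) < σ / 2
    · exact h.imp fun j hj => Or.inl hj
    · push Not at h
      obtain ⟨_, ⟨j, rfl⟩, hj⟩ := hZd x
      exact ⟨j, Or.inr ⟨h, hj⟩⟩
  classical
  have hmeas : Measurable fun x => Nat.find (hex x) := by
    refine measurable_find hex fun j => ?_
    have hd : ∀ i, Measurable fun x => dist x (e i) := fun i => measurable_id.dist measurable_const
    refine MeasurableSet.union (measurableSet_lt (hd j) measurable_const) ?_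
    refine MeasurableSet.inter ?_ (measurableSet_le (hd j) measurable_const)
    have : {x | ∀ i, σ / 2 ≤ dist x (e i)} = ⋂ i, {x | σ / 2 ≤ dist x (e i)} := by
      ext; simp
    change MeasurableSet {x | ∀ i, σ / 2 ≤ dist x (e i)}
    rw [this]
    exact MeasurableSet.iInter fun i => measurableSet_le measurable_const (hd i)
  refine ⟨fun x => e (Nat.find (hex x)), fun z => ?_, ?_, fun x => ?_, fun x y hxy => ?_⟩
  · exact hmeas (MeasurableSet.of_discrete (s := {n | e n = z}))
  · exact (countable_range e).mono (range_subset_iff.2 fun x => mem_range_self _)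
  · rcases Nat.find_spec (hex x) with h | h
    · linarith
    · exact h.2
  · rcases Nat.find_spec (hex y) with h | h
    · by_contra hne
      have h1 := hZs _ (mem_range_self (Nat.find (hex y))) _ (mem_range_self (Nat.find (hex x))) hne
      have := dist_triangle_left (e (Nat.find (hex y))) (e (Nat.find (hex x))) y
      linarith
    · exact absurd hxy (not_lt.2 (h.1 _))

/-- The centre of generation `k + 1` is selected as a function of the centre of generation `k`, so
nestedness is automatic. Since `δ ≥ 18`, the accumulated displacements stay within `5 / 4` of the
current scale, and `5 / 72 + 1 / 3 < 1 / 2` keeps the inner ball in its cube. -/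
lemma exists_cubeSystem [Nonempty G] [SecondCountableTopology G] [MeasurableSpace G]
    [OpensMeasurableSpace G] {a δ : ℝ} (ha : 0 < a) (hδ : 18 ≤ δ) : Nonempty (CubeSystem G a δ) := by
  have hs : ∀ k : ℕ, 0 < a * δ ^ k := fun k => by positivity
  choose f hf1 hf2 hf3 hf4 using fun k => exists_center_selection (G := G) (hs k)
  let π : ℕ → G → G := fun k => Nat.rec (f 0) (fun k g => f (k + 1) ∘ g) k
  have hπ : ∀ k, π (k + 1) = f (k + 1) ∘ π k := fun k => rfl
  have hcount : ∀ k, (range (π k)).Countable := by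
    intro k
    cases k with
    | zero => exact hf2 0
    | succ k => exact (hf2 (k + 1)).mono (by rw [hπ]; exact range_comp_subset_range _ _)
  have hstep : ∀ k : ℕ, 18 * (a * δ ^ k) ≤ a * δ ^ (k + 1) := fun k => by
    rw [pow_succ]; nlinarith [hs k]
  have hdist : ∀ k x, dist x (π k x) ≤ 5 / 4 * (a * δ ^ k) := by
    intro k
    induction k with
    | zero => exact fun x => (hf3 0 x).trans (by linarith [hs 0])
    | succ k ih =>
      intro x
      have h1 := ih x
      have h2 := hf3 (k + 1) (π k x)
      have h3 := dist_triangle x (π k x) (f (k + 1) (π k x))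
      rw [hπ]
      simp only [Function.comp]
      linarith [hstep k, hs (k + 1)]
  have hmeas : ∀ k, ∀ S : Set G, MeasurableSet (π k ⁻¹' S) := by
    have hred : ∀ k, (∀ z, MeasurableSet (π k ⁻¹' {z})) → ∀ S : Set G, MeasurableSet (π k ⁻¹' S) := by
      intro k hk S
      have : π k ⁻¹' S = ⋃ z ∈ range (π k) ∩ S, π k ⁻¹' {z} := by
        ext x; simp
      rw [this]
      exact MeasurableSet.biUnion ((hcount k).mono inter_subset_left) fun z _ => hk z
    intro k
    induction k with
    | zero => exact hred 0 (hf1 0)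
    | succ k ih =>
      intro S
      rw [hπ, preimage_comp]
      exact ih _
  refine ⟨⟨π, fun k z => hmeas k {z}, hcount, fun k x y h => by simp [hπ, h], hdist, ?_⟩⟩
  intro k x y h
  cases k with
  | zero => exact hf4 0 x y (by
      have : dist y (f 0 x) ≤ a * δ ^ 0 / 3 := h
      linarith [hs 0])
  | succ k =>
    refine hf4 (k + 1) (π k x) (π k y) ?_
    have h1 := hdist k y
    have h2 : dist y (f (k + 1) (π k x)) ≤ a * δ ^ (k + 1) / 3 := h
    have h3 := dist_triangle_left (π k y) (f (k + 1) (π k x)) y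
    linarith [hstep k, hs (k + 1)]

end Existence

namespace CubeSystem

variable {G : Type*} [MetricSpace G] [MeasurableSpace G] {a δ : ℝ} (𝒟 : CubeSystem G a δ)

/-- The cube of generation `k` that contains `x`. -/
def cube (k : ℕ) (x : G) : Set G := 𝒟.π k ⁻¹' {𝒟.π k x}

lemma measurableSet_preimage (k : ℕ) (S : Set G) : MeasurableSet (𝒟.π k ⁻¹' S) := by
  have : 𝒟.π k ⁻¹' S = ⋃ z ∈ range (𝒟.π k) ∩ S, 𝒟.π k ⁻¹' {z} := by
    ext x; simp
  rw [this]
  exact MeasurableSet.biUnion ((𝒟.countable_range k).mono inter_subset_left)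
    fun z _ => 𝒟.measurableSet_fiber k z

lemma measurableSet_cube (k : ℕ) (x : G) : MeasurableSet (𝒟.cube k x) := 𝒟.measurableSet_fiber k _

lemma mem_cube_self (k : ℕ) (x : G) : x ∈ 𝒟.cube k x := rfl

lemma eq_of_le {j k : ℕ} (h : j ≤ k) {x y : G} (hxy : 𝒟.π j x = 𝒟.π j y) : 𝒟.π k x = 𝒟.π k y := by
  induction k, h using Nat.le_induction with
  | base => exact hxy
  | succ k _ ih => exact 𝒟.succ k x y ih

/-- A function is constant on the cubes of generation `k`. -/
def IsConst {β : Type*} (k : ℕ) (W : G → β) : Prop := ∀ x y, 𝒟.π k x = 𝒟.π k y → W x = W y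

variable {𝒟}

lemma IsConst.of_le {β : Type*} {j k : ℕ} (h : j ≤ k) {W : G → β} (hW : 𝒟.IsConst k W) :
    𝒟.IsConst j W := fun x y hxy => hW x y (𝒟.eq_of_le h hxy)

/-- There are countably many cubes, so every union of cubes of one generation is measurable. -/
lemma IsConst.measurable {β : Type*} [MeasurableSpace β] {k : ℕ} {W : G → β} (hW : 𝒟.IsConst k W) :
    Measurable W := by
  intro S _
  have : W ⁻¹' S = 𝒟.π k ⁻¹' (𝒟.π k '' (W ⁻¹' S)) := by
    refine subset_antisymm (subset_preimage_image _ _) ?_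
    rintro x ⟨y, hy, hyx⟩
    rw [mem_preimage, ← hW y x hyx]
    exact hy
  rw [this]
  exact 𝒟.measurableSet_preimage k _

lemma IsConst.measurableSet {k : ℕ} {p : G → Prop} (hp : 𝒟.IsConst k p) : MeasurableSet {x | p x} :=
  measurableSet_setOfPred.2 hp.measurable

variable (𝒟)

/-- The integral as a sum over cubes. -/
lemma setLIntegral_eq_tsum (m : Measure G) (k : ℕ) {S : Set G} (hS : 𝒟.IsConst k (· ∈ S))
    (u : G → ℝ≥0∞) : ∫⁻ x in S, u x ∂m =
      ∑' z : (𝒟.π k '' S), ∫⁻ x in 𝒟.π k ⁻¹' {z.1}, u x ∂m := by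
  have : Countable (𝒟.π k '' S) := ((𝒟.countable_range k).mono (image_subset_range _ _)).to_subtype
  have hSe : S = ⋃ z : (𝒟.π k '' S), 𝒟.π k ⁻¹' {z.1} := by
    ext x
    simp only [iUnion_coe_set, mem_iUnion, mem_preimage, mem_singleton_iff, exists_prop]
    constructor
    · exact fun hx => ⟨_, ⟨x, hx, rfl⟩, rfl⟩
    · rintro ⟨_, ⟨y, hy, rfl⟩, hxy⟩
      have := hS x y hxy
      exact this.mpr hy
  conv_lhs => rw [hSe]
  refine lintegral_iUnion (fun z => 𝒟.measurableSet_fiber k _) ?_ u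
  intro z w hzw
  exact (disjoint_singleton.2 fun h => hzw (Subtype.ext h)).preimage _

/-- Comparison of integrals over all cubes of a generation. -/
lemma lintegral_mul_le_of_cube_le {m : Measure G} {k : ℕ} {u v W : G → ℝ≥0∞} (hu : Measurable u)
    (hv : Measurable v) (hW : 𝒟.IsConst k W)
    (h : ∀ x, ∫⁻ y in 𝒟.cube k x, u y ∂m ≤ ∫⁻ y in 𝒟.cube k x, v y ∂m) :
    ∫⁻ x, W x * u x ∂m ≤ ∫⁻ x, W x * v x ∂m := by
  rw [← setLIntegral_univ, ← setLIntegral_univ (fun x => W x * v x),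
    𝒟.setLIntegral_eq_tsum m k (fun _ _ _ => rfl), 𝒟.setLIntegral_eq_tsum m k (fun _ _ _ => rfl)]
  refine ENNReal.tsum_le_tsum ?_
  rintro ⟨_, ⟨x, -, rfl⟩⟩
  have key : ∀ u : G → ℝ≥0∞, Measurable u → ∫⁻ y in 𝒟.π k ⁻¹' {𝒟.π k x}, W y * u y ∂m =
      W x * ∫⁻ y in 𝒟.cube k x, u y ∂m := fun u hu => by
    rw [← lintegral_const_mul _ hu]
    refine setLIntegral_congr_fun (𝒟.measurableSet_fiber k _) fun y hy => ?_
    rw [hW y x hy]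
  dsimp only
  rw [key u hu, key v hv]
  exact mul_le_mul' le_rfl (h x)

lemma lintegral_le_of_cube_le {m : Measure G} {k : ℕ} {u v : G → ℝ≥0∞} (hu : Measurable u)
    (hv : Measurable v)
    (h : ∀ x, ∫⁻ y in 𝒟.cube k x, u y ∂m ≤ ∫⁻ y in 𝒟.cube k x, v y ∂m) :
    ∫⁻ x, u x ∂m ≤ ∫⁻ x, v x ∂m := by
  simpa using 𝒟.lintegral_mul_le_of_cube_le hu hv (W := fun _ => 1) (fun _ _ _ => rfl) h

end CubeSystem

end

/-! ### Cubes, mean-zero functions and the variation at one scale. -/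

section

variable {G : Type*} [MetricSpace G] [MeasurableSpace G] [OpensMeasurableSpace G]

/-- The short variation at the `i`-th scale of the sequence `a * δ ^ i`. -/
def scaleVariation (m : Measure G) (a δ : ℝ) (i : ℕ) (f : G → ℂ) (x : G) : ℝ≥0∞ :=
  qVariation 2 (Ico (a * δ ^ (i + 1)) (a * δ ^ (i + 2))) (fun r => ballAverage m r f x)

/-- The standing assumptions relating the scales `a * δ ^ k` to the scale `r₀`. -/
structure GoodScales (a δ r₀ : ℝ) : Prop where
  r₀_pos : 0 < r₀
  le_a : 18 * r₀ ≤ a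
  le_δ : 18 ≤ δ

namespace GoodScales

variable {a δ r₀ : ℝ} (hs : GoodScales a δ r₀)
include hs

lemma a_pos : 0 < a := by linarith [hs.r₀_pos, hs.le_a]

lemma scale_pos (k : ℕ) : 0 < a * δ ^ k := by
  have := hs.a_pos; have := hs.le_δ; positivity

lemma le_scale (k : ℕ) : 18 * r₀ ≤ a * δ ^ k :=
  hs.le_a.trans (le_mul_of_one_le_right hs.a_pos.le (one_le_pow₀ (by linarith [hs.le_δ])))

lemma scale_succ (k : ℕ) : 18 * (a * δ ^ k) ≤ a * δ ^ (k + 1) := by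
  rw [pow_succ]; nlinarith [hs.scale_pos k, hs.le_δ]

lemma scale_mono {j k : ℕ} (h : j ≤ k) : a * δ ^ j ≤ a * δ ^ k :=
  mul_le_mul_of_nonneg_left (pow_le_pow_right₀ (by linarith [hs.le_δ]) h) hs.a_pos.le

lemma scale_lt {j k : ℕ} (h : j < k) : 18 * (a * δ ^ j) ≤ a * δ ^ k :=
  (hs.scale_succ j).trans (hs.scale_mono h)

/-- Turns the annular gain into geometric decay in `i - k`. A surplus factor `δ⁻¹` is dropped, and
`t ^ (ε / 2) ≤ t` because `t ≥ 1` and `ε ≤ 1`. -/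
lemma ratio_rpow_le {ε : ℝ} (hε : 0 < ε) (hε1 : ε ≤ 1) {k i : ℕ} (hki : k ≤ i) {t : ℝ} (ht : 1 ≤ t) :
    ENNReal.ofReal ((t * (a * δ ^ k) / (a * δ ^ (i + 1))) ^ (ε / 2)) ≤
      ENNReal.ofReal t * ((δ ^ (-(ε / 2))).toNNReal : ℝ≥0∞) ^ (i - k) := by
  have ha := hs.a_pos
  have hδ : 0 < δ := by linarith [hs.le_δ]
  rw [← ENNReal.ofReal, ← ENNReal.ofReal_pow (by positivity), ← ENNReal.ofReal_mul (by positivity)]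
  refine ENNReal.ofReal_le_ofReal ?_
  have e : t * (a * δ ^ k) / (a * δ ^ (i + 1)) ≤ t * (δ⁻¹) ^ (i - k) := by
    rw [show t * (a * δ ^ k) / (a * δ ^ (i + 1)) = t * (δ ^ k / δ ^ (i + 1)) by field_simp]
    gcongr
    obtain ⟨d, rfl⟩ := Nat.exists_eq_add_of_le hki
    rw [Nat.add_sub_cancel_left, inv_pow, div_le_iff₀ (by positivity), ← div_eq_inv_mul,
      le_div_iff₀ (by positivity), ← pow_add]
    exact pow_le_pow_right₀ (by linarith [hs.le_δ]) (by omega)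
  calc _ ≤ (t * (δ⁻¹) ^ (i - k)) ^ (ε / 2) := by gcongr
    _ = t ^ (ε / 2) * (δ ^ (-(ε / 2))) ^ (i - k) := by
        rw [Real.mul_rpow (by linarith) (by positivity), ← Real.rpow_natCast, ← Real.rpow_natCast,
          Real.rpow_neg hδ.le, ← Real.inv_rpow hδ.le, ← Real.rpow_mul (by positivity),
          ← Real.rpow_mul (by positivity), mul_comm (ε / 2)]
    _ ≤ t ^ (1 : ℝ) * (δ ^ (-(ε / 2))) ^ (i - k) := by
        gcongr
        linarith
    _ = _ := by rw [Real.rpow_one]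

end GoodScales

namespace CubeSystem

variable {a δ : ℝ} (𝒟 : CubeSystem G a δ)

/-- The average over the cube of generation `k` that contains `x`. -/
def average (m : Measure G) (k : ℕ) (f : G → ℂ) (x : G) : ℂ := ⨍ y in 𝒟.cube k x, f y ∂m

/-- The average over the cube of generation `k` that contains `x`, for `[0, ∞]`-valued functions. -/
def laverage (m : Measure G) (k : ℕ) (u : G → ℝ≥0∞) (x : G) : ℝ≥0∞ :=
  (m (𝒟.cube k x))⁻¹ * ∫⁻ y in 𝒟.cube k x, u y ∂m

/-- All means over cubes of generation `k` vanish. -/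
def MeanZero (m : Measure G) (k : ℕ) (f : G → ℂ) : Prop := ∀ x, ∫ y in 𝒟.cube k x, f y ∂m = 0

lemma cube_eq {k : ℕ} {x y : G} (h : 𝒟.π k x = 𝒟.π k y) : 𝒟.cube k x = 𝒟.cube k y := by
  rw [cube, cube, h]

lemma isConst_average (m : Measure G) (k : ℕ) (f : G → ℂ) : 𝒟.IsConst k (𝒟.average m k f) :=
  fun x y h => by rw [average, average, 𝒟.cube_eq h]

lemma isConst_laverage (m : Measure G) (k : ℕ) (u : G → ℝ≥0∞) : 𝒟.IsConst k (𝒟.laverage m k u) :=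
  fun x y h => by rw [laverage, laverage, 𝒟.cube_eq h]

lemma dist_le_of_mem_cube {k : ℕ} {x y : G} (h : y ∈ 𝒟.cube k x) :
    dist y x ≤ 5 / 2 * (a * δ ^ k) := by
  have h1 := 𝒟.dist_le k x
  have h2 := 𝒟.dist_le k y
  rw [show 𝒟.π k y = 𝒟.π k x from h] at h2
  have := dist_triangle_right y x (𝒟.π k x)
  linarith

lemma cube_subset_closedBall (k : ℕ) (x : G) : 𝒟.cube k x ⊆ closedBall x (5 / 2 * (a * δ ^ k)) :=
  fun _ hy => 𝒟.dist_le_of_mem_cube hy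

lemma closedBall_subset_cube (k : ℕ) (x : G) :
    closedBall (𝒟.π k x) (a * δ ^ k / 3) ⊆ 𝒟.cube k x := fun y hy => 𝒟.inner k x y hy

lemma setIntegral_eq_zero {m : Measure G} {k : ℕ} {f : G → ℂ} (hf : 𝒟.MeanZero m k f) {S : Set G}
    (hS : 𝒟.IsConst k (· ∈ S)) (hfS : IntegrableOn f S m) : ∫ x in S, f x ∂m = 0 := by
  have : Countable (𝒟.π k '' S) := ((𝒟.countable_range k).mono (image_subset_range _ _)).to_subtype
  have hSe : S = ⋃ z : (𝒟.π k '' S), 𝒟.π k ⁻¹' {z.1} := by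
    ext x
    simp only [iUnion_coe_set, mem_iUnion, mem_preimage, mem_singleton_iff, exists_prop]
    constructor
    · exact fun hx => ⟨_, ⟨x, hx, rfl⟩, rfl⟩
    · rintro ⟨_, ⟨y, hy, rfl⟩, hxy⟩
      exact (hS x y hxy).mpr hy
  rw [hSe] at hfS ⊢
  rw [integral_iUnion (fun z => 𝒟.measurableSet_fiber k _) (fun z w hzw =>
    (disjoint_singleton.2 fun h => hzw (Subtype.ext h)).preimage _) hfS]
  refine (tsum_congr ?_).trans tsum_zero
  rintro ⟨_, ⟨x, -, rfl⟩⟩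
  exact hf x

lemma setLIntegral_le_mul {m : Measure G} {k : ℕ} {u : G → ℝ≥0∞} {l : ℝ≥0∞}
    (h : ∀ x, ∫⁻ y in 𝒟.cube k x, u y ∂m ≤ l * m (𝒟.cube k x)) {S : Set G}
    (hS : 𝒟.IsConst k (· ∈ S)) : ∫⁻ x in S, u x ∂m ≤ l * m S := by
  rw [← setLIntegral_one, 𝒟.setLIntegral_eq_tsum m k hS, 𝒟.setLIntegral_eq_tsum m k hS,
    ← ENNReal.tsum_mul_left]
  refine ENNReal.tsum_le_tsum ?_
  rintro ⟨_, ⟨x, -, rfl⟩⟩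
  rw [setLIntegral_one]
  exact h x

/-- Points whose cube is not contained in the ball lie near the sphere. -/
lemma exists_boundary_decomposition (hs0 : 0 < a * δ ^ (k : ℕ)) (x : G) (r : ℝ) : ∃ S T : Set G,
    𝒟.IsConst k (· ∈ S) ∧ 𝒟.IsConst k (· ∈ T) ∧ S ⊆ closedBall x r ∧ closedBall x r \ S ⊆ T ∧
    T ⊆ closedBall x (r + 5 * (a * δ ^ k)) \ closedBall x (r - 5 * (a * δ ^ k)) := by
  -- `S` is the union of the cubes inside the ball, and `T` will be the union of the cubes that meet
  -- the rest of the ball. From a point of `T`, two steps inside one cube, each of length at most `5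
  -- / 2 * (a * δ ^ k)`, lead outside the ball; hence the width `5`.
  set S : Set G := {y | 𝒟.cube k y ⊆ closedBall x r} with hS
  refine ⟨S, {y | (𝒟.cube k y ∩ (closedBall x r \ S)).Nonempty}, ?_, ?_, ?_, ?_, ?_⟩
  · intro y z hyz
    simp [hS, 𝒟.cube_eq hyz]
  · intro y z hyz
    simp [𝒟.cube_eq hyz]
  · exact fun y hy => hy (𝒟.mem_cube_self k y)
  · exact fun y hy => ⟨y, 𝒟.mem_cube_self k y, hy⟩
  · rintro y ⟨z, hz, hzB, hzS⟩
    obtain ⟨w, hw, hwB⟩ := not_subset.1 hzS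
    have h1 := 𝒟.dist_le_of_mem_cube hz
    have h2 := 𝒟.dist_le_of_mem_cube hw
    rw [mem_closedBall] at hzB hwB
    have h3 := dist_triangle_left y x z
    have h4 := dist_triangle w z x
    have h5 := dist_triangle z y x
    refine ⟨mem_closedBall.2 (by linarith), fun h6 => ?_⟩
    rw [mem_closedBall] at h6
    linarith

/-- The cubes inside the ball contribute zero, and what is left of the ball lies in the annulus. -/
lemma enorm_setIntegral_closedBall_le {m : Measure G} {k : ℕ} (hs0 : 0 < a * δ ^ k) {f : G → ℂ}
    (hf : BallIntegrable m f) (hz : 𝒟.MeanZero m k f) (x : G) (r : ℝ) :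
    ‖∫ y in closedBall x r, f y ∂m‖ₑ ≤
      ∫⁻ y in closedBall x (r + 5 * (a * δ ^ k)) \ closedBall x (r - 5 * (a * δ ^ k)), ‖f y‖ₑ ∂m := by
  obtain ⟨S, T, hS, -, hSB, hBT, hTA⟩ := 𝒟.exists_boundary_decomposition hs0 x r
  have hSm : MeasurableSet S := IsConst.measurableSet hS
  have h1 := setIntegral_sdiff hSm (hf x r) hSB
  rw [𝒟.setIntegral_eq_zero hz hS ((hf x r).mono_set hSB), sub_zero] at h1
  rw [← h1]
  exact (enorm_integral_le_lintegral_enorm _).trans (lintegral_mono_set (hBT.trans hTA))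

/-- The remainder of the ball is enlarged to a union of whole cubes, over which the density bound
can be summed. -/
lemma enorm_setIntegral_closedBall_le_of_density {m : Measure G} {k : ℕ} (hs0 : 0 < a * δ ^ k)
    {f : G → ℂ} (hf : BallIntegrable m f) (hz : 𝒟.MeanZero m k f) {l : ℝ≥0∞}
    (hl : ∀ x, ∫⁻ y in 𝒟.cube k x, ‖f y‖ₑ ∂m ≤ l * m (𝒟.cube k x)) (x : G) (r : ℝ) :
    ‖∫ y in closedBall x r, f y ∂m‖ₑ ≤
      l * m (closedBall x (r + 5 * (a * δ ^ k)) \ closedBall x (r - 5 * (a * δ ^ k))) := by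
  obtain ⟨S, T, hS, hT, hSB, hBT, hTA⟩ := 𝒟.exists_boundary_decomposition hs0 x r
  have hSm : MeasurableSet S := IsConst.measurableSet hS
  have h1 := setIntegral_sdiff hSm (hf x r) hSB
  rw [𝒟.setIntegral_eq_zero hz hS ((hf x r).mono_set hSB), sub_zero] at h1
  rw [← h1]
  calc _ ≤ ∫⁻ y in T, ‖f y‖ₑ ∂m :=
        (enorm_integral_le_lintegral_enorm _).trans (lintegral_mono_set hBT)
    _ ≤ l * m T := 𝒟.setLIntegral_le_mul hl hT
    _ ≤ _ := by gcongr

section Measure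

variable {m : Measure G} {r₀ ε K : ℝ} (h : CoarseAnnular m r₀ ε K) (hs : GoodScales a δ r₀)
include h hs

lemma measure_cube_ne_zero (k : ℕ) (x : G) : m (𝒟.cube k x) ≠ 0 := fun h0 =>
  h.pos' (𝒟.π k x) (r := a * δ ^ k / 3) (by linarith [hs.le_scale k, hs.r₀_pos])
    (measure_mono_null (𝒟.closedBall_subset_cube k x) h0)

lemma measure_cube_ne_top (k : ℕ) (x : G) : m (𝒟.cube k x) ≠ ∞ :=
  ((measure_mono (𝒟.cube_subset_closedBall k x)).trans_lt (h.lt_top _ _)).ne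

omit hs in
lemma exists_measure_closedBall_le_cube (hs : GoodScales a δ r₀) (Λ : ℝ) : ∃ C : ℝ≥0, 1 ≤ C ∧
    ∀ k x y R, dist x y + R ≤ Λ * (a * δ ^ k) → m (closedBall y R) ≤ C * m (𝒟.cube k x) := by
  obtain ⟨C, hC1, hC⟩ := h.exists_doubling (3 * (Λ + 5 / 4))
  refine ⟨C, hC1, fun k x y R hR => ?_⟩
  refine (hC (𝒟.π k x) y (a * δ ^ k / 3) R (by linarith [hs.le_scale k, hs.r₀_pos]) ?_).trans
    (by gcongr; exact 𝒟.closedBall_subset_cube k x)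
  have h1 := 𝒟.dist_le k x
  have h2 := dist_triangle_left (𝒟.π k x) y x
  linarith

/-- Short variation of functions with vanishing means over small cubes. -/
lemma exists_scaleVariation_sq_le_of_meanZero : ∃ C : ℝ≥0, ∀ f : G → ℂ, Measurable f →
    BallIntegrable m f → ∀ k i, k ≤ i → 𝒟.MeanZero m k f → ∀ x,
    scaleVariation m a δ i f x ^ 2 ≤ C * ((δ ^ (-(ε / 2))).toNNReal : ℝ≥0∞) ^ (i - k) *
      ballLAverage m (3 * (a * δ ^ (i + 2))) (fun y => ‖f y‖ₑ ^ 2) x := by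
  obtain ⟨C, hC⟩ := h.exists_qVariation_sq_le_of_cancel (3 * δ)
  refine ⟨C * 5, fun f hf hfB k i hki hz x => ?_⟩
  have hk := hs.scale_pos k
  refine (hC f hf hfB x (5 * (a * δ ^ k)) (a * δ ^ (i + 1)) (a * δ ^ (i + 2))
    (3 * (a * δ ^ (i + 2))) ?_ ?_ ?_ ?_ ?_ ?_).trans ?_
  · linarith [hs.le_scale (i + 1), hs.r₀_pos]
  · linarith
  -- The half-width `5 * (a * δ ^ k)` must be at most a third of the smallest radius. This holds by
  -- `15 ≤ 18`, as the radii of scale `i` start one generation up.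
  · linarith [hs.scale_lt (show k < i + 1 by omega)]
  · linarith [hs.scale_lt (show k < i + 2 by omega)]
  · rw [pow_succ δ (i + 1)]; linarith
  · exact fun r _ => 𝒟.enorm_setIntegral_closedBall_le hk hfB hz x r
  · have := hs.ratio_rpow_le h.ε_pos h.ε_le hki (t := 5) (by norm_num)
    refine (mul_le_mul' (mul_le_mul' le_rfl this) le_rfl).trans (le_of_eq ?_)
    push_cast
    norm_num
    ring

/-- Short variation of functions with vanishing means over small cubes and bounded density. -/
lemma exists_scaleVariation_sq_le_of_density : ∃ C : ℝ≥0, ∀ f : G → ℂ,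
    BallIntegrable m f → ∀ k i, k ≤ i → 𝒟.MeanZero m k f → ∀ l : ℝ≥0∞,
    (∀ x, ∫⁻ y in 𝒟.cube k x, ‖f y‖ₑ ∂m ≤ l * m (𝒟.cube k x)) → ∀ x,
    scaleVariation m a δ i f x ^ 2 ≤ C * ((δ ^ (-(ε / 2))).toNNReal : ℝ≥0∞) ^ (i - k) * l *
      ballLAverage m (a * δ ^ (i + 2)) (fun y => ‖f y‖ₑ) x := by
  obtain ⟨C, hC⟩ := h.exists_qVariation_sq_le_of_cancel_of_density δ
  refine ⟨C * 5, fun f hfB k i hki hz l hl x => ?_⟩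
  have hk := hs.scale_pos k
  refine (hC f hfB l x (5 * (a * δ ^ k)) (a * δ ^ (i + 1)) (a * δ ^ (i + 2)) ?_ ?_ ?_ ?_ ?_).trans ?_
  · linarith [hs.le_scale (i + 1), hs.r₀_pos]
  · linarith
  · linarith [hs.scale_lt (show k < i + 1 by omega)]
  · rw [pow_succ δ (i + 1)]; linarith
  · exact fun r _ => 𝒟.enorm_setIntegral_closedBall_le_of_density hk hfB hz hl x r
  · have := hs.ratio_rpow_le h.ε_pos h.ε_le hki (t := 5) (by norm_num)
    have hle : ENNReal.ofReal ((5 * (a * δ ^ k) / (a * δ ^ (i + 1))) ^ ε) ≤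
        ENNReal.ofReal ((5 * (a * δ ^ k) / (a * δ ^ (i + 1))) ^ (ε / 2)) := by
      refine ENNReal.ofReal_le_ofReal ?_
      have h1 := hs.scale_pos (i + 1)
      refine Real.rpow_le_rpow_of_exponent_ge (by positivity) ?_ (by linarith [h.ε_pos])
      rw [div_le_one h1]
      linarith [hs.scale_lt (show k < i + 1 by omega)]
    refine (mul_le_mul' (mul_le_mul' (mul_le_mul' le_rfl (hle.trans this)) le_rfl)
      le_rfl).trans (le_of_eq ?_)
    push_cast
    norm_num
    ring

omit [OpensMeasurableSpace G] in
lemma scaleVariation_eq_zero_of_forall (i : ℕ) {f : G → ℂ} {x : G}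
    (hf : ∀ y ∈ closedBall x (a * δ ^ (i + 2)), f y = f x) [OpensMeasurableSpace G] :
    scaleVariation m a δ i f x = 0 := by
  refine qVariation_const (c := f x) (by norm_num) fun r hr => ?_
  have hr0 : m (closedBall x r) ≠ 0 := h.pos' x (by
    linarith [hr.1, hs.le_scale (i + 1), hs.r₀_pos])
  rw [ballAverage_congr_on (g := fun _ => f x) fun y hy =>
    hf y (closedBall_subset_closedBall hr.2.le hy)]
  exact setAverage_const hr0 (h.lt_top x r).ne _

end Measure

end CubeSystem

/-- Short variation of the difference of the averages at two nearby points. -/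
lemma CoarseAnnular.exists_scale_qVariation_sub_sq_le {m : Measure G} {a δ r₀ ε K : ℝ}
    (h : CoarseAnnular m r₀ ε K) (hs : GoodScales a δ r₀) : ∃ C : ℝ≥0, ∀ f : G → ℂ, Measurable f →
    BallIntegrable m f → ∀ k i, k ≤ i → ∀ x y, dist x y ≤ 5 * (a * δ ^ k) →
    qVariation 2 (Ico (a * δ ^ (i + 1)) (a * δ ^ (i + 2)))
      (fun r => ballAverage m r f x - ballAverage m r f y) ^ 2 ≤
      C * ((δ ^ (-(ε / 2))).toNNReal : ℝ≥0∞) ^ (i - k) *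
        ballLAverage m (3 * (a * δ ^ (i + 2))) (fun y => ‖f y‖ₑ ^ 2) x := by
  obtain ⟨C, hC⟩ := h.exists_qVariation_sub_sq_le δ
  refine ⟨C * 5, fun f hf hfB k i hki x y hxy => ?_⟩
  have hk := hs.scale_pos k
  refine (hC f hf hfB x y (5 * (a * δ ^ k)) (a * δ ^ (i + 1)) (a * δ ^ (i + 2))
    ?_ ?_ ?_ ?_ ?_ hxy).trans ?_
  · linarith [hs.le_scale (i + 1), hs.r₀_pos]
  · linarith
  · linarith [hs.scale_lt (show k < i + 1 by omega)]
  · exact hs.scale_mono (Nat.le_succ _)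
  · rw [pow_succ δ (i + 1)]; linarith
  · have := hs.ratio_rpow_le h.ε_pos h.ε_le hki (t := 5) (by norm_num)
    refine (mul_le_mul' (mul_le_mul' le_rfl this) le_rfl).trans (le_of_eq ?_)
    push_cast
    norm_num
    ring

end

section

/-! ### A discrete almost orthogonality estimate -/

lemma ENNReal.sum_sq_le_weight {ι : Type*} (s : Finset ι) (w V : ι → ℝ≥0∞)
    (hw0 : ∀ k, w k ≠ 0) (hwt : ∀ k, w k ≠ ∞) :
    (∑ k ∈ s, V k) ^ 2 ≤ (∑ k ∈ s, w k) * ∑ k ∈ s, (w k)⁻¹ * V k ^ 2 := by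
  have h1 := ENNReal.inner_le_weight_mul_Lp_of_nonneg s (p := 2) (by norm_num) w
    (fun k => (w k)⁻¹ * V k)
  have e1 : ∀ k, w k * ((w k)⁻¹ * V k) = V k := fun k => by
    rw [← mul_assoc, ENNReal.mul_inv_cancel (hw0 k) (hwt k), one_mul]
  have e2 : ∀ k, w k * ((w k)⁻¹ * V k) ^ (2 : ℝ) = (w k)⁻¹ * V k ^ 2 := fun k => by
    rw [ENNReal.rpow_two, sq, ← mul_assoc, e1]; ring
  simp only [e1, e2] at h1
  calc _ ≤ ((∑ k ∈ s, w k) ^ (1 - (2 : ℝ)⁻¹) * (∑ k ∈ s, (w k)⁻¹ * V k ^ 2) ^ ((2 : ℝ)⁻¹)) ^ 2 := by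
        gcongr
    _ = _ := by
        rw [mul_pow, ← ENNReal.rpow_two, ← ENNReal.rpow_two, ← ENNReal.rpow_mul, ← ENNReal.rpow_mul]
        norm_num

/-- With truncated subtraction the exponent is `|i - k|`; each side of the diagonal is dominated by
a geometric series. -/
lemma ENNReal.sum_pow_dist_le (q : ℝ≥0∞) (i M : ℕ) :
    ∑ k ∈ Finset.range M, q ^ ((i - k) + (k - i)) ≤ 2 * (1 - q)⁻¹ := by
  have hgeom : ∀ n, ∑ k ∈ Finset.range n, q ^ k ≤ (1 - q)⁻¹ := fun n => by
    rw [← ENNReal.tsum_geometric]; exact ENNReal.sum_le_tsum _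
  calc _ ≤ ∑ k ∈ Finset.range ((i + 1) + M), q ^ ((i - k) + (k - i)) :=
        Finset.sum_le_sum_of_subset (Finset.range_mono (by omega))
    _ = ∑ k ∈ Finset.range (i + 1), q ^ ((i - k) + (k - i)) +
          ∑ k ∈ Finset.range M, q ^ ((i - (i + 1 + k)) + ((i + 1 + k) - i)) :=
        Finset.sum_range_add _ _ _
    _ ≤ (1 - q)⁻¹ + (1 - q)⁻¹ := by
        gcongr
        · rw [← Finset.sum_range_reflect]
          refine le_trans (le_of_eq (Finset.sum_congr rfl fun k hk => ?_)) (hgeom (i + 1))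
          rw [Finset.mem_range] at hk
          congr 1; omega
        · calc _ ≤ ∑ k ∈ Finset.range (M + 1), q ^ k := by
                rw [Finset.sum_range_succ']
                refine le_trans (le_of_eq (Finset.sum_congr rfl fun k _ => ?_)) le_self_add
                congr 1; omega
            _ ≤ _ := hgeom _
    _ = _ := (two_mul _).symm

/-- A Schur test. Of the decay `q ^ (2 * |i - k|)` one half pays for the weights in Cauchy–Schwarz
over `k`; the other half makes the sum over `i` converge. -/
lemma lintegral_sum_sq_le {α : Type*} [MeasurableSpace α] {μ : Measure α} {V : ℕ → ℕ → α → ℝ≥0∞}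
    (hV : ∀ i k, Measurable (V i k)) {q C : ℝ≥0∞} (hq0 : q ≠ 0) (hqt : q ≠ ∞) {β : ℕ → ℝ≥0∞}
    {N M : ℕ} (h : ∀ i < N, ∀ k < M, ∫⁻ x, V i k x ^ 2 ∂μ ≤ C * (q ^ ((i - k) + (k - i))) ^ 2 * β k) :
    ∑ i ∈ Finset.range N, ∫⁻ x, (∑ k ∈ Finset.range M, V i k x) ^ 2 ∂μ ≤
      C * (2 * (1 - q)⁻¹) ^ 2 * ∑ k ∈ Finset.range M, β k := by
  set A := 2 * (1 - q)⁻¹ with hA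
  set w : ℕ → ℕ → ℝ≥0∞ := fun i k => q ^ ((i - k) + (k - i)) with hw
  have hw0 : ∀ i k, w i k ≠ 0 := fun i k => pow_ne_zero _ hq0
  have hwt : ∀ i k, w i k ≠ ∞ := fun i k => ENNReal.pow_ne_top hqt
  have h1 : ∀ i < N, ∫⁻ x, (∑ k ∈ Finset.range M, V i k x) ^ 2 ∂μ ≤
      A * C * ∑ k ∈ Finset.range M, w i k * β k := by
    intro i hi
    calc _ ≤ ∫⁻ x, A * ∑ k ∈ Finset.range M, (w i k)⁻¹ * V i k x ^ 2 ∂μ := by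
          refine lintegral_mono fun x => ?_
          refine (ENNReal.sum_sq_le_weight _ (w i) (fun k => V i k x) (hw0 i) (hwt i)).trans ?_
          exact mul_le_mul' (ENNReal.sum_pow_dist_le q i M) le_rfl
      _ = A * ∑ k ∈ Finset.range M, (w i k)⁻¹ * ∫⁻ x, V i k x ^ 2 ∂μ := by
          rw [lintegral_const_mul _ (Finset.measurable_fun_sum _ fun k _ =>
            ((hV i k).pow_const 2).const_mul _), lintegral_finsetSum _ fun k _ =>
            ((hV i k).pow_const 2).const_mul _]
          simp_rw [lintegral_const_mul _ ((hV i _).pow_const 2)]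
      _ ≤ A * ∑ k ∈ Finset.range M, (w i k)⁻¹ * (C * (w i k) ^ 2 * β k) := by
          gcongr with k hk
          exact h i hi k (Finset.mem_range.1 hk)
      _ = A * C * ∑ k ∈ Finset.range M, w i k * β k := by
          rw [mul_assoc A C, Finset.mul_sum (a := C)]
          congr 1
          refine Finset.sum_congr rfl fun k _ => ?_
          calc _ = C * (((w i k)⁻¹ * w i k) * w i k * β k) := by ring
            _ = _ := by rw [ENNReal.inv_mul_cancel (hw0 i k) (hwt i k), one_mul]
  calc _ ≤ ∑ i ∈ Finset.range N, A * C * ∑ k ∈ Finset.range M, w i k * β k :=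
        Finset.sum_le_sum fun i hi => h1 i (Finset.mem_range.1 hi)
    _ = A * C * ∑ k ∈ Finset.range M, (∑ i ∈ Finset.range N, w i k) * β k := by
        rw [← Finset.mul_sum, Finset.sum_comm]
        simp_rw [Finset.sum_mul]
    _ ≤ A * C * ∑ k ∈ Finset.range M, A * β k := by
        gcongr with k _
        refine le_trans (le_of_eq (Finset.sum_congr rfl fun i _ => ?_)) (ENNReal.sum_pow_dist_le q k N)
        rw [hw, add_comm]
    _ = _ := by rw [← Finset.mul_sum]; ring

variable {G : Type*} [MetricSpace G] [MeasurableSpace G] [OpensMeasurableSpace G]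

namespace CubeSystem

variable {a δ : ℝ} (𝒟 : CubeSystem G a δ)

lemma setLIntegral_le_of_cube_le {m : Measure G} {k : ℕ} {u v : G → ℝ≥0∞}
    (h : ∀ x, ∫⁻ y in 𝒟.cube k x, u y ∂m ≤ ∫⁻ y in 𝒟.cube k x, v y ∂m) {S : Set G}
    (hS : 𝒟.IsConst k (· ∈ S)) : ∫⁻ x in S, u x ∂m ≤ ∫⁻ x in S, v x ∂m := by
  rw [𝒟.setLIntegral_eq_tsum m k hS, 𝒟.setLIntegral_eq_tsum m k hS]
  refine ENNReal.tsum_le_tsum ?_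
  rintro ⟨_, ⟨x, -, rfl⟩⟩
  exact h x

section Averages

variable {m : Measure G} {r₀ ε K : ℝ} (h : CoarseAnnular m r₀ ε K) (hs : GoodScales a δ r₀)

lemma integrableOn_cube {f : G → ℂ} (hf : BallIntegrable m f) (k : ℕ) (x : G) :
    IntegrableOn f (𝒟.cube k x) m := (hf x _).mono_set (𝒟.cube_subset_closedBall k x)

lemma setLIntegral_cube_of_isConst {β : Type*} {k : ℕ} {W : G → β} (hW : 𝒟.IsConst k W)
    (φ : β → ℝ≥0∞) (x : G) : ∫⁻ y in 𝒟.cube k x, φ (W y) ∂m = φ (W x) * m (𝒟.cube k x) := by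
  rw [← setLIntegral_const]
  exact setLIntegral_congr_fun (𝒟.measurableSet_cube k x) fun y hy => by
    rw [hW y x hy]

include h hs

lemma setLIntegral_laverage (k : ℕ) (u : G → ℝ≥0∞) (x : G) :
    ∫⁻ y in 𝒟.cube k x, 𝒟.laverage m k u y ∂m = ∫⁻ y in 𝒟.cube k x, u y ∂m := by
  rw [𝒟.setLIntegral_cube_of_isConst (𝒟.isConst_laverage m k u) (fun t => t), laverage, mul_comm,
    ← mul_assoc, ENNReal.mul_inv_cancel (𝒟.measure_cube_ne_zero h hs k x)
      (𝒟.measure_cube_ne_top h hs k x), one_mul]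

lemma average_eq (k : ℕ) (f : G → ℂ) (x : G) :
    (m.real (𝒟.cube k x)) • 𝒟.average m k f x = ∫ y in 𝒟.cube k x, f y ∂m := by
  rw [average, setAverage_eq, smul_smul, mul_inv_cancel₀, one_smul]
  exact (ENNReal.toReal_pos (𝒟.measure_cube_ne_zero h hs k x)
    (𝒟.measure_cube_ne_top h hs k x)).ne'

lemma enorm_average_le (k : ℕ) (f : G → ℂ) (x : G) :
    ‖𝒟.average m k f x‖ₑ ≤ 𝒟.laverage m k (fun y => ‖f y‖ₑ) x := by
  rw [average, setAverage_eq, enorm_smul, enorm_inv_measureReal (𝒟.measure_cube_ne_zero h hs k x)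
      (𝒟.measure_cube_ne_top h hs k x)]
  exact mul_le_mul' le_rfl (enorm_integral_le_lintegral_enorm _)

lemma setLIntegral_enorm_average_le (k : ℕ) (f : G → ℂ) (x : G) :
    ∫⁻ y in 𝒟.cube k x, ‖𝒟.average m k f y‖ₑ ∂m ≤ ∫⁻ y in 𝒟.cube k x, ‖f y‖ₑ ∂m := by
  rw [← 𝒟.setLIntegral_laverage h hs k (fun y => ‖f y‖ₑ)]
  exact lintegral_mono fun y => 𝒟.enorm_average_le h hs k f y

lemma ballIntegrable_average {f : G → ℂ} (hf : BallIntegrable m f) (k : ℕ) :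
    BallIntegrable m (𝒟.average m k f) := by
  intro x r
  refine ⟨(𝒟.isConst_average m k f).measurable.aestronglyMeasurable, ?_⟩
  set T : Set G := {y | (𝒟.cube k y ∩ closedBall x r).Nonempty} with hT
  have hTc : 𝒟.IsConst k (· ∈ T) := fun y z hyz => by simp [hT, 𝒟.cube_eq hyz]
  have hTB : T ⊆ closedBall x (r + 5 / 2 * (a * δ ^ k)) := by
    rintro y ⟨z, hz, hzB⟩
    have h1 := 𝒟.dist_le_of_mem_cube hz
    rw [mem_closedBall] at hzB ⊢
    have := dist_triangle_left y x z
    linarith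
  calc ∫⁻ y in closedBall x r, ‖𝒟.average m k f y‖ₑ ∂m ≤ ∫⁻ y in T, ‖𝒟.average m k f y‖ₑ ∂m :=
        lintegral_mono_set fun y hy => ⟨y, 𝒟.mem_cube_self k y, hy⟩
    _ ≤ ∫⁻ y in T, ‖f y‖ₑ ∂m :=
        𝒟.setLIntegral_le_of_cube_le (fun x => 𝒟.setLIntegral_enorm_average_le h hs k f x) hTc
    _ ≤ ∫⁻ y in closedBall x (r + 5 / 2 * (a * δ ^ k)), ‖f y‖ₑ ∂m := lintegral_mono_set hTB
    _ < ∞ := (hf _ _).2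

lemma setIntegral_average (k : ℕ) (f : G → ℂ) (x : G) :
    ∫ y in 𝒟.cube k x, 𝒟.average m k f y ∂m = ∫ y in 𝒟.cube k x, f y ∂m := by
  rw [setIntegral_congr_fun (g := fun _ => 𝒟.average m k f x) (𝒟.measurableSet_cube k x)
    (fun y hy => 𝒟.isConst_average m k f y x hy), setIntegral_const, 𝒟.average_eq h hs]

lemma meanZero_sub_average {f : G → ℂ} (hf : BallIntegrable m f) (k : ℕ) :
    𝒟.MeanZero m k (fun y => f y - 𝒟.average m k f y) := fun x => by
  rw [integral_sub (𝒟.integrableOn_cube hf k x)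
    (𝒟.integrableOn_cube (𝒟.ballIntegrable_average h hs hf k) k x), 𝒟.setIntegral_average h hs,
    sub_self]

/-- The tower property: a cube of generation `k + 1` is a union of cubes of generation `k`, over
which `f` minus its averages has mean zero. -/
lemma average_average_succ {f : G → ℂ} (hf : BallIntegrable m f) (k : ℕ) (x : G) :
    𝒟.average m (k + 1) (𝒟.average m k f) x = 𝒟.average m (k + 1) f x := by
  have hA := 𝒟.ballIntegrable_average h hs hf k
  have h1 := 𝒟.setIntegral_eq_zero (𝒟.meanZero_sub_average h hs hf k) (S := 𝒟.cube (k + 1) x)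
    (fun y z hyz => by
      change (𝒟.π (k + 1) y = _) = (𝒟.π (k + 1) z = _)
      rw [𝒟.succ k y z hyz])
    ((𝒟.integrableOn_cube hf _ x).sub (𝒟.integrableOn_cube hA _ x))
  rw [integral_sub (𝒟.integrableOn_cube hf _ x) (𝒟.integrableOn_cube hA _ x), sub_eq_zero] at h1
  rw [average, average, setAverage_eq, setAverage_eq, h1]

/-- Orthogonality of the projection onto functions that are constant on cubes. -/
lemma lintegral_sq_sub_average_add {f : G → ℂ} (hfm : Measurable f) (hf : BallIntegrable m f)
    (k : ℕ) : ∫⁻ x, ‖f x - 𝒟.average m k f x‖ₑ ^ 2 ∂m + ∫⁻ x, ‖𝒟.average m k f x‖ₑ ^ 2 ∂m ≤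
      ∫⁻ x, ‖f x‖ₑ ^ 2 ∂m := by
  have hAm : Measurable (𝒟.average m k f) := (𝒟.isConst_average m k f).measurable
  have hm1 : Measurable fun x => ‖f x - 𝒟.average m k f x‖ₑ ^ 2 := (hfm.sub hAm).enorm.pow_const 2
  rw [← lintegral_add_left hm1]
  refine 𝒟.lintegral_le_of_cube_le (k := k) (hm1.add (hAm.enorm.pow_const 2)) (hfm.enorm.pow_const 2)
    fun x => ?_
  set Q := 𝒟.cube k x with hQ
  have hQt : m Q ≠ ∞ := 𝒟.measure_cube_ne_top h hs k x
  set c := 𝒟.average m k f x with hc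
  have e1 : ∫⁻ y in Q, (‖f y - 𝒟.average m k f y‖ₑ ^ 2 + ‖𝒟.average m k f y‖ₑ ^ 2) ∂m =
      ∫⁻ y in Q, (‖f y - c‖ₑ ^ 2 + ‖c‖ₑ ^ 2) ∂m :=
    setLIntegral_congr_fun (𝒟.measurableSet_cube k x) fun y hy => by
      simp only [𝒟.isConst_average m k f y x hy, hc]
  rw [e1]
  by_cases hfin : ∫⁻ y in Q, ‖f y‖ₑ ^ 2 ∂m = ∞
  · rw [hfin]; exact le_top
  have hfQ := 𝒟.integrableOn_cube hf k x
  have hf2 : Integrable (fun y => ‖f y‖ ^ 2) (m.restrict Q) := by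
    refine ⟨(hfm.norm.pow_const 2).aestronglyMeasurable, ?_⟩
    rw [HasFiniteIntegral]
    simpa [enorm_pow] using lt_top_iff_ne_top.2 hfin
  -- The last term integrates to zero over `Q` because `c` is the mean of `f` on `Q`.
  have hpt : ∀ y, ‖f y - c‖ ^ 2 + ‖c‖ ^ 2 = ‖f y‖ ^ 2 + 2 * ((‖c‖ ^ 2 : ℝ) - (f y * (starRingEnd ℂ) c).re) := by
    intro y
    rw [← Complex.normSq_eq_norm_sq, ← Complex.normSq_eq_norm_sq, ← Complex.normSq_eq_norm_sq,
      Complex.normSq_sub]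
    ring
  have hI1 : Integrable (fun y => (f y * (starRingEnd ℂ) c).re) (m.restrict Q) :=
    (hfQ.mul_const _).re
  have : IsFiniteMeasure (m.restrict Q) := ⟨by simpa using hQt.lt_top⟩
  have hI2 : Integrable (fun y => 2 * ((‖c‖ ^ 2 : ℝ) - (f y * (starRingEnd ℂ) c).re)) (m.restrict Q) :=
    ((integrable_const _).sub hI1).const_mul 2
  have hzero : ∫ y in Q, 2 * ((‖c‖ ^ 2 : ℝ) - (f y * (starRingEnd ℂ) c).re) ∂m = 0 := by
    rw [integral_const_mul, integral_sub (integrable_const _) hI1]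
    have h1 : ∫ y in Q, (f y * (starRingEnd ℂ) c).re ∂m = (∫ y in Q, f y * (starRingEnd ℂ) c ∂m).re :=
      integral_re (hfQ.mul_const _)
    rw [h1, integral_mul_const, ← 𝒟.average_eq h hs k f x, ← hc, setIntegral_const, smul_mul_assoc,
      Complex.mul_conj, Complex.real_smul, ← Complex.ofReal_mul, Complex.ofReal_re,
      Complex.normSq_eq_norm_sq, smul_eq_mul, sub_self, mul_zero]
  have key : ∫ y in Q, (‖f y - c‖ ^ 2 + ‖c‖ ^ 2) ∂m = ∫ y in Q, ‖f y‖ ^ 2 ∂m := by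
    simp_rw [hpt]
    rw [integral_add hf2 hI2, hzero, add_zero]
  have hI : Integrable (fun y => ‖f y - c‖ ^ 2 + ‖c‖ ^ 2) (m.restrict Q) := by
    simp_rw [hpt]; exact hf2.add hI2
  have k1 := ofReal_integral_eq_lintegral_ofReal hI (ae_of_all _ fun y => by positivity)
  have k2 := ofReal_integral_eq_lintegral_ofReal hf2 (ae_of_all _ fun y => by positivity)
  rw [key, k2] at k1
  refine le_of_eq ?_
  simp only [← ofReal_norm, ← ENNReal.ofReal_pow (norm_nonneg _)]
  rw [k1]
  refine lintegral_congr fun y => ?_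
  rw [ENNReal.ofReal_add (by positivity) (by positivity)]

end Averages

end CubeSystem

end

/-! ### Functions constant on large cubes: rarity of points near cube boundaries. -/

section

variable {G : Type*} [MetricSpace G] [MeasurableSpace G] [OpensMeasurableSpace G]
variable {a δ : ℝ} {m : Measure G} {r₀ ε K : ℝ}

lemma ballLAverage_le {R : ℝ} {u : G → ℝ≥0∞} {x : G} {M : ℝ≥0∞}
    (hu : ∀ y ∈ closedBall x R, u y ≤ M) : ballLAverage m R u x ≤ M := by
  rw [ballLAverage, ← ENNReal.div_eq_inv_mul]
  refine ENNReal.div_le_of_le_mul ?_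
  rw [← setLIntegral_const]
  exact setLIntegral_mono measurable_const hu

section Basic

variable (h : CoarseAnnular m r₀ ε K) (hs : GoodScales a δ r₀)
include h hs

lemma measurable_scaleVariation [SecondCountableTopology G] (i : ℕ) {f : G → ℂ} (hfm : Measurable f)
    (hf : BallIntegrable m f) : Measurable (scaleVariation m a δ i f) := by
  have := h.sigmaFinite
  refine measurable_qVariation (a := fun r x => ballAverage m r f x)
    (fun r => measurable_ballAverage r hfm) fun x r hr =>
    continuousWithinAt_ballAverage h.lt_top hf (h.pos x r ?_)
  linarith [hr.1, hs.le_scale (i + 1), hs.r₀_pos]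

lemma scaleVariation_add_le (i : ℕ) {f g : G → ℂ} (hf : BallIntegrable m f)
    (hg : BallIntegrable m g) (x : G) : scaleVariation m a δ i (fun y => f y + g y) x ≤
      scaleVariation m a δ i f x + scaleVariation m a δ i g x := by
  unfold scaleVariation
  simp_rw [ballAverage_add hf hg]
  exact qVariation_two_add_le _ _

/-- A single scale is controlled by an average. -/
lemma exists_scaleVariation_le : ∃ C : ℝ≥0, ∀ f : G → ℂ, BallIntegrable m f → ∀ i x,
    scaleVariation m a δ i f x ≤ C * ballLAverage m (a * δ ^ (i + 2)) (fun y => ‖f y‖ₑ) x := by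
  obtain ⟨C, -, hC⟩ := h.exists_qVariation_one_le δ
  refine ⟨C, fun f hf i x => (qVariation_two_le_one _ _).trans
    (hC f hf x x _ _ _ (by linarith [hs.le_scale (i + 1), hs.r₀_pos]) ?_ ?_)⟩
  · rw [dist_self, zero_add]
  · rw [dist_self, zero_add, pow_succ δ (i + 1)]; linarith

lemma exists_scaleVariation_sq_le : ∃ C : ℝ≥0, ∀ f : G → ℂ, Measurable f → BallIntegrable m f →
    ∀ i x, scaleVariation m a δ i f x ^ 2 ≤
      C * ballLAverage m (a * δ ^ (i + 2)) (fun y => ‖f y‖ₑ ^ 2) x := by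
  obtain ⟨C, hC⟩ := exists_scaleVariation_le h hs
  refine ⟨C ^ 2, fun f hfm hf i x => ?_⟩
  calc _ ≤ (C * ballLAverage m (a * δ ^ (i + 2)) (fun y => ‖f y‖ₑ) x) ^ 2 := by
        gcongr; exact hC f hf i x
    _ = C ^ 2 * ballLAverage m (a * δ ^ (i + 2)) (fun y => ‖f y‖ₑ) x ^ 2 := mul_pow _ _ _
    _ ≤ _ := by
        push_cast
        gcongr
        exact ballLAverage_sq_le h.lt_top hfm.enorm _ _

end Basic

namespace CubeSystem

variable (𝒟 : CubeSystem G a δ)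

/-- The points whose cube of generation `t` is close to the centre of its parent. -/
def central (t : ℕ) : Set G := {x | dist (𝒟.π t x) (𝒟.π (t + 1) x) ≤ 3 / 20 * (a * δ ^ (t + 1))}

/-- The points that are not central at any generation between `j` and `l`. -/
def peripheral (j l : ℕ) : Set G := {x | ∀ t, j ≤ t → t < l → x ∉ 𝒟.central t}

lemma isConst_central (t : ℕ) : 𝒟.IsConst t (· ∈ 𝒟.central t) := fun x y hxy => by
  simp only [central, mem_ofPred_eq, hxy, 𝒟.succ t x y hxy]

lemma isConst_peripheral (j l : ℕ) : 𝒟.IsConst j (· ∈ 𝒟.peripheral j l) := fun x y hxy => by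
  have : ∀ t, j ≤ t → (x ∈ 𝒟.central t ↔ y ∈ 𝒟.central t) := fun t ht => by
    simpa using 𝒟.isConst_central t x y (𝒟.eq_of_le ht hxy)
  simp only [peripheral, mem_ofPred_eq, eq_iff_iff]
  exact forall_congr' fun t => forall_congr' fun ht => by rw [this t ht]

lemma measurableSet_peripheral (j l : ℕ) : MeasurableSet (𝒟.peripheral j l) :=
  IsConst.measurableSet (𝒟.isConst_peripheral j l)

section

variable (h : CoarseAnnular m r₀ ε K) (hs : GoodScales a δ r₀)

include hs in
-- The ball stays within `(1 + 5 / 4) / 18 + 3 / 20 < 1 / 3` of the parent's centre, in units of the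
-- parent's scale, hence in its inner ball.
lemma closedBall_subset_of_central {t : ℕ} {x : G} (hx : x ∈ 𝒟.central t) :
    closedBall x (a * δ ^ t) ⊆ 𝒟.cube (t + 1) x := by
  refine Subset.trans ?_ (𝒟.closedBall_subset_cube (t + 1) x)
  refine closedBall_subset_closedBall' ?_
  have h1 := 𝒟.dist_le t x
  have h2 : dist (𝒟.π t x) (𝒟.π (t + 1) x) ≤ 3 / 20 * (a * δ ^ (t + 1)) := hx
  have h3 := dist_triangle x (𝒟.π t x) (𝒟.π (t + 1) x)
  linarith [hs.scale_succ t, hs.scale_pos t]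

include hs in
-- One central generation between `j` and `l` is enough: the ball is then inside a cube of the next
-- generation, and cubes are nested.
lemma closedBall_subset_of_notMem_peripheral {j l : ℕ} {x : G} (hx : x ∉ 𝒟.peripheral j l) :
    closedBall x (a * δ ^ j) ⊆ 𝒟.cube l x := by
  simp only [peripheral, mem_ofPred_eq, not_forall, not_not] at hx
  obtain ⟨t, hjt, htl, ht⟩ := hx
  refine (closedBall_subset_closedBall (hs.scale_mono hjt)).trans
    ((𝒟.closedBall_subset_of_central hs ht).trans fun y hy => ?_)
  exact 𝒟.eq_of_le htl hy

include h in
-- The ball of radius `a * δ ^ (t + 1) / 32` about the centre of the cube is central, as `1 / 32 + 5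
-- / 72 ≤ 3 / 20`, and doubling gives it a fixed proportion of the mass. The factor `120` is `32 *
-- (5 / 2 + 5 / 4)`.
lemma exists_measure_cube_diff_central_le (hs : GoodScales a δ r₀) : ∃ κ : ℝ≥0, κ < 1 ∧ ∀ t x,
    m (𝒟.cube (t + 1) x \ 𝒟.central t) ≤ κ * m (𝒟.cube (t + 1) x) := by
  obtain ⟨C, hC1, hC⟩ := h.exists_doubling 120
  have hC0 : 0 < C := by positivity
  refine ⟨1 - C⁻¹, tsub_lt_self one_pos (by positivity), fun t x => ?_⟩
  set Q := 𝒟.cube (t + 1) x with hQ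
  set B := closedBall (𝒟.π (t + 1) x) (a * δ ^ (t + 1) / 32) with hB
  have hst := hs.scale_succ t
  have hsp := hs.scale_pos t
  have hBQ : B ⊆ Q := (closedBall_subset_closedBall (by linarith)).trans
    (𝒟.closedBall_subset_cube (t + 1) x)
  have hBc : B ⊆ 𝒟.central t := fun y hy => by
    have h1 : 𝒟.π (t + 1) y = 𝒟.π (t + 1) x := hBQ hy
    have h2 := 𝒟.dist_le t y
    have h3 := dist_triangle_left (𝒟.π t y) (𝒟.π (t + 1) x) y
    rw [hB, mem_closedBall] at hy
    change dist (𝒟.π t y) (𝒟.π (t + 1) y) ≤ _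
    rw [h1]
    linarith
  have hQt : m Q ≠ ∞ := 𝒟.measure_cube_ne_top h hs _ _
  have hBt : m B ≠ ∞ := (h.lt_top _ _).ne
  have h1 : m Q ≤ C * m B := by
    refine (measure_mono (𝒟.cube_subset_closedBall (t + 1) x)).trans (hC _ _ _ _ ?_ ?_)
    · linarith [hs.le_scale t, hs.r₀_pos]
    · have := 𝒟.dist_le (t + 1) x
      rw [dist_comm]
      linarith
  have h2 : (C : ℝ≥0∞)⁻¹ * m Q ≤ m B := by
    rw [ENNReal.inv_mul_le_iff (by exact_mod_cast hC0.ne') ENNReal.coe_ne_top]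
    exact h1
  calc m (Q \ 𝒟.central t) ≤ m (Q \ B) := measure_mono (sdiff_subset_sdiff_right hBc)
    _ = m Q - m B := measure_sdiff hBQ measurableSet_closedBall.nullMeasurableSet hBt
    _ ≤ m Q - (C : ℝ≥0∞)⁻¹ * m Q := tsub_le_tsub_left h2 _
    _ = (1 - (C : ℝ≥0∞)⁻¹) * m Q := by
        rw [ENNReal.sub_mul (fun _ _ => hQt), one_mul]
    _ = _ := by
        rw [ENNReal.coe_sub, ENNReal.coe_inv hC0.ne', ENNReal.coe_one]

include h in
/-- The peripheral region carries an exponentially small proportion of every cube. -/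
lemma exists_setLIntegral_peripheral_le (hs : GoodScales a δ r₀) : ∃ κ : ℝ≥0, κ < 1 ∧
    ∀ j l (W : G → ℝ≥0∞), 𝒟.IsConst l W →
      ∫⁻ x in 𝒟.peripheral j l, W x ∂m ≤ (κ : ℝ≥0∞) ^ (l - j) * ∫⁻ x, W x ∂m := by
  obtain ⟨κ, hκ1, hκ⟩ := 𝒟.exists_measure_cube_diff_central_le h hs
  refine ⟨κ, hκ1, fun j l => ?_⟩
  rcases le_total l j with hlj | hjl
  · intro W _
    rw [Nat.sub_eq_zero_of_le hlj, pow_zero, one_mul]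
    exact setLIntegral_le_lintegral _ _
  obtain ⟨d, rfl⟩ := Nat.exists_eq_add_of_le hjl
  rw [Nat.add_sub_cancel_left]
  clear hjl
  induction d with
  | zero =>
    intro W _
    rw [pow_zero, one_mul]
    exact setLIntegral_le_lintegral _ _
  | succ d ih =>
    intro W hW
    have hcm : MeasurableSet (𝒟.central (j + d))ᶜ :=
      (IsConst.measurableSet (𝒟.isConst_central (j + d))).compl
    have hsub : 𝒟.peripheral j (j + (d + 1)) ⊆ 𝒟.peripheral j (j + d) ∩ (𝒟.central (j + d))ᶜ :=
      fun x hx => ⟨fun t h1 h2 => hx t h1 (by omega), hx (j + d) (by omega) (by omega)⟩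
    -- Whether a point is central at generation `j + d` depends only on its cube of that generation.
    -- The weight cut off to non-central points is therefore admissible for the induction
    -- hypothesis, and cutting it off costs a factor `κ`.
    have hind : 𝒟.IsConst (j + d) ((𝒟.central (j + d))ᶜ.indicator W) := fun x y hxy => by
      have h1 : x ∈ 𝒟.central (j + d) ↔ y ∈ 𝒟.central (j + d) := by
        simpa using 𝒟.isConst_central (j + d) x y hxy
      have h2 : W x = W y := hW x y (𝒟.succ _ _ _ hxy)
      by_cases hx : x ∈ 𝒟.central (j + d)
      · simp [hx, h1.1 hx]
      · have hy : y ∉ 𝒟.central (j + d) := fun h => hx (h1.2 h)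
        simp [hx, hy, h2]
    have hstep : ∫⁻ x, (𝒟.central (j + d))ᶜ.indicator W x ∂m ≤ κ * ∫⁻ x, W x ∂m := by
      have e : ∀ x, (𝒟.central (j + d))ᶜ.indicator W x =
          W x * (𝒟.central (j + d))ᶜ.indicator (fun _ => 1) x := fun x => by
        by_cases hx : x ∈ 𝒟.central (j + d) <;> simp [hx]
      simp_rw [e]
      refine (𝒟.lintegral_mul_le_of_cube_le (k := j + d + 1) (v := fun _ => (κ : ℝ≥0∞))
        (measurable_const.indicator hcm) measurable_const hW fun x => ?_).trans (le_of_eq ?_)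
      · rw [lintegral_indicator hcm, setLIntegral_const, setLIntegral_const, one_mul,
          Measure.restrict_apply hcm, inter_comm, ← Set.sdiff_eq]
        exact hκ (j + d) x
      · rw [lintegral_mul_const _ (IsConst.measurable hW), mul_comm]
    calc _ ≤ ∫⁻ x in 𝒟.peripheral j (j + d) ∩ (𝒟.central (j + d))ᶜ, W x ∂m :=
          lintegral_mono_set hsub
      _ = ∫⁻ x in 𝒟.peripheral j (j + d), (𝒟.central (j + d))ᶜ.indicator W x ∂m := by
          rw [setLIntegral_indicator hcm, inter_comm]
      _ ≤ (κ : ℝ≥0∞) ^ d * ∫⁻ x, (𝒟.central (j + d))ᶜ.indicator W x ∂m := ih _ hind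
      _ ≤ (κ : ℝ≥0∞) ^ d * (κ * ∫⁻ x, W x ∂m) := by gcongr
      _ = _ := by rw [pow_succ]; ring

include h in
/-- Short variation of functions that are constant on large cubes. -/
lemma exists_lintegral_scaleVariation_sq_le_of_isConst [SecondCountableTopology G]
    (hs : GoodScales a δ r₀) : ∃ C κ : ℝ≥0, κ < 1 ∧
    ∀ f : G → ℂ, BallIntegrable m f → ∀ l i, 𝒟.IsConst l f →
      ∫⁻ x, scaleVariation m a δ i f x ^ 2 ∂m ≤
        C * (κ : ℝ≥0∞) ^ (l - (i + 2)) * ∫⁻ x, ‖f x‖ₑ ^ 2 ∂m := by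
  obtain ⟨C1, hC1⟩ := exists_scaleVariation_sq_le h hs
  obtain ⟨C2, hC2⟩ := h.exists_lintegral_ballLAverage_le
  obtain ⟨κ, hκ1, hκ⟩ := 𝒟.exists_setLIntegral_peripheral_le h hs
  obtain ⟨C3, hC31, hC3⟩ := 𝒟.exists_measure_closedBall_le_cube h hs 20
  refine ⟨C1 * C2 + C1 * C3 * C3 * C2, κ, hκ1, fun f hf l i hl => ?_⟩
  have hfm : Measurable f := IsConst.measurable hl
  have hum : Measurable fun y => ‖f y‖ₑ ^ 2 := hfm.enorm.pow_const 2
  have hs0 := hs.scale_pos l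
  rcases le_or_gt l (i + 2) with hli | hli
  · rw [Nat.sub_eq_zero_of_le hli, pow_zero, mul_one]
    calc _ ≤ ∫⁻ x, C1 * ballLAverage m (a * δ ^ (i + 2)) (fun y => ‖f y‖ₑ ^ 2) x ∂m :=
          lintegral_mono fun x => hC1 f hfm hf i x
      _ = C1 * ∫⁻ x, ballLAverage m (a * δ ^ (i + 2)) (fun y => ‖f y‖ₑ ^ 2) x ∂m :=
          lintegral_const_mul' _ _ ENNReal.coe_ne_top
      _ ≤ C1 * (C2 * ∫⁻ x, ‖f x‖ₑ ^ 2 ∂m) := by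
          gcongr
          exact hC2 _ (by linarith [hs.le_scale (i + 2), hs.r₀_pos]) _ hum
      _ ≤ _ := by
          rw [← mul_assoc, ← ENNReal.coe_mul]
          gcongr
          exact le_self_add
  -- Averaging about the cube centre `𝒟.π l x` instead of `x` makes `W` constant on cubes of
  -- generation `l`, as the peripheral estimate requires; `hW2` returns to averages about `x`.
  set W : G → ℝ≥0∞ := fun x => C1 * C3 *
    ballLAverage m (8 * (a * δ ^ l)) (fun y => ‖f y‖ₑ ^ 2) (𝒟.π l x) with hW
  have hWc : 𝒟.IsConst l W := fun x y hxy => by simp only [hW, hxy]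
  have hpt : ∀ x y, dist y x ≤ a * δ ^ l → ‖f y‖ₑ ^ 2 ≤
      C3 * ballLAverage m (8 * (a * δ ^ l)) (fun y => ‖f y‖ₑ ^ 2) (𝒟.π l x) := by
    intro x y hyx
    have h1 := 𝒟.dist_le l x
    have h3 := dist_triangle y x (𝒟.π l x)
    have hsub : 𝒟.cube l y ⊆ closedBall (𝒟.π l x) (8 * (a * δ ^ l)) :=
      (𝒟.cube_subset_closedBall l y).trans (closedBall_subset_closedBall' (by linarith))
    have hQ0 := 𝒟.measure_cube_ne_zero h hs l y
    have hQt := 𝒟.measure_cube_ne_top h hs l y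
    have h2 := hC3 l y (𝒟.π l x) (8 * (a * δ ^ l)) (by linarith)
    calc ‖f y‖ₑ ^ 2 = (m (𝒟.cube l y))⁻¹ * (‖f y‖ₑ ^ 2 * m (𝒟.cube l y)) := by
          rw [mul_comm, mul_assoc, ENNReal.mul_inv_cancel hQ0 hQt, mul_one]
      _ = (m (𝒟.cube l y))⁻¹ * ∫⁻ z in 𝒟.cube l y, ‖f z‖ₑ ^ 2 ∂m := by
          rw [𝒟.setLIntegral_cube_of_isConst hl (fun t => ‖t‖ₑ ^ 2)]
      _ ≤ (C3 * (m (closedBall (𝒟.π l x) (8 * (a * δ ^ l))))⁻¹) *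
            ∫⁻ z in closedBall (𝒟.π l x) (8 * (a * δ ^ l)), ‖f z‖ₑ ^ 2 ∂m := by
          gcongr
          exact ENNReal.inv_le_const_mul_inv (by positivity) h2
      _ = _ := by rw [ballLAverage]; ring
  -- Off the peripheral region the largest ball of scale `i` lies in one cube of generation `l`,
  -- where `f` is constant, so nothing varies.
  have hbound : ∀ x, scaleVariation m a δ i f x ^ 2 ≤ (𝒟.peripheral (i + 2) l).indicator W x := by
    intro x
    by_cases hx : x ∈ 𝒟.peripheral (i + 2) l
    · rw [indicator_of_mem hx]
      refine (hC1 f hfm hf i x).trans ?_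
      rw [hW]
      dsimp only
      rw [mul_assoc]
      gcongr
      exact ballLAverage_le fun y hy => hpt x y
        ((mem_closedBall.1 hy).trans (hs.scale_mono hli.le))
    · rw [indicator_of_notMem hx, scaleVariation_eq_zero_of_forall h hs i fun y hy =>
        hl y x (𝒟.closedBall_subset_of_notMem_peripheral hs hx hy)]
      simp
  have hW2 : ∀ x, W x ≤ C1 * C3 * C3 *
      ballLAverage m (10 * (a * δ ^ l)) (fun y => ‖f y‖ₑ ^ 2) x := by
    intro x
    have h1 := 𝒟.dist_le l x
    have hπ : 𝒟.π l (𝒟.π l x) = 𝒟.π l x := 𝒟.inner l x _ (by rw [dist_self]; positivity)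
    have h2 := hC3 l (𝒟.π l x) x (10 * (a * δ ^ l)) (by rw [dist_comm]; linarith)
    have hsub : 𝒟.cube l (𝒟.π l x) ⊆ closedBall (𝒟.π l x) (8 * (a * δ ^ l)) :=
      (𝒟.cube_subset_closedBall l _).trans (closedBall_subset_closedBall (by linarith))
    have h4 : (m (closedBall (𝒟.π l x) (8 * (a * δ ^ l))))⁻¹ ≤
        C3 * (m (closedBall x (10 * (a * δ ^ l))))⁻¹ :=
      ENNReal.inv_le_const_mul_inv (by positivity) (h2.trans (by gcongr))
    calc W x = C1 * C3 * ((m (closedBall (𝒟.π l x) (8 * (a * δ ^ l))))⁻¹ *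
          ∫⁻ y in closedBall (𝒟.π l x) (8 * (a * δ ^ l)), ‖f y‖ₑ ^ 2 ∂m) := rfl
      _ ≤ C1 * C3 * ((C3 * (m (closedBall x (10 * (a * δ ^ l))))⁻¹) *
          ∫⁻ y in closedBall x (10 * (a * δ ^ l)), ‖f y‖ₑ ^ 2 ∂m) := by
          gcongr
          exact closedBall_subset_closedBall' (by rw [dist_comm]; linarith)
      _ = _ := by rw [ballLAverage]; ring
  calc _ ≤ ∫⁻ x, (𝒟.peripheral (i + 2) l).indicator W x ∂m := lintegral_mono hbound
    _ = ∫⁻ x in 𝒟.peripheral (i + 2) l, W x ∂m :=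
        lintegral_indicator (𝒟.measurableSet_peripheral _ _) _
    _ ≤ (κ : ℝ≥0∞) ^ (l - (i + 2)) * ∫⁻ x, W x ∂m := hκ _ _ _ hWc
    _ ≤ (κ : ℝ≥0∞) ^ (l - (i + 2)) * ∫⁻ x, ((C1 * C3 * C3 : ℝ≥0) : ℝ≥0∞) *
          ballLAverage m (10 * (a * δ ^ l)) (fun y => ‖f y‖ₑ ^ 2) x ∂m := by
        gcongr with x
        push_cast
        exact hW2 x
    _ ≤ (κ : ℝ≥0∞) ^ (l - (i + 2)) * (((C1 * C3 * C3 : ℝ≥0) : ℝ≥0∞) *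
          (C2 * ∫⁻ x, ‖f x‖ₑ ^ 2 ∂m)) := by
        rw [lintegral_const_mul' _ _ ENNReal.coe_ne_top]
        gcongr
        exact hC2 _ (by linarith [hs.le_scale l, hs.r₀_pos]) _ hum
    _ = ((C1 * C3 * C3 * C2 : ℝ≥0) : ℝ≥0∞) * (κ : ℝ≥0∞) ^ (l - (i + 2)) *
          ∫⁻ x, ‖f x‖ₑ ^ 2 ∂m := by push_cast; ring
    _ ≤ _ := by
        gcongr
        exact le_add_self

end

end CubeSystem

end

/-! ### The `L²` bound by martingale differences. -/

section

variable {G : Type*} [MetricSpace G] [MeasurableSpace G] [OpensMeasurableSpace G]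
variable {a δ : ℝ} {m : Measure G} {r₀ ε K : ℝ}

/-- The square of the short variation over the first `N` scales. -/
def squareVariation (m : Measure G) (a δ : ℝ) (N : ℕ) (f : G → ℂ) (x : G) : ℝ≥0∞ :=
  ∑ i ∈ Finset.range N, scaleVariation m a δ i f x ^ 2

lemma BallIntegrable.sum {ι : Type*} {s : Finset ι} {f : ι → G → ℂ}
    (hf : ∀ k ∈ s, BallIntegrable m (f k)) : BallIntegrable m (fun y => ∑ k ∈ s, f k y) :=
  fun x r => integrable_finsetSum _ fun k hk => hf k hk x r

lemma BallIntegrable.sub {f g : G → ℂ} (hf : BallIntegrable m f) (hg : BallIntegrable m g) :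
    BallIntegrable m (fun y => f y - g y) :=
  fun x r => (hf x r).sub (hg x r)

lemma scaleVariation_zero (i : ℕ) (x : G) : scaleVariation m a δ i (fun _ => 0) x = 0 :=
  qVariation_const (c := 0) (by norm_num) fun r _ => by simp [ballAverage_eq]

lemma ENNReal.add_sq_le (s t : ℝ≥0∞) : (s + t) ^ 2 ≤ 2 * s ^ 2 + 2 * t ^ 2 := by
  have := ENNReal.rpow_add_le_mul_rpow_add_rpow s t (p := 2) (by norm_num)
  norm_num at this
  rwa [mul_add] at this

/-- A common ratio for both kinds of decay, with `q ^ 2` equal to the larger of `κ`, `ϑ` and `1 /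
2`. Because `q ^ 2 ≥ 1 / 2`, the factor `8 = 2 ^ 3` makes up for the loss of three generations in
the exponent. -/
lemma NNReal.exists_sq_bounds {κ ϑ : ℝ≥0} (hκ : κ < 1) (hϑ : ϑ < 1) :
    ∃ q : ℝ≥0, 0 < q ∧ q < 1 ∧ ϑ ≤ q ^ 2 ∧ ∀ d : ℕ, κ ^ (d - 3) ≤ 8 * (q ^ d) ^ 2 := by
  set Q := max (max κ ϑ) (1 / 2) with hQ
  have hQ1 : Q < 1 := max_lt (max_lt hκ hϑ) (by
    rw [div_lt_one (by norm_num)]; norm_num)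
  have hQ2 : 1 / 2 ≤ Q := le_max_right _ _
  have hQ0 : 0 < Q := lt_of_lt_of_le (by positivity) hQ2
  refine ⟨NNReal.sqrt Q, by simpa using hQ0,
    (NNReal.sqrt_lt_sqrt.2 hQ1).trans_eq NNReal.sqrt_one, ?_, fun d => ?_⟩
  · rw [NNReal.sq_sqrt]
    exact (le_max_right _ _).trans (le_max_left _ _)
  · rw [← pow_mul, mul_comm d, pow_mul, NNReal.sq_sqrt]
    have h8 : 1 ≤ 8 * Q ^ 3 := by
      calc (1 : ℝ≥0) = 8 * (1 / 2) ^ 3 := by norm_num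
        _ ≤ _ := by gcongr
    calc κ ^ (d - 3) ≤ Q ^ (d - 3) := by
          gcongr
          exact (le_max_left _ _).trans (le_max_left _ _)
      _ ≤ (8 * Q ^ 3) * Q ^ (d - 3) := le_mul_of_one_le_left (by positivity) h8
      _ = 8 * Q ^ (3 + (d - 3)) := by rw [pow_add]; ring
      _ ≤ 8 * Q ^ d := by
          gcongr 8 * ?_
          exact pow_le_pow_of_le_one (by positivity) hQ1.le (by omega)

lemma ratio_lt_one (h : CoarseAnnular m r₀ ε K) (hs : GoodScales a δ r₀) :
    (δ ^ (-(ε / 2))).toNNReal < 1 := by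
  rw [Real.toNNReal_lt_one]
  exact Real.rpow_lt_one_of_one_lt_of_neg (by linarith [hs.le_δ]) (by linarith [h.ε_pos])

section

variable (h : CoarseAnnular m r₀ ε K) (hs : GoodScales a δ r₀)
include h hs

lemma scaleVariation_sum_le {ι : Type*} (i : ℕ) (s : Finset ι) {f : ι → G → ℂ}
    (hf : ∀ k ∈ s, BallIntegrable m (f k)) (x : G) :
    scaleVariation m a δ i (fun y => ∑ k ∈ s, f k y) x ≤ ∑ k ∈ s, scaleVariation m a δ i (f k) x := by
  induction s using Finset.cons_induction with
  | empty => simp [scaleVariation_zero]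
  | cons k s hk ih =>
    simp_rw [Finset.sum_cons]
    refine (scaleVariation_add_le h hs i (hf k (by simp)) (BallIntegrable.sum fun j hj =>
      hf j (by simp [hj])) x).trans ?_
    gcongr
    exact ih fun j hj => hf j (by simp [hj])

lemma measurable_squareVariation [SecondCountableTopology G] (N : ℕ) {f : G → ℂ}
    (hfm : Measurable f) (hf : BallIntegrable m f) : Measurable (squareVariation m a δ N f) :=
  Finset.measurable_fun_sum _ fun i _ => (measurable_scaleVariation h hs i hfm hf).pow_const 2

/-- The `L²` bound for the short variation. -/
theorem exists_lintegral_squareVariation_le [SecondCountableTopology G] [Nonempty G] :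
    ∃ C : ℝ≥0, ∀ f : G → ℂ, Measurable f → BallIntegrable m f → ∀ N,
      ∫⁻ x, squareVariation m a δ N f x ∂m ≤ C * ∫⁻ x, ‖f x‖ₑ ^ 2 ∂m := by
  obtain ⟨𝒟⟩ := exists_cubeSystem (G := G) hs.a_pos hs.le_δ
  obtain ⟨C1, hC1⟩ := 𝒟.exists_scaleVariation_sq_le_of_meanZero h hs
  obtain ⟨C2, hC2⟩ := h.exists_lintegral_ballLAverage_le
  obtain ⟨C3, κ, hκ1, hC3⟩ := 𝒟.exists_lintegral_scaleVariation_sq_le_of_isConst h hs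
  have hϑ1 := ratio_lt_one h hs
  set ϑ := (δ ^ (-(ε / 2))).toNNReal with hϑ
  obtain ⟨q, hq0, hq1, hqϑ, hqκ⟩ := NNReal.exists_sq_bounds hκ1 hϑ1
  have hqκ' : ∀ d : ℕ, (κ : ℝ≥0∞) ^ (d - 3) ≤ 8 * ((q : ℝ≥0∞) ^ d) ^ 2 := fun d => by
    exact_mod_cast hqκ d
  have hϑq : ∀ d : ℕ, (ϑ : ℝ≥0∞) ^ d ≤ ((q : ℝ≥0∞) ^ d) ^ 2 := fun d => by
    rw [← pow_mul, mul_comm, pow_mul]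
    gcongr
    exact_mod_cast hqϑ
  set A : ℝ≥0∞ := 2 * (1 - (q : ℝ≥0∞))⁻¹ with hA
  have hAt : A ≠ ∞ := by
    refine ENNReal.mul_ne_top (by norm_num) (ENNReal.inv_ne_top.2 ?_)
    exact (tsub_pos_of_lt (by exact_mod_cast hq1)).ne'
  set B : ℝ≥0∞ := C1 * C2 + C3 * 8 with hB
  have hBt : B ≠ ∞ := by simp [hB, ENNReal.mul_eq_top]
  have hconst : 2 * (B * A) + 2 * (B * A ^ 2) ≠ ∞ := by
    simp [ENNReal.mul_eq_top, hAt, hBt]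
  refine ⟨(2 * (B * A) + 2 * (B * A ^ 2)).toNNReal, fun f hfm hf N => ?_⟩
  rw [ENNReal.coe_toNNReal hconst]
  set I := ∫⁻ x, ‖f x‖ₑ ^ 2 ∂m with hI
  have hEB := fun k => 𝒟.ballIntegrable_average h hs hf k
  have hEc := fun k => 𝒟.isConst_average m k f
  have hEm : ∀ k, Measurable (𝒟.average m k f) := fun k => (hEc k).measurable
  -- `D 0` carries all oscillation below generation `0`, and the average of generation `N` is kept
  -- as a remainder. The expansion of `f` is thus finite and exact, without any martingale
  -- convergence.
  set D : ℕ → G → ℂ := fun k => Nat.casesOn k (fun x => f x - 𝒟.average m 0 f x)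
    (fun k x => 𝒟.average m k f x - 𝒟.average m (k + 1) f x) with hD
  have hD0 : D 0 = fun x => f x - 𝒟.average m 0 f x := rfl
  have hDs : ∀ k, D (k + 1) = fun x => 𝒟.average m k f x - 𝒟.average m (k + 1) f x := fun k => rfl
  have hDs' : ∀ k, D (k + 1) = fun x => 𝒟.average m k f x -
      𝒟.average m (k + 1) (𝒟.average m k f) x := fun k => by
    rw [hDs]; funext x; rw [𝒟.average_average_succ h hs hf]
  have hDB : ∀ k, BallIntegrable m (D k) := fun k => by
    cases k with
    | zero => exact hf.sub (hEB 0)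
    | succ k => exact (hEB k).sub (hEB (k + 1))
  have hDm : ∀ k, Measurable (D k) := fun k => by
    cases k with
    | zero => exact hfm.sub (hEm 0)
    | succ k => exact (hEm k).sub (hEm (k + 1))
  have hDz : ∀ k, 𝒟.MeanZero m k (D k) := fun k => by
    cases k with
    | zero => exact 𝒟.meanZero_sub_average h hs hf 0
    | succ k =>
      rw [hDs']
      exact 𝒟.meanZero_sub_average h hs (hEB k) (k + 1)
  have hDc : ∀ k, 𝒟.IsConst k (D (k + 1)) := fun k x y hxy => by
    simp only [hDs]
    rw [hEc k x y hxy, hEc (k + 1) x y (𝒟.succ k x y hxy)]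
  have hsum : ∀ M x, 𝒟.average m M f x + ∑ k ∈ Finset.range (M + 1), D k x = f x := by
    intro M x
    induction M with
    | zero => simp [hD0]
    | succ M ih => rw [Finset.sum_range_succ, hDs]; simp only; rw [← ih]; ring
  -- Iterated Pythagoras, by the tower property.
  have horth : ∀ M, ∑ k ∈ Finset.range (M + 1), ∫⁻ x, ‖D k x‖ₑ ^ 2 ∂m +
      ∫⁻ x, ‖𝒟.average m M f x‖ₑ ^ 2 ∂m ≤ I := by
    intro M
    induction M with
    | zero =>
      rw [Finset.sum_range_one]
      exact 𝒟.lintegral_sq_sub_average_add h hs hfm hf 0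
    | succ M ih =>
      refine le_trans ?_ ih
      rw [Finset.sum_range_succ, add_assoc]
      gcongr
      have := 𝒟.lintegral_sq_sub_average_add h hs (hEm M) (hEB M) (M + 1)
      simp_rw [𝒟.average_average_succ h hs hf] at this
      exact this
  -- For `k ≤ i` the mean zero of `D k` on cubes of generation `k` gives the decay; for `k > i` it
  -- comes from `D k` being constant on cubes of generation `k - 1`.
  have hV : ∀ i < N, ∀ k < N + 1, ∫⁻ x, scaleVariation m a δ i (D k) x ^ 2 ∂m ≤
      B * ((q : ℝ≥0∞) ^ ((i - k) + (k - i))) ^ 2 * ∫⁻ x, ‖D k x‖ₑ ^ 2 ∂m := by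
    intro i _ k _
    rcases le_or_gt k i with hki | hki
    · rw [Nat.sub_eq_zero_of_le hki, add_zero]
      calc _ ≤ ∫⁻ x, C1 * (ϑ : ℝ≥0∞) ^ (i - k) *
            ballLAverage m (3 * (a * δ ^ (i + 2))) (fun y => ‖D k y‖ₑ ^ 2) x ∂m :=
            lintegral_mono fun x => hC1 (D k) (hDm k) (hDB k) k i hki (hDz k) x
        _ = C1 * (ϑ : ℝ≥0∞) ^ (i - k) *
            ∫⁻ x, ballLAverage m (3 * (a * δ ^ (i + 2))) (fun y => ‖D k y‖ₑ ^ 2) x ∂m :=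
            lintegral_const_mul' _ _ (ENNReal.mul_ne_top ENNReal.coe_ne_top
              (ENNReal.pow_ne_top ENNReal.coe_ne_top))
        _ ≤ C1 * ((q : ℝ≥0∞) ^ (i - k)) ^ 2 * (C2 * ∫⁻ x, ‖D k x‖ₑ ^ 2 ∂m) := by
            refine mul_le_mul' (mul_le_mul' le_rfl (hϑq _)) (hC2 _ ?_ _
              ((hDm k).enorm.pow_const 2))
            linarith [hs.le_scale (i + 2), hs.r₀_pos]
        _ = C1 * C2 * ((q : ℝ≥0∞) ^ (i - k)) ^ 2 * ∫⁻ x, ‖D k x‖ₑ ^ 2 ∂m := by ring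
        _ ≤ _ := by
            gcongr
            exact le_self_add
    · rw [Nat.sub_eq_zero_of_le hki.le, zero_add]
      obtain ⟨k, rfl⟩ := Nat.exists_eq_succ_of_ne_zero (show k ≠ 0 by omega)
      refine (hC3 (D (k + 1)) (hDB (k + 1)) k i (hDc k)).trans ?_
      rw [show k - (i + 2) = (k + 1 - i) - 3 by omega]
      calc _ ≤ C3 * (8 * ((q : ℝ≥0∞) ^ (k + 1 - i)) ^ 2) * ∫⁻ x, ‖D (k + 1) x‖ₑ ^ 2 ∂m := by
            gcongr
            exact hqκ' _
        _ = C3 * 8 * ((q : ℝ≥0∞) ^ (k + 1 - i)) ^ 2 * ∫⁻ x, ‖D (k + 1) x‖ₑ ^ 2 ∂m := by ring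
        _ ≤ _ := by
            gcongr
            exact le_add_self
  have hSchur := lintegral_sum_sq_le (μ := m) (V := fun i k => scaleVariation m a δ i (D k))
    (fun i k => measurable_scaleVariation h hs i (hDm k) (hDB k)) (q := q) (C := B)
    (by exact_mod_cast hq0.ne') ENNReal.coe_ne_top hV
  -- The remainder is constant on cubes of generation `N`, so its contribution at scale `i` decays
  -- in `N - i` and sums over `i < N` uniformly in `N`.
  have hE : ∀ i < N, ∫⁻ x, scaleVariation m a δ i (𝒟.average m N f) x ^ 2 ∂m ≤
      B * (q : ℝ≥0∞) ^ ((N - i) + (i - N)) * I := by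
    intro i hi
    rw [Nat.sub_eq_zero_of_le hi.le, add_zero]
    refine (hC3 _ (hEB N) N i (hEc N)).trans ?_
    calc _ ≤ C3 * (8 * (q : ℝ≥0∞) ^ (N - i)) * I := by
          gcongr
          · calc (κ : ℝ≥0∞) ^ (N - (i + 2)) ≤ (κ : ℝ≥0∞) ^ ((N - i) - 3) :=
                  pow_le_pow_right_of_le_one' (by exact_mod_cast hκ1.le) (by omega)
              _ ≤ _ := hqκ' _
              _ ≤ _ := by
                refine mul_le_mul' le_rfl ?_
                rw [sq]
                exact mul_le_of_le_one_left' (pow_le_one' (by exact_mod_cast hq1.le) _)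
          · exact le_add_self.trans (horth N)
      _ = C3 * 8 * (q : ℝ≥0∞) ^ (N - i) * I := by ring
      _ ≤ _ := by
          gcongr
          exact le_add_self
  have hpt : ∀ i x, scaleVariation m a δ i f x ^ 2 ≤
      2 * scaleVariation m a δ i (𝒟.average m N f) x ^ 2 +
      2 * (∑ k ∈ Finset.range (N + 1), scaleVariation m a δ i (D k) x) ^ 2 := by
    intro i x
    refine le_trans ?_ (ENNReal.add_sq_le _ _)
    gcongr
    calc scaleVariation m a δ i f x = scaleVariation m a δ i
          (fun y => 𝒟.average m N f y + ∑ k ∈ Finset.range (N + 1), D k y) x := by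
          congr 1; funext y; exact (hsum N y).symm
      _ ≤ _ := (scaleVariation_add_le h hs i (hEB N) (BallIntegrable.sum fun k _ => hDB k) x).trans
          (by gcongr; exact scaleVariation_sum_le h hs i _ (fun k _ => hDB k) x)
  have hmE : ∀ i, Measurable fun x => scaleVariation m a δ i (𝒟.average m N f) x ^ 2 := fun i =>
    (measurable_scaleVariation h hs i (hEm N) (hEB N)).pow_const 2
  have hmV : ∀ i, Measurable fun x =>
      (∑ k ∈ Finset.range (N + 1), scaleVariation m a δ i (D k) x) ^ 2 := fun i =>
    (Finset.measurable_fun_sum _ fun k _ =>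
      measurable_scaleVariation h hs i (hDm k) (hDB k)).pow_const 2
  calc _ = ∑ i ∈ Finset.range N, ∫⁻ x, scaleVariation m a δ i f x ^ 2 ∂m :=
        lintegral_finsetSum _ fun i _ => (measurable_scaleVariation h hs i hfm hf).pow_const 2
    _ ≤ ∑ i ∈ Finset.range N, (2 * ∫⁻ x, scaleVariation m a δ i (𝒟.average m N f) x ^ 2 ∂m +
          2 * ∫⁻ x, (∑ k ∈ Finset.range (N + 1), scaleVariation m a δ i (D k) x) ^ 2 ∂m) := by
        refine Finset.sum_le_sum fun i _ => (lintegral_mono (hpt i)).trans (le_of_eq ?_)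
        rw [lintegral_add_left ((hmE i).const_mul 2), lintegral_const_mul _ (hmE i),
          lintegral_const_mul _ (hmV i)]
    _ ≤ 2 * (∑ i ∈ Finset.range N, B * (q : ℝ≥0∞) ^ ((N - i) + (i - N)) * I) +
          2 * (B * A ^ 2 * ∑ k ∈ Finset.range (N + 1), ∫⁻ x, ‖D k x‖ₑ ^ 2 ∂m) := by
        rw [Finset.sum_add_distrib, ← Finset.mul_sum, ← Finset.mul_sum]
        gcongr with i hi
        exact hE i (Finset.mem_range.1 hi)
    _ ≤ 2 * (B * A * I) + 2 * (B * A ^ 2 * I) := by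
        rw [← Finset.sum_mul, ← Finset.mul_sum]
        gcongr
        · exact ENNReal.sum_pow_dist_le _ _ _
        · exact le_self_add.trans (horth N)
    _ = _ := by ring

end

end

section

/-! ### Distribution functions -/

section Layercake

variable {α : Type*} [MeasurableSpace α] {μ : Measure α}

/-- The layer cake formula for real functions is applied to the truncations `min (F x) k`, since `F`
may be infinite, and monotone convergence removes the truncation. -/
lemma lintegral_rpow_le_lintegral_meas_lt {F : α → ℝ≥0∞} (hF : Measurable F) {p : ℝ} (hp : 0 < p) :
    ∫⁻ x, F x ^ p ∂μ ≤
      ENNReal.ofReal p * ∫⁻ t in Ioi (0 : ℝ), μ {x | ENNReal.ofReal t < F x} *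
        ENNReal.ofReal (t ^ (p - 1)) := by
  have hmono : Monotone fun (k : ℕ) x => min (F x) k ^ p := fun k l hkl x => by
    dsimp only
    gcongr
  have hsup : ∀ x, F x ^ p = ⨆ k : ℕ, min (F x) k ^ p := fun x => by
    have h1 : Tendsto (fun k : ℕ => min (F x) (k : ℝ≥0∞)) atTop (𝓝 (min (F x) ∞)) :=
      tendsto_const_nhds.min ENNReal.tendsto_nat_nhds_top
    rw [min_eq_left le_top] at h1
    have h2 : Tendsto (fun k : ℕ => min (F x) (k : ℝ≥0∞) ^ p) atTop (𝓝 (F x ^ p)) :=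
      (ENNReal.continuous_rpow_const.tendsto _).comp h1
    exact tendsto_nhds_unique h2 (tendsto_atTop_iSup fun k l hkl => hmono hkl x)
  simp_rw [hsup]
  rw [lintegral_iSup (fun k => (hF.min measurable_const).pow_const p) hmono]
  refine iSup_le fun k => ?_
  have hfin : ∀ x, min (F x) k ≠ ∞ := fun x =>
    ((min_le_right _ _).trans_lt (ENNReal.natCast_lt_top k)).ne
  have := lintegral_rpow_eq_lintegral_meas_lt_mul μ (f := fun x => (min (F x) k).toReal)
    (Eventually.of_forall fun x => ENNReal.toReal_nonneg)
    (hF.min measurable_const).ennreal_toReal.aemeasurable hp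
  calc _ = ∫⁻ x, ENNReal.ofReal ((min (F x) k).toReal ^ p) ∂μ := by
        refine lintegral_congr fun x => ?_
        rw [← ENNReal.ofReal_rpow_of_nonneg ENNReal.toReal_nonneg hp.le,
          ENNReal.ofReal_toReal (hfin x)]
    _ = _ := this
    _ ≤ _ := by
        refine mul_le_mul' le_rfl (setLIntegral_mono' measurableSet_Ioi fun t ht => ?_)
        refine mul_le_mul' (measure_mono fun x hx => ?_) le_rfl
        have hx' : t < (min (F x) k).toReal := hx
        exact ((ENNReal.ofReal_lt_iff_lt_toReal (mem_Ioi.1 ht).le (hfin x)).2 hx').trans_le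
          (min_le_left _ _)

lemma lintegral_Ioo_rpow {s : ℝ} (hs : 0 < s) (v : ℝ≥0) :
    ∫⁻ t in Ioi (0 : ℝ), (Iio (v : ℝ)).indicator (fun t => ENNReal.ofReal (t ^ (s - 1))) t =
      ENNReal.ofReal s⁻¹ * (v : ℝ≥0∞) ^ s := by
  rw [setLIntegral_indicator measurableSet_Iio, inter_comm, Ioi_inter_Iio]
  have hint : IntegrableOn (fun t : ℝ => t ^ (s - 1)) (Ioc 0 v) := by
    rw [← intervalIntegrable_iff_integrableOn_Ioc_of_le v.coe_nonneg]
    exact intervalIntegral.intervalIntegrable_rpow' (by linarith)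
  rw [setLIntegral_congr Ioo_ae_eq_Ioc, ← ofReal_integral_eq_lintegral_ofReal hint
    ((ae_restrict_iff' measurableSet_Ioc).2 (Eventually.of_forall fun t ht =>
      Real.rpow_nonneg ht.1.le _)), ← intervalIntegral.integral_of_le v.coe_nonneg,
    integral_rpow (Or.inl (by linarith)), sub_add_cancel, Real.zero_rpow hs.ne', sub_zero,
    div_eq_inv_mul, ENNReal.ofReal_mul (by positivity),
    ← ENNReal.ofReal_rpow_of_nonneg v.coe_nonneg hs.le, ENNReal.ofReal_coe_nnreal]

lemma lintegral_Ici_rpow {s : ℝ} (hs : 0 < s) {v : ℝ≥0} (hv : v ≠ 0) :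
    ∫⁻ t in Ioi (0 : ℝ), (Ici (v : ℝ)).indicator (fun t => ENNReal.ofReal (t ^ (-s - 1))) t =
      ENNReal.ofReal s⁻¹ * (v : ℝ≥0∞) ^ (-s) := by
  have hv0 : 0 < (v : ℝ) := by positivity
  rw [setLIntegral_indicator measurableSet_Ici, inter_eq_left.2 (Ici_subset_Ioi.2 hv0)]
  have hint := integrableOn_Ioi_rpow_of_lt (a := -s - 1) (by linarith) hv0
  rw [setLIntegral_congr Ioi_ae_eq_Ici.symm, ← ofReal_integral_eq_lintegral_ofReal hint
    ((ae_restrict_iff' measurableSet_Ioi).2 (Eventually.of_forall fun t ht =>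
      Real.rpow_nonneg (hv0.trans ht).le _)), integral_Ioi_rpow_of_lt (by linarith) hv0,
    sub_add_cancel, neg_div_neg_eq, div_eq_inv_mul, ENNReal.ofReal_mul (by positivity),
    ← ENNReal.ofReal_rpow_of_pos hv0, ENNReal.ofReal_coe_nnreal]

variable [SFinite μ]

lemma lintegral_rpow_mul_lintegral_lt {s : ℝ} (hs : 0 < s) {w : α → ℝ≥0∞} {v : α → ℝ≥0}
    (hw : Measurable w) (hv : Measurable v) :
    ∫⁻ t in Ioi (0 : ℝ), ENNReal.ofReal (t ^ (s - 1)) * ∫⁻ x in {x | t < v x}, w x ∂μ =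
      ENNReal.ofReal s⁻¹ * ∫⁻ x, w x * (v x : ℝ≥0∞) ^ s ∂μ := by
  have hm : MeasurableSet {z : ℝ × α | z.1 < v z.2} :=
    measurableSet_lt measurable_fst (hv.comp measurable_snd).coe_nnreal_real
  calc _ = ∫⁻ t in Ioi (0 : ℝ), ∫⁻ x, {z : ℝ × α | z.1 < v z.2}.indicator
          (fun z => ENNReal.ofReal (z.1 ^ (s - 1)) * w z.2) (t, x) ∂μ := by
        refine lintegral_congr fun t => ?_
        have hmt : MeasurableSet {x | t < v x} :=
          measurableSet_lt measurable_const hv.coe_nnreal_real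
        rw [← lintegral_const_mul _ hw, ← lintegral_indicator hmt]
        rfl
    _ = ∫⁻ x, (∫⁻ t in Ioi (0 : ℝ), {z : ℝ × α | z.1 < v z.2}.indicator
          (fun z => ENNReal.ofReal (z.1 ^ (s - 1)) * w z.2) (t, x)) ∂μ := by
        refine lintegral_lintegral_swap (Measurable.aemeasurable ?_)
        refine Measurable.indicator ?_ hm
        exact ((measurable_fst.pow_const _).ennreal_ofReal).mul (hw.comp measurable_snd)
    _ = ∫⁻ x, w x * (ENNReal.ofReal s⁻¹ * (v x : ℝ≥0∞) ^ s) ∂μ := by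
        refine lintegral_congr fun x => ?_
        rw [← lintegral_Ioo_rpow hs, ← lintegral_const_mul _ (by fun_prop (disch := measurability))]
        refine lintegral_congr fun t => ?_
        by_cases h : t < v x <;> simp [indicator, h, mul_comm]
    _ = _ := by
        rw [← lintegral_const_mul _ (by fun_prop)]
        refine lintegral_congr fun x => ?_
        ring

/-- Tonelli. Where `v` vanishes the integral in `t` diverges at `0`, so `w` has to vanish there. -/
lemma lintegral_rpow_mul_lintegral_ge {s : ℝ} (hs : 0 < s) {w : α → ℝ≥0∞} {v : α → ℝ≥0}
    (hw : Measurable w) (hv : Measurable v) (h0 : ∀ x, v x = 0 → w x = 0) :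
    ∫⁻ t in Ioi (0 : ℝ), ENNReal.ofReal (t ^ (-s - 1)) * ∫⁻ x in {x | v x ≤ t}, w x ∂μ =
      ENNReal.ofReal s⁻¹ * ∫⁻ x, w x * (v x : ℝ≥0∞) ^ (-s) ∂μ := by
  have hm : MeasurableSet {z : ℝ × α | v z.2 ≤ z.1} :=
    measurableSet_le (hv.comp measurable_snd).coe_nnreal_real measurable_fst
  calc _ = ∫⁻ t in Ioi (0 : ℝ), ∫⁻ x, {z : ℝ × α | v z.2 ≤ z.1}.indicator
          (fun z => ENNReal.ofReal (z.1 ^ (-s - 1)) * w z.2) (t, x) ∂μ := by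
        refine lintegral_congr fun t => ?_
        have hmt : MeasurableSet {x | v x ≤ t} :=
          measurableSet_le hv.coe_nnreal_real measurable_const
        rw [← lintegral_const_mul _ hw, ← lintegral_indicator hmt]
        rfl
    _ = ∫⁻ x, (∫⁻ t in Ioi (0 : ℝ), {z : ℝ × α | v z.2 ≤ z.1}.indicator
          (fun z => ENNReal.ofReal (z.1 ^ (-s - 1)) * w z.2) (t, x)) ∂μ := by
        refine lintegral_lintegral_swap (Measurable.aemeasurable ?_)
        refine Measurable.indicator ?_ hm
        exact ((measurable_fst.pow_const _).ennreal_ofReal).mul (hw.comp measurable_snd)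
    _ = ∫⁻ x, w x * (ENNReal.ofReal s⁻¹ * (v x : ℝ≥0∞) ^ (-s)) ∂μ := by
        refine lintegral_congr fun x => ?_
        rcases eq_or_ne (v x) 0 with hvx | hvx
        · simp [indicator, h0 x hvx]
        rw [← lintegral_Ici_rpow hs hvx,
          ← lintegral_const_mul _ (by fun_prop (disch := measurability))]
        refine lintegral_congr fun t => ?_
        by_cases h : v x ≤ t <;> simp [indicator, h, mul_comm]
    _ = _ := by
        rw [← lintegral_const_mul _ (by fun_prop)]
        refine lintegral_congr fun x => ?_
        ring

lemma ENNReal.ofReal_rpow_sub_one {t : ℝ} (ht : 0 < t) (s : ℝ) :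
    ENNReal.ofReal (t ^ (s - 1)) = (ENNReal.ofReal t)⁻¹ * ENNReal.ofReal (t ^ s) := by
  rw [Real.rpow_sub_one ht.ne', div_eq_inv_mul, ENNReal.ofReal_mul (by positivity),
    ENNReal.ofReal_inv_of_pos ht]

/-- The strong type bound for `p > 1` from a weak type bound by the large values. -/
lemma lintegral_rpow_le_of_weak {p : ℝ} (hp : 1 < p) {F : α → ℝ≥0∞} {v : α → ℝ≥0}
    (hF : Measurable F) (hv : Measurable v) {C : ℝ≥0}
    (h : ∀ t : ℝ, 0 < t → μ {x | ENNReal.ofReal t < F x} ≤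
      C * (ENNReal.ofReal t)⁻¹ * ∫⁻ x in {x | t < v x}, v x ∂μ) :
    ∫⁻ x, F x ^ p ∂μ ≤ ENNReal.ofReal p * (C * ENNReal.ofReal (p - 1)⁻¹) *
      ∫⁻ x, (v x : ℝ≥0∞) ^ p ∂μ := by
  refine (lintegral_rpow_le_lintegral_meas_lt hF (by linarith : 0 < p)).trans ?_
  rw [mul_assoc]
  refine mul_le_mul' le_rfl ?_
  calc _ ≤ ∫⁻ t in Ioi (0 : ℝ), C * (ENNReal.ofReal (t ^ (p - 1 - 1)) *
          ∫⁻ x in {x | t < v x}, v x ∂μ) := by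
        refine setLIntegral_mono' measurableSet_Ioi fun t ht => ?_
        have ht0 : 0 < t := ht
        refine (mul_le_mul' (h t ht) le_rfl).trans (le_of_eq ?_)
        rw [ENNReal.ofReal_rpow_sub_one ht0 (p - 1)]
        ring
    _ = C * (ENNReal.ofReal (p - 1)⁻¹ * ∫⁻ x, v x * (v x : ℝ≥0∞) ^ (p - 1) ∂μ) := by
        rw [lintegral_const_mul' _ _ ENNReal.coe_ne_top,
          lintegral_rpow_mul_lintegral_lt (by linarith) hv.coe_nnreal_ennreal hv]
    _ = _ := by
        rw [mul_assoc]
        congr 2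
        refine lintegral_congr fun x => ?_
        nth_rw 1 [← ENNReal.rpow_one (v x : ℝ≥0∞)]
        rw [← ENNReal.rpow_add_of_nonneg _ _ (by norm_num) (by linarith)]
        congr 1; ring

/-- Real interpolation between weak type `(1, 1)` and weak type `(2, 2)`. -/
lemma lintegral_rpow_le_of_weak_of_sq {p : ℝ} (hp : 1 < p) (hp2 : p < 2) {F : α → ℝ≥0∞}
    {v : α → ℝ≥0} (hF : Measurable F) (hv : Measurable v) {C : ℝ≥0}
    (h : ∀ t : ℝ, 0 < t → μ {x | ENNReal.ofReal t < F x} ≤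
      C * (ENNReal.ofReal t)⁻¹ * ∫⁻ x in {x | t < v x}, v x ∂μ +
      C * ((ENNReal.ofReal t)⁻¹ ^ 2 * ∫⁻ x in {x | v x ≤ t}, (v x : ℝ≥0∞) ^ 2 ∂μ)) :
    ∫⁻ x, F x ^ p ∂μ ≤
      ENNReal.ofReal p * (C * (ENNReal.ofReal (p - 1)⁻¹ + ENNReal.ofReal (2 - p)⁻¹)) *
      ∫⁻ x, (v x : ℝ≥0∞) ^ p ∂μ := by
  refine (lintegral_rpow_le_lintegral_meas_lt hF (by linarith : 0 < p)).trans ?_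
  rw [mul_assoc]
  refine mul_le_mul' le_rfl ?_
  have hm1 : Measurable fun t : ℝ => ∫⁻ x in {x | t < v x}, v x ∂μ := by
    have hm : MeasurableSet {z : ℝ × α | z.1 < v z.2} :=
      measurableSet_lt measurable_fst (hv.comp measurable_snd).coe_nnreal_real
    have : (fun t : ℝ => ∫⁻ x in {x | t < v x}, (v x : ℝ≥0∞) ∂μ) = fun t => ∫⁻ x,
        {z : ℝ × α | z.1 < v z.2}.indicator (fun z => (v z.2 : ℝ≥0∞)) (t, x) ∂μ := by
      funext t
      rw [← lintegral_indicator (measurableSet_lt measurable_const hv.coe_nnreal_real)]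
      rfl
    rw [this]
    exact Measurable.lintegral_prod_right' (((hv.comp measurable_snd).coe_nnreal_ennreal).indicator hm)
  calc _ ≤ ∫⁻ t in Ioi (0 : ℝ), (C * (ENNReal.ofReal (t ^ (p - 1 - 1)) *
          ∫⁻ x in {x | t < v x}, v x ∂μ) + C * (ENNReal.ofReal (t ^ (-(2 - p) - 1)) *
          ∫⁻ x in {x | v x ≤ t}, (v x : ℝ≥0∞) ^ 2 ∂μ)) := by
        refine setLIntegral_mono' measurableSet_Ioi fun t ht => ?_
        have ht0 : 0 < t := ht
        refine (mul_le_mul' (h t ht) le_rfl).trans (le_of_eq ?_)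
        rw [show -(2 - p) - 1 = p - 1 - 1 - 1 by ring, ENNReal.ofReal_rpow_sub_one ht0 (p - 1 - 1),
          ENNReal.ofReal_rpow_sub_one ht0 (p - 1)]
        ring
    _ = C * (ENNReal.ofReal (p - 1)⁻¹ * ∫⁻ x, v x * (v x : ℝ≥0∞) ^ (p - 1) ∂μ) +
        C * (ENNReal.ofReal (2 - p)⁻¹ * ∫⁻ x, (v x : ℝ≥0∞) ^ 2 * (v x : ℝ≥0∞) ^ (-(2 - p)) ∂μ) := by
        rw [lintegral_add_left (by fun_prop), lintegral_const_mul' _ _ ENNReal.coe_ne_top,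
          lintegral_const_mul' _ _ ENNReal.coe_ne_top,
          lintegral_rpow_mul_lintegral_lt (by linarith) hv.coe_nnreal_ennreal hv,
          lintegral_rpow_mul_lintegral_ge (by linarith) (hv.coe_nnreal_ennreal.pow_const 2) hv
            (fun x hx => by simp [hx])]
    _ = _ := by
        rw [← mul_add, mul_assoc, add_mul]
        congr 2
        · congr 1
          refine lintegral_congr fun x => ?_
          nth_rw 1 [← ENNReal.rpow_one (v x : ℝ≥0∞)]
          rw [← ENNReal.rpow_add_of_nonneg _ _ (by norm_num) (by linarith)]
          congr 1; ring
        · congr 1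
          refine lintegral_congr fun x => ?_
          rcases eq_or_ne (v x) 0 with hvx | hvx
          · have : 0 < p := by linarith
            simp [hvx, this]
          rw [← ENNReal.rpow_two, ← ENNReal.rpow_add _ _ (by exact_mod_cast hvx) ENNReal.coe_ne_top]
          congr 1; ring

end Layercake

/-! ### The maximal function -/

variable {G : Type*} [MetricSpace G] [MeasurableSpace G] [OpensMeasurableSpace G]
variable {a δ : ℝ} {m : Measure G} {r₀ ε K : ℝ}

/-- The maximal function over the radii `R 0, …, R (N - 1)`. -/
def maximalAverage (m : Measure G) (R : ℕ → ℝ) (N : ℕ) (u : G → ℝ≥0∞) (x : G) : ℝ≥0∞ :=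
  ⨆ i ∈ Finset.range N, ballLAverage m (R i) u x

lemma ballLAverage_le_maximalAverage {R : ℕ → ℝ} {i N : ℕ} (hi : i < N) (u : G → ℝ≥0∞) (x : G) :
    ballLAverage m (R i) u x ≤ maximalAverage m R N u x :=
  le_iSup₂_of_le i (Finset.mem_range.2 hi) le_rfl

lemma measurable_maximalAverage [SecondCountableTopology G] [SFinite m] {R : ℕ → ℝ} {N : ℕ}
    {u : G → ℝ≥0∞} (hu : Measurable u) : Measurable (maximalAverage m R N u) :=
  Measurable.iSup fun _ => Measurable.iSup fun _ => measurable_ballLAverage _ hu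

namespace CoarseAnnular

/-- The weak type `(1, 1)` bound for the maximal function. -/
lemma exists_measure_maximalAverage_le [SecondCountableTopology G] (h : CoarseAnnular m r₀ ε K) :
    ∃ C : ℝ≥0, ∀ R : ℕ → ℝ, (∀ i, r₀ ≤ R i) → ∀ N, ∀ u : G → ℝ≥0∞, Measurable u → ∀ l : ℝ≥0∞,
      l * m {x | l < maximalAverage m R N u x} ≤ C * ∫⁻ x, u x ∂m := by
  obtain ⟨C, hC1, hC⟩ := h.exists_doubling 5
  refine ⟨C, fun R hR N u hu l => ?_⟩
  set t := {x | l < maximalAverage m R N u x} with ht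
  have hi : ∀ x : G, ∃ i, x ∈ t → i < N ∧ l < ballLAverage m (R i) u x := fun x => by
    by_cases hx : x ∈ t
    · obtain ⟨i, hi⟩ := lt_iSup_iff.1 (show l < maximalAverage m R N u x from hx)
      obtain ⟨hiN, hi⟩ := lt_iSup_iff.1 hi
      exact ⟨i, fun _ => ⟨Finset.mem_range.1 hiN, hi⟩⟩
    · exact ⟨0, fun h => absurd h hx⟩
  choose i hi using hi
  -- Finitely many radii are in play, so they are bounded, as the Vitali covering theorem demands.
  obtain ⟨Rmax, hRmax⟩ : ∃ M, ∀ j < N, R j ≤ M := by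
    obtain ⟨M, hM⟩ := ((Finset.range N).image R).bddAbove
    exact ⟨M, fun j hj => hM (by simpa using ⟨j, hj, rfl⟩)⟩
  obtain ⟨v, hvt, hvd, hv⟩ := Vitali.exists_disjoint_subfamily_covering_enlargement_closedBall t
    id (fun x => R (i x)) Rmax (fun x hx => hRmax _ (hi x hx).1) 5 (by norm_num)
  have hpos : ∀ j, 0 < R j := fun j => h.r₀_pos.trans_le (hR j)
  have hvc : v.Countable := hvd.countable_of_nonempty_interior fun x _ =>
    ⟨x, ball_subset_interior_closedBall (mem_ball_self (hpos _))⟩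
  have := hvc.to_subtype
  calc l * m t ≤ l * m (⋃ x ∈ v, closedBall x (5 * R (i x))) := by
        gcongr
        intro x hx
        obtain ⟨y, hy, hxy⟩ := hv x hx
        exact mem_biUnion hy (hxy (mem_closedBall_self (hpos _).le))
    _ ≤ l * ∑' x : v, m (closedBall x.1 (5 * R (i x))) := by
        gcongr
        exact measure_biUnion_le m hvc _
    _ ≤ ∑' x : v, C * ∫⁻ y in closedBall x.1 (R (i x)), u y ∂m := by
        rw [← ENNReal.tsum_mul_left]
        refine ENNReal.tsum_le_tsum fun x => ?_
        have h1 := hC x.1 x.1 (R (i x)) (5 * R (i x)) (hR _) (by simp)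
        have h2 := (hi x (hvt x.2)).2.le
        rw [ballLAverage] at h2
        have h0 := h.pos' x.1 (hR (i x))
        have h3 := (h.lt_top x.1 (R (i x))).ne
        calc l * m (closedBall x.1 (5 * R (i x)))
            ≤ ((m (closedBall x.1 (R (i x))))⁻¹ * ∫⁻ y in closedBall x.1 (R (i x)), u y ∂m) *
              (C * m (closedBall x.1 (R (i x)))) := mul_le_mul' h2 h1
          _ = ((m (closedBall x.1 (R (i x))))⁻¹ * m (closedBall x.1 (R (i x)))) *
              (C * ∫⁻ y in closedBall x.1 (R (i x)), u y ∂m) := by ring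
          _ = _ := by rw [ENNReal.inv_mul_cancel h0 h3, one_mul]
    _ = C * ∫⁻ y in ⋃ x ∈ v, closedBall x (R (i x)), u y ∂m := by
        rw [ENNReal.tsum_mul_left,
          lintegral_biUnion (s := fun x => closedBall x (R (i x))) hvc
          (fun x _ => measurableSet_closedBall) hvd]
    _ ≤ _ := by
        gcongr
        exact Measure.restrict_le_self

/-- Truncation: `u` is at most `l` plus its part above `l`, and the average of the constant `l` is
`l`. -/
lemma measure_maximalAverage_le_of_lt [SecondCountableTopology G] {R : ℕ → ℝ} {N : ℕ}
    (hR : ∀ x r, m (closedBall x r) < ∞) (hR' : ∀ x i, m (closedBall x (R i)) ≠ 0)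
    {u : G → ℝ≥0∞} (hu : Measurable u) (l : ℝ≥0∞) :
    {x | 2 * l < maximalAverage m R N u x} ⊆
      {x | l < maximalAverage m R N ({y | l < u y}.indicator u) x} := fun x hx => by
  obtain ⟨i, hi⟩ := lt_iSup_iff.1 (show 2 * l < maximalAverage m R N u x from hx)
  obtain ⟨hiN, hi⟩ := lt_iSup_iff.1 hi
  refine lt_of_lt_of_le ?_ (ballLAverage_le_maximalAverage (Finset.mem_range.1 hiN) _ x)
  by_contra! hcon
  refine hi.not_ge ?_
  have hms : MeasurableSet {y | l < u y} := measurableSet_lt measurable_const hu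
  calc ballLAverage m (R i) u x ≤ (m (closedBall x (R i)))⁻¹ *
        ∫⁻ y in closedBall x (R i), (l + {y | l < u y}.indicator u y) ∂m := by
        unfold ballLAverage
        gcongr with y
        by_cases hy : l < u y
        · simp [indicator, hy]
        · simp [indicator, hy, not_lt.1 hy]
    _ = l + ballLAverage m (R i) ({y | l < u y}.indicator u) x := by
        rw [lintegral_add_left measurable_const, setLIntegral_const, mul_add, ballLAverage,
          mul_left_comm, ENNReal.inv_mul_cancel (hR' _ _) (hR _ _).ne, mul_one]
    _ ≤ 2 * l := by rw [two_mul]; gcongr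

/-- The strong type `(p, p)` bound for the maximal function. -/
lemma exists_lintegral_maximalAverage_rpow_le [SecondCountableTopology G]
    (h : CoarseAnnular m r₀ ε K) {p : ℝ} (hp : 1 < p) :
    ∃ C : ℝ≥0, ∀ R : ℕ → ℝ, (∀ i, r₀ ≤ R i) → ∀ N, ∀ u : G → ℝ≥0, Measurable u →
      ∫⁻ x, maximalAverage m R N (fun y => u y) x ^ p ∂m ≤ C * ∫⁻ x, (u x : ℝ≥0∞) ^ p ∂m := by
  obtain ⟨C, hC⟩ := h.exists_measure_maximalAverage_le
  have := h.sigmaFinite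
  refine ⟨p.toNNReal * (C * (p - 1)⁻¹.toNNReal) * 2 ^ p, fun R hR N u hu => ?_⟩
  have hu' : Measurable fun y => (u y : ℝ≥0∞) := hu.coe_nnreal_ennreal
  have hp0 : 0 ≤ p := by linarith
  -- With `v = 2 * u` the level `t` of `v` is the truncation level `t / 2` of `u`.
  have := lintegral_rpow_le_of_weak (μ := m) hp (measurable_maximalAverage (m := m) (R := R) (N := N) hu')
    (v := fun x => 2 * u x) (hu.const_mul 2) (C := C) fun t ht => by
    set l := ENNReal.ofReal (t / 2) with hl
    have hl0 : l ≠ 0 := by simpa [hl] using ht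
    have htl : ENNReal.ofReal t = 2 * l := by
      rw [hl, ← ENNReal.ofReal_ofNat, ← ENNReal.ofReal_mul (by norm_num)]
      congr 1; ring
    have hset : {x | t < (2 * u x : ℝ≥0)} = {y | l < (u y : ℝ≥0∞)} := by
      ext x
      rw [mem_ofPred_eq, mem_ofPred_eq, hl, ← ENNReal.ofReal_coe_nnreal,
        ENNReal.ofReal_lt_ofReal_iff_of_nonneg (by positivity), NNReal.coe_mul, NNReal.coe_ofNat]
      constructor <;> intro h <;> linarith
    have hms : MeasurableSet {y | l < (u y : ℝ≥0∞)} := measurableSet_lt measurable_const hu'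
    have h1 := hC R hR N _ (hu'.indicator hms) l
    rw [lintegral_indicator hms] at h1
    rw [hset, htl]
    refine (measure_mono (measure_maximalAverage_le_of_lt h.lt_top (fun x i => h.pos' x (hR i))
      hu' l)).trans ?_
    have h2 : ∀ A B : ℝ≥0∞, l * A ≤ B → A ≤ l⁻¹ * B := fun A B hAB => by
      calc A = l⁻¹ * (l * A) := by
            rw [← mul_assoc, ENNReal.inv_mul_cancel hl0 ENNReal.ofReal_ne_top, one_mul]
        _ ≤ _ := by gcongr
    refine (h2 _ _ h1).trans (le_of_eq ?_)
    rw [ENNReal.mul_inv (by simp) (by simp)]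
    simp_rw [ENNReal.coe_mul, ENNReal.coe_ofNat]
    rw [lintegral_const_mul _ hu']
    calc _ = (2⁻¹ * 2) * (l⁻¹ * (C * ∫⁻ x in {y | l < (u y : ℝ≥0∞)}, u x ∂m)) := by
          rw [ENNReal.inv_mul_cancel (by norm_num) (by norm_num), one_mul]
      _ = _ := by ring
  refine this.trans (le_of_eq ?_)
  simp_rw [ENNReal.coe_mul, ENNReal.mul_rpow_of_nonneg _ _ hp0, ENNReal.coe_ofNat]
  rw [lintegral_const_mul _ (hu'.pow_const p), ENNReal.coe_rpow_of_nonneg _ hp0]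
  simp only [ENNReal.ofReal, ENNReal.coe_ofNat]
  ring

end CoarseAnnular

end

/-! ### Calderón–Zygmund decomposition and the weak type `(1, 1)` bound. -/

section

variable {G : Type*} [MetricSpace G] [MeasurableSpace G] [OpensMeasurableSpace G]
variable {a δ : ℝ} {m : Measure G} {r₀ ε K : ℝ}

namespace CubeSystem

variable (𝒟 : CubeSystem G a δ)

open scoped Classical in
/-- The largest `k ≤ N` such that the average of `u` over the cube of generation `k` containing `x`
exceeds `l`, and `0` if there is none. -/
def stopIndex (m : Measure G) (N : ℕ) (l : ℝ≥0∞) (u : G → ℝ≥0∞) (x : G) : ℕ :=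
  Nat.findGreatest (fun k => l < 𝒟.laverage m k u x) N

variable {N : ℕ} {l : ℝ≥0∞} {u : G → ℝ≥0∞}

/-- Stopping at `k` is decided by the averages of generations at least `k`, all of which are
constant on cubes of generation `k`. -/
lemma isConst_stopIndex (k : ℕ) : 𝒟.IsConst k (· ∈ {x | 𝒟.stopIndex m N l u x = k}) := by
  intro x y hxy
  have hc : ∀ j, k ≤ j → 𝒟.laverage m j u x = 𝒟.laverage m j u y := fun j hj =>
    𝒟.isConst_laverage m j u x y (𝒟.eq_of_le hj hxy)
  classical
  simp only [mem_ofPred_eq, stopIndex, Nat.findGreatest_eq_iff, eq_iff_iff]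
  rw [hc k le_rfl]
  refine and_congr_right fun _ => and_congr_right fun _ => forall_congr' fun n => ?_
  refine forall_congr' fun hn => ?_
  rw [hc n hn.le]

lemma measurableSet_stopIndex (k : ℕ) : MeasurableSet {x | 𝒟.stopIndex m N l u x = k} :=
  IsConst.measurableSet (𝒟.isConst_stopIndex k)

lemma stopIndex_le (x : G) : 𝒟.stopIndex m N l u x ≤ N := by
  classical
  exact Nat.findGreatest_le N

/-- The index `0` is excluded because it is also the default when no average exceeds `l`. -/
lemma lt_laverage_of_stopIndex {k : ℕ} (hk : k ≠ 0) {x : G} (hx : 𝒟.stopIndex m N l u x = k) :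
    l < 𝒟.laverage m k u x := by
  classical
  exact Nat.findGreatest_of_ne_zero (P := fun k => l < 𝒟.laverage m k u x) hx hk

lemma laverage_le_of_stopIndex_lt {k : ℕ} {x : G} (hx : 𝒟.stopIndex m N l u x < k) (hk : k ≤ N) :
    𝒟.laverage m k u x ≤ l := by
  classical
  exact not_lt.1 (Nat.findGreatest_is_greatest (P := fun k => l < 𝒟.laverage m k u x) hx hk)

open scoped Classical in
lemma sum_indicator_stopIndex {E : Type*} [AddCommMonoid E] (F : ℕ → G → E) (M : ℕ) (x : G) :
    ∑ k ∈ Finset.range M, {x | 𝒟.stopIndex m N l u x = k}.indicator (F k) x =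
      if 𝒟.stopIndex m N l u x < M then F (𝒟.stopIndex m N l u x) x else 0 := by
  split_ifs with hx
  · rw [Finset.sum_eq_single (𝒟.stopIndex m N l u x)]
    · exact indicator_of_mem (s := {y | 𝒟.stopIndex m N l u y = 𝒟.stopIndex m N l u x}) rfl _
    · exact fun k _ hk => indicator_of_notMem
        (s := {y | 𝒟.stopIndex m N l u y = k}) (fun h => hk (Eq.symm h)) _
    · exact fun h => absurd (Finset.mem_range.2 hx) h
  · refine Finset.sum_eq_zero fun k hk => indicator_of_notMem (fun h => hx ?_) _
    rw [show 𝒟.stopIndex m N l u x = k from h]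
    exact Finset.mem_range.1 hk

lemma sum_setLIntegral_stopIndex_le (M : ℕ) {v : G → ℝ≥0∞} (hv : Measurable v) :
    ∑ k ∈ Finset.range M, ∫⁻ x in {x | 𝒟.stopIndex m N l u x = k}, v x ∂m ≤ ∫⁻ x, v x ∂m := by
  classical
  calc _ = ∑ k ∈ Finset.range M, ∫⁻ x, {x | 𝒟.stopIndex m N l u x = k}.indicator v x ∂m := by
        simp_rw [lintegral_indicator (𝒟.measurableSet_stopIndex _)]
    _ = ∫⁻ x, ∑ k ∈ Finset.range M, {x | 𝒟.stopIndex m N l u x = k}.indicator v x ∂m :=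
        (lintegral_finsetSum _ fun k _ => hv.indicator (𝒟.measurableSet_stopIndex k)).symm
    _ ≤ _ := by
        refine lintegral_mono fun x => ?_
        dsimp only
        rw [𝒟.sum_indicator_stopIndex (fun _ => v)]
        split_ifs
        · exact le_rfl
        · exact zero_le

section

variable (h : CoarseAnnular m r₀ ε K) (hs : GoodScales a δ r₀)
include h hs

lemma laverage_mul_measure (k : ℕ) (u : G → ℝ≥0∞) (x : G) :
    𝒟.laverage m k u x * m (𝒟.cube k x) = ∫⁻ y in 𝒟.cube k x, u y ∂m := by
  rw [laverage, mul_comm, ← mul_assoc, ENNReal.mul_inv_cancel (𝒟.measure_cube_ne_zero h hs k x)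
    (𝒟.measure_cube_ne_top h hs k x), one_mul]

lemma cube_subset_cube_succ (k : ℕ) (x : G) : 𝒟.cube k x ⊆ 𝒟.cube (k + 1) x :=
  fun y hy => 𝒟.succ k y x hy

lemma exists_laverage_le_succ : ∃ C : ℝ≥0, ∀ (u : G → ℝ≥0∞) k x,
    𝒟.laverage m k u x ≤ C * 𝒟.laverage m (k + 1) u x := by
  obtain ⟨C, hC1, hC⟩ := 𝒟.exists_measure_closedBall_le_cube h hs (5 / 2 * δ)
  refine ⟨C, fun u k x => ?_⟩
  have h1 : m (𝒟.cube (k + 1) x) ≤ C * m (𝒟.cube k x) :=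
    (measure_mono (𝒟.cube_subset_closedBall (k + 1) x)).trans (hC k x x _ (by
      rw [dist_self, zero_add, pow_succ]; linarith))
  have h2 := ENNReal.inv_le_const_mul_inv (by positivity : C ≠ 0) h1
  unfold laverage
  rw [← mul_assoc]
  exact mul_le_mul' h2 (lintegral_mono_set (𝒟.cube_subset_cube_succ h hs k x))

/-- Serves to place a neighbourhood of every stopped cube inside a level set of the maximal
function. -/
lemma exists_laverage_le_ballLAverage : ∃ C : ℝ≥0, C ≠ 0 ∧ ∀ (u : G → ℝ≥0∞) k x y,
    dist x y ≤ a * δ ^ (k + 1) →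
    𝒟.laverage m k u y ≤ C * ballLAverage m (3 * (a * δ ^ (k + 2))) u x := by
  obtain ⟨C, hC1, hC⟩ := 𝒟.exists_measure_closedBall_le_cube h hs (δ + 3 * δ ^ 2)
  refine ⟨C, by positivity, fun u k x y hxy => ?_⟩
  have hk := hs.scale_pos k
  have h1 := hs.scale_succ k
  have h2 := hs.scale_succ (k + 1)
  have h3 : m (closedBall x (3 * (a * δ ^ (k + 2)))) ≤ C * m (𝒟.cube k y) := by
    refine hC k y x _ ?_
    rw [dist_comm]
    calc _ ≤ a * δ ^ (k + 1) + 3 * (a * δ ^ (k + 2)) := by linarith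
      _ = _ := by ring
  unfold laverage ballLAverage
  rw [← mul_assoc]
  refine mul_le_mul' (ENNReal.inv_le_const_mul_inv (by positivity : C ≠ 0) h3)
    (lintegral_mono_set fun z hz => ?_)
  have h4 := 𝒟.dist_le_of_mem_cube hz
  rw [mem_closedBall]
  have := dist_triangle z y x
  rw [dist_comm y x] at this
  linarith

end

end CubeSystem

section

variable (h : CoarseAnnular m r₀ ε K) (hs : GoodScales a δ r₀)
include h hs

/-- The weak type `(1, 1)` bound for the short variation. -/
theorem exists_measure_squareVariation_le [SecondCountableTopology G] [Nonempty G] :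
    ∃ C : ℝ≥0, ∀ f : G → ℂ, Measurable f → BallIntegrable m f → ∀ N, ∀ l : ℝ≥0, l ≠ 0 →
      l * m {x | (l : ℝ≥0∞) ^ 2 < squareVariation m a δ N f x} ≤ C * ∫⁻ x, ‖f x‖ₑ ∂m := by
  obtain ⟨𝒟⟩ := exists_cubeSystem (G := G) hs.a_pos hs.le_δ
  obtain ⟨C1, hC1⟩ := 𝒟.exists_laverage_le_succ h hs
  obtain ⟨C2, hC20, hC2⟩ := 𝒟.exists_laverage_le_ballLAverage h hs
  obtain ⟨C3, hC3⟩ := h.exists_measure_maximalAverage_le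
  obtain ⟨C4, hC4⟩ := exists_lintegral_squareVariation_le h hs
  obtain ⟨C5, hC5⟩ := 𝒟.exists_scaleVariation_sq_le_of_density h hs
  obtain ⟨C6, hC6⟩ := h.exists_lintegral_ballLAverage_le
  have hϑ1 := ratio_lt_one h hs
  set ϑ := (δ ^ (-(ε / 2))).toNNReal with hϑ
  obtain ⟨q, hq0, hq1, hqϑ, -⟩ := NNReal.exists_sq_bounds hϑ1 hϑ1
  have hϑq : ∀ d : ℕ, (ϑ : ℝ≥0∞) ^ d ≤ ((q : ℝ≥0∞) ^ d) ^ 2 := fun d => by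
    rw [← pow_mul, mul_comm, pow_mul]
    gcongr
    exact_mod_cast hqϑ
  set A : ℝ≥0∞ := 2 * (1 - (q : ℝ≥0∞))⁻¹ with hA
  have hAt : A ≠ ∞ := by
    refine ENNReal.mul_ne_top (by norm_num) (ENNReal.inv_ne_top.2 ?_)
    exact (tsub_pos_of_lt (by exact_mod_cast hq1)).ne'
  set B : ℝ≥0∞ := C5 * (2 * C1) * C6 with hB
  have hBt : B ≠ ∞ := by simp [hB, ENNReal.mul_eq_top]
  set D : ℝ≥0∞ := C2 * C3 + (2 * (C4 * C1) + 2 * (B * A ^ 2 * 2)) with hD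
  have hDt : D ≠ ∞ := by simp [hD, ENNReal.mul_eq_top, hAt, hBt]
  refine ⟨D.toNNReal, fun f hfm hf N l hl0 => ?_⟩
  rw [ENNReal.coe_toNNReal hDt]
  have hl0' : (l : ℝ≥0∞) ≠ 0 := by exact_mod_cast hl0
  set I := ∫⁻ x, ‖f x‖ₑ ∂m with hI
  set u : G → ℝ≥0∞ := fun y => ‖f y‖ₑ with hu
  have hum : Measurable u := hfm.enorm
  set S : ℕ → Set G := fun k => {x | 𝒟.stopIndex m N l u x = k} with hS
  have hSm : ∀ k, MeasurableSet (S k) := fun k => 𝒟.measurableSet_stopIndex k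
  have hSc : ∀ k, 𝒟.IsConst k (· ∈ S k) := fun k => 𝒟.isConst_stopIndex k
  have hSi : ∀ k {x y}, y ∈ 𝒟.cube k x → (y ∈ S k ↔ x ∈ S k) := fun k x y hy =>
    iff_of_eq (hSc k y x hy)
  have hEB := fun k => 𝒟.ballIntegrable_average h hs hf k
  have hEc := fun k => 𝒟.isConst_average m k f
  have hEm : ∀ k, Measurable (𝒟.average m k f) := fun k => (hEc k).measurable
  -- Stopping at `k < N` means that the average over the next larger cube is at most `l`; doubling
  -- transfers this to the cube of generation `k`. For `k = 0` it covers the default case too.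
  have hdens : ∀ k < N, ∀ x ∈ S k, 𝒟.laverage m k u x ≤ C1 * l := fun k hk x hx => by
    refine (hC1 u k x).trans ?_
    gcongr
    refine 𝒟.laverage_le_of_stopIndex_lt ?_ (show k + 1 ≤ N from hk)
    rw [show 𝒟.stopIndex m N l u x = k from hx]
    exact Nat.lt_succ_self k
  -- On `S 0`, which includes the points without any large average, `f` is also replaced by its mean
  -- over the smallest cubes. No differentiation theorem is needed, and `b 0` still has mean zero on
  -- these cubes.
  set b : ℕ → G → ℂ := fun k => (S k).indicator fun y => f y - 𝒟.average m k f y with hb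
  set g : G → ℂ := fun x => ∑ k ∈ Finset.range N, (S k).indicator (𝒟.average m k f) x with hg
  -- On top-generation cubes with large average no larger cube is available to bound the density, so
  -- `f` is left untouched there; off the exceptional set no scale `i < N` sees this part.
  set e : G → ℂ := (S N).indicator f with he
  have hind : ∀ k {φ : G → ℂ}, BallIntegrable m φ → BallIntegrable m ((S k).indicator φ) :=
    fun k φ hφ x r => (hφ x r).indicator (hSm k)
  have hbB : ∀ k, BallIntegrable m (b k) := fun k => hind k (hf.sub (hEB k))
  have hbm : ∀ k, Measurable (b k) := fun k => (hfm.sub (hEm k)).indicator (hSm k)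
  have hgB : BallIntegrable m g := BallIntegrable.sum fun k _ => hind k (hEB k)
  have hgm : Measurable g := Finset.measurable_fun_sum _ fun k _ => (hEm k).indicator (hSm k)
  have heB : BallIntegrable m e := hind N hf
  have hdecomp : f = fun x => (g x + e x) + ∑ k ∈ Finset.range N, b k x := by
    classical
    funext x
    simp only [hg, he, hb, hS]
    rw [𝒟.sum_indicator_stopIndex (fun k => 𝒟.average m k f),
      𝒟.sum_indicator_stopIndex (fun k y => f y - 𝒟.average m k f y)]
    rcases lt_or_eq_of_le (𝒟.stopIndex_le (m := m) (N := N) (l := l) (u := u) x) with hlt | heq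
    · rw [if_pos hlt, if_pos hlt, indicator_of_notMem (by exact hlt.ne)]
      ring
    · rw [if_neg heq.not_lt, if_neg heq.not_lt, indicator_of_mem (by exact heq)]
      ring
  -- the bad functions
  have hbz : ∀ k, 𝒟.MeanZero m k (b k) := fun k x => by
    by_cases hx : x ∈ S k
    · rw [← 𝒟.meanZero_sub_average h hs hf k x]
      refine setIntegral_congr_fun (𝒟.measurableSet_cube k x) fun y hy => ?_
      have : y ∈ S k := by rwa [hSi k hy]
      simp [hb, this]
    · rw [← integral_zero G ℂ (μ := m.restrict (𝒟.cube k x))]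
      refine setIntegral_congr_fun (𝒟.measurableSet_cube k x) fun y hy => ?_
      have : y ∉ S k := by rwa [hSi k hy]
      simp [hb, this]
  have hbu : ∀ k x, ∫⁻ y in 𝒟.cube k x, ‖b k y‖ₑ ∂m ≤
      ∫⁻ y in 𝒟.cube k x, (S k).indicator (fun y => 2 * u y) y ∂m := fun k x => by
    by_cases hx : x ∈ S k
    · have hmem : ∀ y ∈ 𝒟.cube k x, y ∈ S k := fun y hy => by rwa [hSi k hy]
      calc _ ≤ ∫⁻ y in 𝒟.cube k x, (u y + ‖𝒟.average m k f y‖ₑ) ∂m := by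
            refine setLIntegral_mono' (𝒟.measurableSet_cube k x) fun y hy => ?_
            simp only [hb, indicator_of_mem (hmem y hy)]
            exact enorm_sub_le
        _ ≤ ∫⁻ y in 𝒟.cube k x, u y ∂m + ∫⁻ y in 𝒟.cube k x, u y ∂m := by
            rw [lintegral_add_left hum]
            exact add_le_add le_rfl (𝒟.setLIntegral_enorm_average_le h hs k f x)
        _ = ∫⁻ y in 𝒟.cube k x, 2 * u y ∂m := by
            rw [lintegral_const_mul _ hum, two_mul]
        _ = _ := setLIntegral_congr_fun (𝒟.measurableSet_cube k x) fun y hy => by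
            simp [hmem y hy]
    · have hmem : ∀ y ∈ 𝒟.cube k x, y ∉ S k := fun y hy => by rwa [hSi k hy]
      rw [setLIntegral_congr_fun (g := fun _ => 0) (𝒟.measurableSet_cube k x) fun y hy => by
        simp [hb, hmem y hy]]
      simp
  have hbl : ∀ k < N, ∀ x, ∫⁻ y in 𝒟.cube k x, ‖b k y‖ₑ ∂m ≤ 2 * C1 * l * m (𝒟.cube k x) := by
    intro k hk x
    refine (hbu k x).trans ?_
    by_cases hx : x ∈ S k
    · calc _ ≤ ∫⁻ y in 𝒟.cube k x, 2 * u y ∂m := lintegral_mono fun y => indicator_le_self _ _ y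
        _ = 2 * (𝒟.laverage m k u x * m (𝒟.cube k x)) := by
            rw [lintegral_const_mul _ hum, 𝒟.laverage_mul_measure h hs]
        _ ≤ 2 * (C1 * l * m (𝒟.cube k x)) := by gcongr; exact hdens k hk x hx
        _ = _ := by ring
    · rw [setLIntegral_congr_fun (g := fun _ => 0) (𝒟.measurableSet_cube k x) fun y hy => ?_]
      · simp
      · have : y ∉ S k := by rwa [hSi k hy]
        simp [this]
  have hb1 : ∑ k ∈ Finset.range N, l * ∫⁻ x, ‖b k x‖ₑ ∂m ≤ 2 * l * I := by
    calc _ ≤ ∑ k ∈ Finset.range N, l * (2 * ∫⁻ x in S k, u x ∂m) := by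
          refine Finset.sum_le_sum fun k _ => mul_le_mul' le_rfl ?_
          refine (𝒟.lintegral_le_of_cube_le (hbm k).enorm
            ((hum.const_mul 2).indicator (hSm k)) (hbu k)).trans (le_of_eq ?_)
          rw [lintegral_indicator (hSm k), lintegral_const_mul _ hum]
      _ = 2 * l * ∑ k ∈ Finset.range N, ∫⁻ x in S k, u x ∂m := by
          rw [Finset.mul_sum]
          exact Finset.sum_congr rfl fun k _ => by ring
      _ ≤ _ := by
          gcongr
          exact 𝒟.sum_setLIntegral_stopIndex_le N hum
  -- the good function
  have hgl : ∀ x, ‖g x‖ₑ ≤ C1 * l := fun x => by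
    classical
    simp only [hg, hS]
    rw [𝒟.sum_indicator_stopIndex (fun k => 𝒟.average m k f)]
    split_ifs with hx
    · exact (𝒟.enorm_average_le h hs _ f x).trans (hdens _ hx x rfl)
    · simp
  have hg1 : ∫⁻ x, ‖g x‖ₑ ∂m ≤ I := by
    calc _ ≤ ∫⁻ x, ∑ k ∈ Finset.range N, ‖(S k).indicator (𝒟.average m k f) x‖ₑ ∂m :=
          lintegral_mono fun x => enorm_sum_le _ _
      _ = ∑ k ∈ Finset.range N, ∫⁻ x in S k, ‖𝒟.average m k f x‖ₑ ∂m := by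
          rw [lintegral_finsetSum _ fun k _ => ((hEm k).indicator (hSm k)).enorm]
          refine Finset.sum_congr rfl fun k _ => ?_
          rw [← lintegral_indicator (hSm k)]
          simp_rw [enorm_indicator_eq_indicator_enorm]
      _ ≤ ∑ k ∈ Finset.range N, ∫⁻ x in S k, u x ∂m := Finset.sum_le_sum fun k _ =>
          𝒟.setLIntegral_le_of_cube_le (𝒟.setLIntegral_enorm_average_le h hs k f) (hSc k)
      _ ≤ _ := 𝒟.sum_setLIntegral_stopIndex_le N hum
  have hg2 : ∫⁻ x, ‖g x‖ₑ ^ 2 ∂m ≤ C1 * l * I := by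
    calc _ ≤ ∫⁻ x, C1 * l * ‖g x‖ₑ ∂m := by
          refine lintegral_mono fun x => ?_
          rw [sq]
          exact mul_le_mul' (hgl x) le_rfl
      _ ≤ _ := by
          rw [lintegral_const_mul _ hgm.enorm]
          gcongr
  -- the exceptional set
  set Ω : Set G := {x | ∃ k y, k ≠ 0 ∧ k ≤ N ∧ dist x y ≤ a * δ ^ (k + 1) ∧
    l < 𝒟.laverage m k u y} with hΩ
  have hΩm : l * m Ω ≤ C2 * C3 * I := by
    have hsub : Ω ⊆ {x | l / C2 < maximalAverage m (fun i => 3 * (a * δ ^ (i + 2))) (N + 1) u x} := by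
      rintro x ⟨k, y, -, hkN, hxy, hlt⟩
      refine lt_of_lt_of_le ?_ (ballLAverage_le_maximalAverage (Nat.lt_succ_of_le hkN) u x)
      refine ENNReal.div_lt_of_lt_mul' (hlt.trans_le (hC2 u k x y hxy))
    have h1 := hC3 (fun i => 3 * (a * δ ^ (i + 2)))
      (fun i => by linarith [hs.le_scale (i + 2), hs.r₀_pos]) (N + 1) u hum (l / C2)
    calc _ = C2 * (l / C2 * m Ω) := by
          rw [← mul_assoc, ENNReal.mul_div_cancel (by exact_mod_cast hC20) ENNReal.coe_ne_top]
      _ ≤ C2 * (C3 * I) := by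
          refine mul_le_mul' le_rfl (le_trans ?_ h1)
          gcongr
      _ = _ := by ring
  -- For `i < k` the balls of scale `i` have radius below `a * δ ^ (k + 1)`, whereas points that
  -- close to a stopped cube of generation `k ≥ 1` belong to `Ω`.
  have hvan : ∀ x ∉ Ω, ∀ i k, i < k → k ≤ N → ∀ φ : G → ℂ,
      scaleVariation m a δ i ((S k).indicator φ) x = 0 := fun x hx i k hik hkN φ => by
    have hz : ∀ y, dist x y ≤ a * δ ^ (k + 1) → (S k).indicator φ y = 0 := fun y hy => by
      refine indicator_of_notMem (fun hyS => hx ⟨k, y, by omega, hkN, hy, ?_⟩) _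
      exact 𝒟.lt_laverage_of_stopIndex (by omega) hyS
    refine CubeSystem.scaleVariation_eq_zero_of_forall h hs i fun y hy => ?_
    rw [hz x (by rw [dist_self]; exact (hs.scale_pos _).le), hz y]
    rw [dist_comm]
    exact (mem_closedBall.1 hy).trans (hs.scale_mono (by omega))
  -- The terms with `k > i` vanish off `Ω` and may be discarded.
  set V : ℕ → ℕ → G → ℝ≥0∞ := fun i k => if k ≤ i then scaleVariation m a δ i (b k) else 0 with hV
  have hVm : ∀ i k, Measurable (V i k) := fun i k => by
    simp only [hV]
    split_ifs
    · exact measurable_scaleVariation h hs i (hbm k) (hbB k)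
    · exact measurable_const
  -- The density bound converts one factor of `b k` into a multiple of `l`, so the right side costs
  -- `l * ∫ ‖b k‖`, which sums to at most `2 * l * I`.
  have hVle : ∀ i < N, ∀ k < N, ∫⁻ x, V i k x ^ 2 ∂m ≤
      B * ((q : ℝ≥0∞) ^ ((i - k) + (k - i))) ^ 2 * (l * ∫⁻ x, ‖b k x‖ₑ ∂m) := by
    intro i _ k hk
    simp only [hV]
    split_ifs with hki
    · rw [Nat.sub_eq_zero_of_le hki, add_zero]
      calc _ ≤ ∫⁻ x, C5 * (ϑ : ℝ≥0∞) ^ (i - k) * (2 * C1 * l) *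
            ballLAverage m (a * δ ^ (i + 2)) (fun y => ‖b k y‖ₑ) x ∂m :=
            lintegral_mono fun x => hC5 (b k) (hbB k) k i hki (hbz k) _ (hbl k hk) x
        _ = C5 * (ϑ : ℝ≥0∞) ^ (i - k) * (2 * C1 * l) *
            ∫⁻ x, ballLAverage m (a * δ ^ (i + 2)) (fun y => ‖b k y‖ₑ) x ∂m :=
            lintegral_const_mul' _ _ (by
              refine ENNReal.mul_ne_top (ENNReal.mul_ne_top ENNReal.coe_ne_top
                (ENNReal.pow_ne_top ENNReal.coe_ne_top)) ?_
              simp [ENNReal.mul_eq_top])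
        _ ≤ C5 * ((q : ℝ≥0∞) ^ (i - k)) ^ 2 * (2 * C1 * l) * (C6 * ∫⁻ x, ‖b k x‖ₑ ∂m) := by
            refine mul_le_mul' (mul_le_mul' (mul_le_mul' le_rfl (hϑq _)) le_rfl)
              (hC6 _ ?_ _ (hbm k).enorm)
            linarith [hs.le_scale (i + 2), hs.r₀_pos]
        _ = _ := by rw [hB]; ring
    · simp
  have hSchur := lintegral_sum_sq_le (μ := m) hVm (q := q) (C := B)
    (by exact_mod_cast hq0.ne') ENNReal.coe_ne_top hVle
  set H : G → ℝ≥0∞ := fun x => 2 * squareVariation m a δ N g x +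
    2 * ∑ i ∈ Finset.range N, (∑ k ∈ Finset.range N, V i k x) ^ 2 with hH
  have hpt : ∀ x ∉ Ω, squareVariation m a δ N f x ≤ H x := fun x hx => by
    simp only [squareVariation, hH]
    rw [Finset.mul_sum, Finset.mul_sum, ← Finset.sum_add_distrib]
    refine Finset.sum_le_sum fun i hi => ?_
    have hiN := Finset.mem_range.1 hi
    refine le_trans ?_ (ENNReal.add_sq_le _ _)
    gcongr
    calc scaleVariation m a δ i f x
        = scaleVariation m a δ i (fun x => (g x + e x) + ∑ k ∈ Finset.range N, b k x) x := by
          rw [← hdecomp]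
      _ ≤ (scaleVariation m a δ i g x + scaleVariation m a δ i e x) +
          ∑ k ∈ Finset.range N, scaleVariation m a δ i (b k) x :=
          (scaleVariation_add_le h hs i (hgB.add heB) (BallIntegrable.sum fun k _ => hbB k) x).trans
            (add_le_add (scaleVariation_add_le h hs i hgB heB x)
              (scaleVariation_sum_le h hs i _ (fun k _ => hbB k) x))
      _ ≤ _ := by
          rw [he, hvan x hx i N hiN le_rfl, add_zero]
          refine add_le_add le_rfl (Finset.sum_le_sum fun k hk => ?_)
          simp only [hV]
          split_ifs with hki
          · exact le_rfl
          · rw [hb, hvan x hx i k (not_le.1 hki) (Finset.mem_range.1 hk).le]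
            exact zero_le
  have hHint : ∫⁻ x, H x ∂m ≤ (2 * (C4 * C1) + 2 * (B * A ^ 2 * 2)) * l * I := by
    have hm1 := (measurable_squareVariation h hs N hgm hgB).const_mul 2
    have hm2 : ∀ i, Measurable fun x => (∑ k ∈ Finset.range N, V i k x) ^ 2 := fun i =>
      (Finset.measurable_fun_sum _ fun k _ => hVm i k).pow_const 2
    simp only [hH]
    rw [lintegral_add_left hm1, lintegral_const_mul' _ _ (by norm_num),
      lintegral_const_mul' _ _ (by norm_num), lintegral_finsetSum _ fun i _ => hm2 i]
    calc _ ≤ 2 * (C4 * (C1 * l * I)) + 2 * (B * A ^ 2 * (2 * l * I)) := by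
          refine add_le_add (mul_le_mul' le_rfl ((hC4 g hgm hgB N).trans (mul_le_mul' le_rfl hg2)))
            (mul_le_mul' le_rfl (hSchur.trans (mul_le_mul' le_rfl hb1)))
      _ = _ := by ring
  have hmark : l ^ 2 * m {x | (l : ℝ≥0∞) ^ 2 ≤ H x} ≤
      (2 * (C4 * C1) + 2 * (B * A ^ 2 * 2)) * l * I := by
    refine le_trans (mul_meas_ge_le_lintegral ?_ _) hHint
    exact ((measurable_squareVariation h hs N hgm hgB).const_mul 2).add
      ((Finset.measurable_fun_sum _ fun i _ =>
        (Finset.measurable_fun_sum _ fun k _ => hVm i k).pow_const 2).const_mul 2)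
  have hmark' : l * m {x | (l : ℝ≥0∞) ^ 2 ≤ H x} ≤ (2 * (C4 * C1) + 2 * (B * A ^ 2 * 2)) * I := by
    have hlt : (l : ℝ≥0∞) ≠ ∞ := ENNReal.coe_ne_top
    rw [← ENNReal.mul_le_mul_iff_right hl0' hlt]
    calc _ = l ^ 2 * m {x | (l : ℝ≥0∞) ^ 2 ≤ H x} := by ring
      _ ≤ _ := hmark
      _ = _ := by ring
  calc _ ≤ l * (m Ω + m {x | (l : ℝ≥0∞) ^ 2 ≤ H x}) := by
        refine mul_le_mul' le_rfl ((measure_mono fun x hx => ?_).trans (measure_union_le _ _))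
        by_cases hxΩ : x ∈ Ω
        · exact Or.inl hxΩ
        · exact Or.inr (le_trans (le_of_lt hx) (hpt x hxΩ))
    _ ≤ C2 * C3 * I + (2 * (C4 * C1) + 2 * (B * A ^ 2 * 2)) * I := by
        rw [mul_add]
        exact add_le_add hΩm hmark'
    _ = _ := by rw [hD]; ring

end

end

/-! ### Strong type for `1 < p < 2` by interpolation. -/

section

variable {G : Type*} [MetricSpace G] [MeasurableSpace G] [OpensMeasurableSpace G]
variable {a δ : ℝ} {m : Measure G} {r₀ ε K : ℝ}

lemma BallIntegrable.indicator {f : G → ℂ} (hf : BallIntegrable m f) {S : Set G}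
    (hS : MeasurableSet S) : BallIntegrable m (S.indicator f) :=
  fun x r => (hf x r).indicator hS

section

variable (h : CoarseAnnular m r₀ ε K) (hs : GoodScales a δ r₀)
include h hs

lemma squareVariation_add_le (N : ℕ) {f g : G → ℂ} (hf : BallIntegrable m f)
    (hg : BallIntegrable m g) (x : G) : squareVariation m a δ N (fun y => f y + g y) x ≤
      2 * squareVariation m a δ N f x + 2 * squareVariation m a δ N g x := by
  simp only [squareVariation]
  rw [Finset.mul_sum, Finset.mul_sum, ← Finset.sum_add_distrib]
  refine Finset.sum_le_sum fun i _ => (pow_le_pow_left₀ zero_le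
    (scaleVariation_add_le h hs i hf hg x) 2).trans (ENNReal.add_sq_le _ _)

/-- The strong type bound for the short variation for `1 < p < 2`. -/
theorem exists_lintegral_squareVariation_rpow_le_of_lt_two [SecondCountableTopology G] [Nonempty G]
    {p : ℝ} (hp : 1 < p) (hp2 : p < 2) : ∃ C : ℝ≥0, ∀ f : G → ℂ, Measurable f →
      BallIntegrable m f → ∀ N, ∫⁻ x, squareVariation m a δ N f x ^ (p / 2) ∂m ≤
        C * ∫⁻ x, ‖f x‖ₑ ^ p ∂m := by
  obtain ⟨C1, hC1⟩ := exists_measure_squareVariation_le h hs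
  obtain ⟨C2, hC2⟩ := exists_lintegral_squareVariation_le h hs
  have := h.sigmaFinite
  set C : ℝ≥0 := 2 * C1 + 4 * C2 with hC
  refine ⟨p.toNNReal * (C * ((p - 1)⁻¹.toNNReal + (2 - p)⁻¹.toNNReal)), fun f hfm hf N => ?_⟩
  have hFm : Measurable fun x => squareVariation m a δ N f x ^ (1 / 2 : ℝ) :=
    (measurable_squareVariation h hs N hfm hf).pow_const _
  have key := lintegral_rpow_le_of_weak_of_sq (μ := m) hp hp2 hFm hfm.nnnorm (C := C)
    fun t ht => ?_
  · calc _ = ∫⁻ x, (squareVariation m a δ N f x ^ (1 / 2 : ℝ)) ^ p ∂m := by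
          refine lintegral_congr fun x => ?_
          rw [← ENNReal.rpow_mul]
          congr 1; ring
      _ ≤ _ := key
      _ = _ := by
          simp only [ENNReal.coe_mul, ENNReal.coe_add]
          rfl
  -- Halving suffices: if both pieces have square variation at most `l ^ 2`, that of `f` is at most
  -- `2 * l ^ 2 + 2 * l ^ 2 = t ^ 2`. The factors `l⁻¹ = 2 * t⁻¹` and `l⁻¹ ^ 2 = 4 * t⁻¹ ^ 2`
  -- explain `C`.
  set l : ℝ≥0 := t.toNNReal / 2 with hl
  have ht0 : t.toNNReal ≠ 0 := by simpa using ht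
  have hl0 : l ≠ 0 := by positivity
  have htl : ENNReal.ofReal t = 2 * l := by
    rw [ENNReal.ofReal, hl, ← ENNReal.coe_ofNat, ← ENNReal.coe_mul]
    congr 1
    field_simp
  have hms : MeasurableSet {x | t < ‖f x‖₊} := measurableSet_lt measurable_const hfm.nnnorm.coe_nnreal_real
  set f1 := {x | t < ‖f x‖₊}.indicator f with hf1
  set f2 := {x | t < ‖f x‖₊}ᶜ.indicator f with hf2
  have hdec : f = fun x => f1 x + f2 x := by
    funext x
    exact (congrFun (indicator_self_add_compl {x | t < ‖f x‖₊} f) x).symm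
  have hf1B : BallIntegrable m f1 := hf.indicator hms
  have hf2B : BallIntegrable m f2 := hf.indicator hms.compl
  have hf1m : Measurable f1 := hfm.indicator hms
  have hf2m : Measurable f2 := hfm.indicator hms.compl
  have h1 := hC1 f1 hf1m hf1B N l hl0
  have h2 := (mul_meas_ge_le_lintegral (measurable_squareVariation h hs N hf2m hf2B)
    ((l : ℝ≥0∞) ^ 2)).trans (hC2 f2 hf2m hf2B N)
  have e1 : ∫⁻ x, ‖f1 x‖ₑ ∂m = ∫⁻ x in {x | t < ‖f x‖₊}, ‖f x‖₊ ∂m := by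
    rw [← lintegral_indicator hms]
    simp_rw [hf1, enorm_indicator_eq_indicator_enorm]
    rfl
  have e2 : ∫⁻ x, ‖f2 x‖ₑ ^ 2 ∂m = ∫⁻ x in {x | ‖f x‖₊ ≤ t}, (‖f x‖₊ : ℝ≥0∞) ^ 2 ∂m := by
    have : {x | (‖f x‖₊ : ℝ) ≤ t} = {x | t < ‖f x‖₊}ᶜ := by ext x; simp
    rw [this, ← lintegral_indicator hms.compl]
    refine lintegral_congr fun x => ?_
    by_cases hx : x ∈ {x | t < ‖f x‖₊}ᶜ
    · rw [hf2, indicator_of_mem hx, indicator_of_mem hx]; rfl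
    · rw [hf2, indicator_of_notMem hx, indicator_of_notMem hx]; simp
  rw [e1] at h1
  rw [e2] at h2
  have hsub : {x | ENNReal.ofReal t < squareVariation m a δ N f x ^ (1 / 2 : ℝ)} ⊆
      {x | (l : ℝ≥0∞) ^ 2 < squareVariation m a δ N f1 x} ∪
      {x | (l : ℝ≥0∞) ^ 2 ≤ squareVariation m a δ N f2 x} := by
    intro x hx
    by_contra hcon
    rw [mem_union, not_or] at hcon
    have c1 : squareVariation m a δ N f1 x ≤ (l : ℝ≥0∞) ^ 2 := not_lt.1 hcon.1
    have c2 : squareVariation m a δ N f2 x ≤ (l : ℝ≥0∞) ^ 2 := (not_le.1 hcon.2).le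
    refine absurd (show ENNReal.ofReal t < squareVariation m a δ N f x ^ (1 / 2 : ℝ) from hx)
      (not_lt.2 ?_)
    have c3 : squareVariation m a δ N f x ≤ (ENNReal.ofReal t) ^ (2 : ℝ) := by
      calc squareVariation m a δ N f x = squareVariation m a δ N (fun y => f1 y + f2 y) x := by
            rw [← hdec]
        _ ≤ _ := squareVariation_add_le h hs N hf1B hf2B x
        _ ≤ 2 * (l : ℝ≥0∞) ^ 2 + 2 * (l : ℝ≥0∞) ^ 2 := by gcongr
        _ = _ := by rw [htl, ENNReal.rpow_two]; ring
    calc _ ≤ ((ENNReal.ofReal t) ^ (2 : ℝ)) ^ (1 / 2 : ℝ) := by gcongr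
      _ = _ := by rw [← ENNReal.rpow_mul]; norm_num
  have hinv : ∀ {c A B : ℝ≥0∞}, c ≠ 0 → c ≠ ∞ → c * A ≤ B → A ≤ c⁻¹ * B := fun {c A B} h0 ht hAB => by
    calc A = c⁻¹ * (c * A) := by rw [← mul_assoc, ENNReal.inv_mul_cancel h0 ht, one_mul]
      _ ≤ _ := by gcongr
  have hl0' : (l : ℝ≥0∞) ≠ 0 := by exact_mod_cast hl0
  have h1' := hinv hl0' ENNReal.coe_ne_top h1
  have h2' := hinv (pow_ne_zero 2 hl0') (ENNReal.pow_ne_top ENNReal.coe_ne_top) h2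
  have hlt : (l : ℝ≥0∞)⁻¹ = 2 * (ENNReal.ofReal t)⁻¹ := by
    rw [htl, ENNReal.mul_inv (by simp) (by simp), ← mul_assoc,
      ENNReal.mul_inv_cancel (by norm_num) (by norm_num), one_mul]
  refine (measure_mono hsub).trans ((measure_union_le _ _).trans (add_le_add ?_ ?_))
  · refine h1'.trans ?_
    rw [hlt]
    calc _ = (2 * C1 : ℝ≥0) * (ENNReal.ofReal t)⁻¹ * ∫⁻ x in {x | t < ‖f x‖₊}, ‖f x‖₊ ∂m := by
          push_cast; ring
      _ ≤ _ := by
          gcongr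
          exact le_self_add
  · refine h2'.trans ?_
    rw [ENNReal.inv_pow, hlt]
    calc _ = (4 * C2 : ℝ≥0) * ((ENNReal.ofReal t)⁻¹ ^ 2 *
          ∫⁻ x in {x | ‖f x‖₊ ≤ t}, (‖f x‖₊ : ℝ≥0∞) ^ 2 ∂m) := by
          push_cast; ring
      _ ≤ _ := by
          gcongr
          exact le_add_self

end

end

/-! ### Tail sums over the scales and localised `L²` bounds, for `p > 2`. -/

section

/-- Bernoulli's inequality for `c / (b + c) = 1 - b / (b + c)`, that is, convexity of `x ↦ x ^ s`
with the tangent at `b + c`. -/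
lemma ENNReal.add_rpow_le_mul_add {s : ℝ} (hs : 1 ≤ s) (b c : ℝ≥0∞) :
    (b + c) ^ s ≤ ENNReal.ofReal s * (b * (b + c) ^ (s - 1)) + c ^ s := by
  rcases hs.eq_or_lt with rfl | hs1
  · simp
  have hs0 : 0 < s := by linarith
  rcases eq_or_ne c ∞ with rfl | hc
  · simp [hs0]
  rcases eq_or_ne b ∞ with rfl | hb
  · have h1 : ENNReal.ofReal s ≠ 0 := by simpa using hs0
    have h2 : 0 < s - 1 := by linarith
    simp [h2, ENNReal.mul_top h1]
  lift b to ℝ≥0 using hb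
  lift c to ℝ≥0 using hc
  rcases eq_or_ne (b + c) 0 with h0 | h0
  · rw [← ENNReal.coe_add, h0, ENNReal.coe_zero, ENNReal.zero_rpow_of_pos hs0]
    exact zero_le
  have hx : 0 < b + c := pos_iff_ne_zero.2 h0
  have key : (b + c : ℝ) ^ s ≤ s * (b * (b + c : ℝ) ^ (s - 1)) + (c : ℝ) ^ s := by
    have hx' : 0 < (b + c : ℝ) := by exact_mod_cast hx
    have h1 := one_add_mul_self_le_rpow_one_add (s := -(b / (b + c : ℝ))) (by
      rw [neg_le_neg_iff, div_le_one hx']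
      linarith [c.coe_nonneg]) hs
    have h2 : 1 + -(b / (b + c : ℝ)) = c / (b + c) := by field_simp; ring
    rw [h2, Real.div_rpow c.coe_nonneg hx'.le] at h1
    have h3 : 0 < (b + c : ℝ) ^ s := Real.rpow_pos_of_pos hx' s
    rw [le_div_iff₀ h3] at h1
    rw [Real.rpow_sub_one hx'.ne']
    have h4 : (1 + s * -(b / (b + c : ℝ))) * (b + c : ℝ) ^ s =
        (b + c : ℝ) ^ s - s * (b * ((b + c : ℝ) ^ s / (b + c))) := by field_simp; ring
    linarith
  rw [← ENNReal.coe_add, ← ENNReal.coe_rpow_of_nonneg _ hs0.le,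
    ← ENNReal.coe_rpow_of_nonneg _ (by linarith : 0 ≤ s - 1), ← ENNReal.coe_rpow_of_nonneg _ hs0.le,
    ENNReal.ofReal, ← ENNReal.coe_mul, ← ENNReal.coe_mul, ← ENNReal.coe_add, ENNReal.coe_le_coe,
    ← NNReal.coe_le_coe]
  push_cast
  rwa [Real.coe_toNNReal _ hs0.le]

lemma ENNReal.eq_add_sum_tsub {P : ℕ → ℝ≥0∞} (hP : Antitone P) {m N : ℕ} (hmN : m ≤ N) :
    P m = P N + ∑ j ∈ Finset.Ico m N, (P j - P (j + 1)) := by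
  induction N, hmN using Nat.le_induction with
  | base => simp
  | succ N hmN ih =>
    rw [Finset.sum_Ico_succ_top hmN, ih]
    nth_rw 1 [← add_tsub_cancel_of_le (hP (Nat.le_succ N))]
    rw [Nat.succ_eq_add_one]
    ring

/-- Summation by parts. -/
lemma ENNReal.sum_mul_eq_sum_tsub_mul {P : ℕ → ℝ≥0∞} (hP : Antitone P) {N : ℕ} (hN : P N = 0)
    (W : ℕ → ℝ≥0∞) : ∑ i ∈ Finset.range N, P i * W i =
      ∑ j ∈ Finset.range N, (P j - P (j + 1)) * ∑ i ∈ Finset.range (j + 1), W i := by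
  calc _ = ∑ i ∈ Finset.range N, ∑ j ∈ Finset.Ico i N, (P j - P (j + 1)) * W i := by
        refine Finset.sum_congr rfl fun i hi => ?_
        rw [← Finset.sum_mul, ENNReal.eq_add_sum_tsub hP (Finset.mem_range.1 hi).le, hN, zero_add]
    _ = ∑ j ∈ Finset.range N, ∑ i ∈ Finset.range (j + 1), (P j - P (j + 1)) * W i := by
        refine Finset.sum_comm' fun i j => ?_
        simp only [Finset.mem_range, Finset.mem_Ico]
        omega
    _ = _ := by simp_rw [Finset.mul_sum]

/-- A discrete form of the fact that the `s`-th power of an integral is `s` times the integral of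
the integrand against the `(s - 1)`-th power of its tail; obtained by adding one term at a time at
the bottom. -/
lemma ENNReal.sum_Ico_add_rpow_le {s : ℝ} (hs : 1 ≤ s) (W : ℕ → ℝ≥0∞) (N : ℕ) :
    (∑ i ∈ Finset.range N, W i) ^ s ≤ ENNReal.ofReal s *
      ∑ i ∈ Finset.range N, W i * (∑ j ∈ Finset.Ico i N, W j) ^ (s - 1) := by
  have hs0 : 0 < s := by linarith
  have : ∀ k ≤ N, (∑ i ∈ Finset.Ico (N - k) N, W i) ^ s ≤ ENNReal.ofReal s *
      ∑ i ∈ Finset.Ico (N - k) N, W i * (∑ j ∈ Finset.Ico i N, W j) ^ (s - 1) := by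
    intro k hk
    induction k with
    | zero => simp [hs0]
    | succ k ih =>
      have hlt : N - (k + 1) < N := by omega
      have he : N - (k + 1) + 1 = N - k := by omega
      rw [Finset.sum_eq_sum_Ico_succ_bot hlt, Finset.sum_eq_sum_Ico_succ_bot hlt, he]
      refine (ENNReal.add_rpow_le_mul_add hs _ _).trans ?_
      rw [mul_add, Finset.sum_eq_sum_Ico_succ_bot hlt, he]
      exact add_le_add le_rfl (ih (by omega))
  simpa using this N le_rfl

variable {G : Type*} [MetricSpace G] [MeasurableSpace G] [OpensMeasurableSpace G]
variable {a δ : ℝ} {m : Measure G} {r₀ ε K : ℝ}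

lemma qVariation_neg {q : ℝ} {I : Set ℝ} (b : ℝ → ℂ) :
    qVariation q I (fun r => -b r) = qVariation q I b := by
  unfold qVariation
  simp only [neg_sub_neg]
  refine iSup_congr fun J => iSup_congr fun r => iSup_congr fun _ => iSup_congr fun _ => ?_
  congr 1
  exact Finset.sum_congr rfl fun j _ => by rw [enorm_sub_rev]

lemma scaleVariation_le_add (i : ℕ) (f : G → ℂ) (x y : G) :
    scaleVariation m a δ i f y ≤ scaleVariation m a δ i f x +
      qVariation 2 (Ico (a * δ ^ (i + 1)) (a * δ ^ (i + 2)))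
        (fun r => ballAverage m r f x - ballAverage m r f y) := by
  have h1 := qVariation_two_add_le (I := Ico (a * δ ^ (i + 1)) (a * δ ^ (i + 2)))
    (fun r => ballAverage m r f x) (fun r => -(ballAverage m r f x - ballAverage m r f y))
  rw [qVariation_neg] at h1
  simpa [scaleVariation] using h1

lemma squareVariation_congr_on {N : ℕ} {f g : G → ℂ} {x : G}
    (hfg : ∀ i < N, ∀ y ∈ closedBall x (a * δ ^ (i + 2)), f y = g y) :
    squareVariation m a δ N f x = squareVariation m a δ N g x := by
  refine Finset.sum_congr rfl fun i hi => ?_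
  rw [scaleVariation, qVariation_congr fun r hr => ballAverage_congr_on fun y hy =>
    hfg i (Finset.mem_range.1 hi) y (closedBall_subset_closedBall hr.2.le hy)]
  rfl

section

variable (h : CoarseAnnular m r₀ ε K) (hs : GoodScales a δ r₀)
include h hs

/-- Tail sums over the scales from `k` on are almost constant at distance `5 * (a * δ ^ k)`: moving
the centre costs at scale `i` a geometric factor in `i - k` times an average of `‖f‖ ^ 2`. -/
lemma exists_sum_scaleVariation_sq_le : ∃ C : ℝ≥0, ∀ f : G → ℂ, Measurable f →
    BallIntegrable m f → ∀ k N x y, dist x y ≤ 5 * (a * δ ^ k) →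
    ∑ i ∈ Finset.Ico k N, scaleVariation m a δ i f y ^ 2 ≤
      2 * ∑ i ∈ Finset.Ico k N, scaleVariation m a δ i f x ^ 2 +
      C * maximalAverage m (fun i => 3 * (a * δ ^ (i + 2))) N (fun y => ‖f y‖ₑ ^ 2) x := by
  obtain ⟨C, hC⟩ := h.exists_scale_qVariation_sub_sq_le hs
  have hϑ1 := ratio_lt_one h hs
  set ϑ := (δ ^ (-(ε / 2))).toNNReal with hϑ
  have hAt : (1 - (ϑ : ℝ≥0∞))⁻¹ ≠ ∞ :=
    ENNReal.inv_ne_top.2 (tsub_pos_of_lt (by exact_mod_cast hϑ1)).ne'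
  refine ⟨2 * C * ((1 - (ϑ : ℝ≥0∞))⁻¹).toNNReal, fun f hfm hf k N x y hxy => ?_⟩
  push_cast
  rw [ENNReal.coe_toNNReal hAt]
  set M := maximalAverage m (fun i => 3 * (a * δ ^ (i + 2))) N (fun y => ‖f y‖ₑ ^ 2) x with hM
  calc _ ≤ ∑ i ∈ Finset.Ico k N, (2 * scaleVariation m a δ i f x ^ 2 +
        2 * (C * (ϑ : ℝ≥0∞) ^ (i - k) * M)) := by
        refine Finset.sum_le_sum fun i hi => ?_
        rw [Finset.mem_Ico] at hi
        refine (pow_le_pow_left₀ zero_le (scaleVariation_le_add i f x y) 2).trans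
          ((ENNReal.add_sq_le _ _).trans (add_le_add le_rfl (mul_le_mul' le_rfl ?_)))
        refine (hC f hfm hf k i hi.1 x y hxy).trans (mul_le_mul' le_rfl ?_)
        exact ballLAverage_le_maximalAverage (R := fun i => 3 * (a * δ ^ (i + 2))) hi.2 _ x
    _ = 2 * ∑ i ∈ Finset.Ico k N, scaleVariation m a δ i f x ^ 2 +
        2 * C * (∑ i ∈ Finset.Ico k N, (ϑ : ℝ≥0∞) ^ (i - k)) * M := by
        rw [Finset.sum_add_distrib, Finset.mul_sum, Finset.mul_sum, Finset.sum_mul]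
        congr 1
        exact Finset.sum_congr rfl fun i _ => by ring
    _ ≤ _ := by
        gcongr
        rw [Finset.sum_Ico_eq_sum_range, ← ENNReal.tsum_geometric]
        simp only [add_tsub_cancel_left]
        exact ENNReal.sum_le_tsum _

/-- The `L²` bound for the short variation, localised to a cube. -/
lemma CubeSystem.exists_setLIntegral_squareVariation_le [SecondCountableTopology G] [Nonempty G]
    (𝒟 : CubeSystem G a δ) : ∃ C : ℝ≥0, ∀ f : G → ℂ, Measurable f → BallIntegrable m f →
    ∀ j N, j < N → ∀ x, ∫⁻ y in 𝒟.cube j x, squareVariation m a δ (j + 1) f y ∂m ≤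
      C * ∫⁻ y in 𝒟.cube j x,
        maximalAverage m (fun i => 3 * (a * δ ^ (i + 2))) N (fun y => ‖f y‖ₑ ^ 2) y ∂m := by
  obtain ⟨C1, hC1⟩ := exists_lintegral_squareVariation_le h hs
  obtain ⟨C2, -, hC2⟩ := 𝒟.exists_measure_closedBall_le_cube h hs (3 * δ ^ 2)
  have := h.sigmaFinite
  refine ⟨C1 * C2, fun f hfm hf j N hjN x => ?_⟩
  set B := closedBall x (a * δ ^ (j + 2) + 5 / 2 * (a * δ ^ j)) with hB
  set M := maximalAverage m (fun i => 3 * (a * δ ^ (i + 2))) N (fun y => ‖f y‖ₑ ^ 2) with hM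
  set Q := 𝒟.cube j x with hQ
  have hQm := 𝒟.measurableSet_cube j x
  have hBm : MeasurableSet B := measurableSet_closedBall
  have hj := hs.scale_pos j
  have hj1 := hs.scale_succ j
  have hj2 := hs.scale_succ (j + 1)
  have hQ0 := 𝒟.measure_cube_ne_zero h hs j x
  have hQt := 𝒟.measure_cube_ne_top h hs j x
  have h1 : ∫⁻ y in Q, squareVariation m a δ (j + 1) f y ∂m ≤ C1 * ∫⁻ y in B, ‖f y‖ₑ ^ 2 ∂m := by
    calc _ = ∫⁻ y in Q, squareVariation m a δ (j + 1) (B.indicator f) y ∂m := by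
          refine setLIntegral_congr_fun hQm fun y hy => ?_
          refine squareVariation_congr_on fun i hi z hz => (indicator_of_mem ?_ _).symm
          rw [hB, mem_closedBall]
          have e1 := 𝒟.dist_le_of_mem_cube hy
          have e2 := mem_closedBall.1 hz
          have e3 := hs.scale_mono (show i + 2 ≤ j + 2 by omega)
          linarith [dist_triangle z y x]
      _ ≤ ∫⁻ y, squareVariation m a δ (j + 1) (B.indicator f) y ∂m := setLIntegral_le_lintegral _ _
      _ ≤ C1 * ∫⁻ y, ‖B.indicator f y‖ₑ ^ 2 ∂m :=
          hC1 _ (hfm.indicator hBm) (hf.indicator hBm) _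
      _ = _ := by
          rw [← lintegral_indicator hBm]
          congr 1
          refine lintegral_congr fun y => ?_
          by_cases hy : y ∈ B <;> simp [hy]
  have h2 : ∀ y ∈ Q, ∫⁻ z in B, ‖f z‖ₑ ^ 2 ∂m ≤ C2 * m Q * M y := by
    intro y hy
    have hd := 𝒟.dist_le_of_mem_cube hy
    have e1 : B ⊆ closedBall y (3 * (a * δ ^ (j + 2))) := fun z hz => by
      rw [hB, mem_closedBall] at hz
      rw [mem_closedBall]
      have := dist_triangle_right z y x
      linarith
    have e2 : 𝒟.cube j y = Q := 𝒟.cube_eq hy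
    have e3 : m (closedBall y (3 * (a * δ ^ (j + 2)))) ≤ C2 * m Q := by
      rw [← e2]
      refine hC2 j y y _ (le_of_eq ?_)
      rw [dist_self]; ring
    have hr : r₀ ≤ 3 * (a * δ ^ (j + 2)) := by linarith [hs.le_scale (j + 2), hs.r₀_pos]
    calc _ ≤ ∫⁻ z in closedBall y (3 * (a * δ ^ (j + 2))), ‖f z‖ₑ ^ 2 ∂m := lintegral_mono_set e1
      _ = m (closedBall y (3 * (a * δ ^ (j + 2)))) *
          ballLAverage m (3 * (a * δ ^ (j + 2))) (fun z => ‖f z‖ₑ ^ 2) y := by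
          rw [ballLAverage, ← mul_assoc (m _), ENNReal.mul_inv_cancel (h.pos' y hr) (h.lt_top _ _).ne,
            one_mul]
      _ ≤ _ := mul_le_mul' e3 (ballLAverage_le_maximalAverage
          (R := fun i => 3 * (a * δ ^ (i + 2))) hjN _ y)
  have h3 : m Q * ∫⁻ z in B, ‖f z‖ₑ ^ 2 ∂m ≤ m Q * (C2 * ∫⁻ y in Q, M y ∂m) := by
    have hMm : Measurable M := measurable_maximalAverage (hfm.enorm.pow_const 2)
    calc _ = ∫⁻ y in Q, (∫⁻ z in B, ‖f z‖ₑ ^ 2 ∂m) ∂m := by rw [setLIntegral_const, mul_comm]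
      _ ≤ ∫⁻ y in Q, C2 * m Q * M y ∂m := setLIntegral_mono' hQm h2
      _ = _ := by
          rw [lintegral_const_mul _ hMm]; ring
  rw [ENNReal.mul_le_mul_iff_right hQ0 hQt] at h3
  calc _ ≤ _ := h1
    _ ≤ C1 * (C2 * ∫⁻ y in Q, M y ∂m) := by gcongr
    _ = _ := by push_cast; ring

end

end

/-! ### Strong type for `p > 2` by summation by parts and absorption. -/

section

lemma ENNReal.rpow_sub_one_mul {s : ℝ} (hs : 1 ≤ s) (x : ℝ≥0∞) : x ^ (s - 1) * x = x ^ s := by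
  nth_rw 2 [← ENNReal.rpow_one x]
  rw [← ENNReal.rpow_add_of_nonneg _ _ (by linarith) (by norm_num), sub_add_cancel]

lemma ENNReal.rpow_mul_le_add {s : ℝ} (hs : 1 ≤ s) {c l : ℝ≥0∞} (hl : 1 ≤ l) (hlt : l ≠ ∞)
    (F M : ℝ≥0∞) : (2 * F + c * M) ^ (s - 1) * M ≤
      (2 * l + c) ^ (s - 1) * M ^ s + l⁻¹ * ((2 + c) ^ (s - 1) * F ^ s) := by
  have hs' : 0 ≤ s - 1 := by linarith
  have hl0 : l ≠ 0 := (zero_lt_one.trans_le hl).ne'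
  rcases le_total F (l * M) with hF | hF
  · refine le_trans ?_ le_self_add
    calc _ ≤ ((2 * l + c) * M) ^ (s - 1) * M := by
          gcongr
          calc _ ≤ 2 * (l * M) + c * M := by gcongr
            _ = _ := by ring
      _ = _ := by
          rw [ENNReal.mul_rpow_of_nonneg _ _ hs', mul_assoc, ENNReal.rpow_sub_one_mul hs]
  · refine le_trans ?_ le_add_self
    have hM : M ≤ l⁻¹ * F := by
      calc M = l⁻¹ * (l * M) := by rw [← mul_assoc, ENNReal.inv_mul_cancel hl0 hlt, one_mul]
        _ ≤ _ := by gcongr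
    have hM' : M ≤ F := hM.trans (mul_le_of_le_one_left' (ENNReal.inv_le_one.2 hl))
    calc _ ≤ ((2 + c) * F) ^ (s - 1) * (l⁻¹ * F) := by
          gcongr
          calc _ ≤ 2 * F + c * F := by gcongr
            _ = _ := by ring
      _ = l⁻¹ * ((2 + c) ^ (s - 1) * (F ^ (s - 1) * F)) := by
          rw [ENNReal.mul_rpow_of_nonneg _ _ hs']; ring
      _ = _ := by rw [ENNReal.rpow_sub_one_mul hs]

lemma ENNReal.le_two_mul_of_le_add_half {A X : ℝ≥0∞} (hA : A ≠ ∞) (h : A ≤ X + 2⁻¹ * A) :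
    A ≤ 2 * X := by
  have h1 : 2⁻¹ * A + 2⁻¹ * A = A := by
    rw [← add_mul, ENNReal.inv_two_add_inv_two, one_mul]
  have h2 : 2⁻¹ * A ≠ ∞ := ENNReal.mul_ne_top (by norm_num) hA
  nth_rw 1 [← h1] at h
  have h3 : 2⁻¹ * A ≤ X := (ENNReal.add_le_add_iff_right h2).1 h
  calc A = 2 * (2⁻¹ * A) := by
        rw [← mul_assoc, ENNReal.mul_inv_cancel (by norm_num) (by norm_num), one_mul]
    _ ≤ _ := by gcongr

variable {G : Type*} [MetricSpace G] [MeasurableSpace G] [OpensMeasurableSpace G]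
variable {a δ : ℝ} {m : Measure G} {r₀ ε K : ℝ}

section

variable (h : CoarseAnnular m r₀ ε K) (hs : GoodScales a δ r₀)
include h hs

/-- Qualitative finiteness, with a bound that depends on `N`; it only licenses the absorption
argument. -/
lemma lintegral_squareVariation_rpow_ne_top [SecondCountableTopology G] {s : ℝ} (hs1 : 1 < s)
    {f : G → ℂ} (hfm : Measurable f) (hf : BallIntegrable m f) (N : ℕ)
    (hfin : ∫⁻ x, (‖f x‖ₑ ^ 2) ^ s ∂m ≠ ∞) : ∫⁻ x, squareVariation m a δ N f x ^ s ∂m ≠ ∞ := by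
  obtain ⟨C1, hC1⟩ := exists_scaleVariation_sq_le h hs
  obtain ⟨C2, hC2⟩ := h.exists_lintegral_maximalAverage_rpow_le hs1
  set M := maximalAverage m (fun i => a * δ ^ (i + 2)) N (fun y => ‖f y‖ₑ ^ 2) with hM
  have h2 : ∫⁻ x, M x ^ s ∂m ≤ C2 * ∫⁻ x, (‖f x‖ₑ ^ 2) ^ s ∂m := by
    have := hC2 (fun i => a * δ ^ (i + 2)) (fun i => by linarith [hs.le_scale (i + 2), hs.r₀_pos])
      N (fun y => ‖f y‖₊ ^ 2) (hfm.nnnorm.pow_const 2)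
    simp only [ENNReal.coe_pow] at this
    exact this
  have hpt : ∀ x, squareVariation m a δ N f x ≤ N * C1 * M x := fun x => by
    calc _ ≤ ∑ i ∈ Finset.range N, C1 * M x := by
          refine Finset.sum_le_sum fun i hi => (hC1 f hfm hf i x).trans (mul_le_mul' le_rfl ?_)
          exact ballLAverage_le_maximalAverage (R := fun i => a * δ ^ (i + 2))
            (Finset.mem_range.1 hi) _ x
      _ = _ := by simp [mul_assoc]
  have hs0 : 0 ≤ s := by linarith
  refine ne_top_of_le_ne_top ?_ (lintegral_mono fun x => ENNReal.rpow_le_rpow (hpt x) hs0)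
  simp_rw [ENNReal.mul_rpow_of_nonneg _ _ hs0]
  have hc : (N : ℝ≥0∞) ^ s * (C1 : ℝ≥0∞) ^ s ≠ ∞ := ENNReal.mul_ne_top
    (ENNReal.rpow_ne_top_of_nonneg hs0 (by simp)) (ENNReal.rpow_ne_top_of_nonneg hs0 (by simp))
  rw [lintegral_const_mul' _ _ hc]
  exact ENNReal.mul_ne_top hc (ne_top_of_le_ne_top (ENNReal.mul_ne_top ENNReal.coe_ne_top hfin) h2)

/-- The tail powers are replaced by majorants constant on cubes and decreasing in the generation.
Summation by parts then exhibits, for each `j`, a weight constant on cubes of generation `j` against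
the square variation up to scale `j`, to which the localised `L²` bound applies. Undoing the
summation leaves the maximal function times the first majorant. -/
lemma exists_lintegral_squareVariation_rpow_le_maximal [SecondCountableTopology G] [Nonempty G] :
    ∃ C : ℝ≥0, ∀ s : ℝ, 1 < s → ∀ f : G → ℂ, Measurable f → BallIntegrable m f → ∀ N,
      ∫⁻ x, squareVariation m a δ N f x ^ s ∂m ≤ ENNReal.ofReal s * (C *
        ∫⁻ x, (2 * squareVariation m a δ N f x + C *
          maximalAverage m (fun i => 3 * (a * δ ^ (i + 2))) N (fun y => ‖f y‖ₑ ^ 2) x) ^ (s - 1) *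
          maximalAverage m (fun i => 3 * (a * δ ^ (i + 2))) N (fun y => ‖f y‖ₑ ^ 2) x ∂m) := by
  obtain ⟨𝒟⟩ := exists_cubeSystem (G := G) hs.a_pos hs.le_δ
  obtain ⟨C1, hC1⟩ := exists_sum_scaleVariation_sq_le h hs
  obtain ⟨C2, hC2⟩ := 𝒟.exists_setLIntegral_squareVariation_le h hs
  have := h.sigmaFinite
  refine ⟨C1 + C2, fun s hs1 f hfm hf N => ?_⟩
  have hs0 : 0 ≤ s - 1 := by linarith
  set M := maximalAverage m (fun i => 3 * (a * δ ^ (i + 2))) N (fun y => ‖f y‖ₑ ^ 2) with hM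
  have hMm : Measurable M := measurable_maximalAverage (hfm.enorm.pow_const 2)
  set T : ℕ → G → ℝ≥0∞ := fun k x => ∑ i ∈ Finset.Ico k N, scaleVariation m a δ i f x ^ 2 with hT
  -- The supremum over the cube makes `H k` constant on cubes of generation `k`, hence measurable;
  -- the supremum over all `j ≥ k` makes it decreasing in `k`, which the summation by parts needs.
  set H : ℕ → G → ℝ≥0∞ := fun k x => ⨆ j ≥ k, ⨆ y ∈ 𝒟.cube j x, T j y with hH
  have hHc : ∀ k, 𝒟.IsConst k (H k) := fun k x y hxy => by
    simp only [hH]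
    refine iSup_congr fun j => iSup_congr fun hj => ?_
    rw [𝒟.cube_eq (𝒟.eq_of_le hj hxy)]
  have hHa : ∀ x, Antitone fun k => H k x := fun x k l hkl =>
    biSup_mono fun j hj => le_trans hkl hj
  have hTH : ∀ k x, T k x ≤ H k x := fun k x =>
    le_iSup₂_of_le k le_rfl (le_iSup₂_of_le x (𝒟.mem_cube_self k x) le_rfl)
  have hHN : ∀ x, H N x = 0 := fun x => by
    simp only [hH, hT]
    refine le_antisymm (iSup₂_le fun j hj => iSup₂_le fun y _ => ?_) zero_le
    rw [Finset.Ico_eq_empty_of_le hj, Finset.sum_empty]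
  have hH0 : ∀ x, H 0 x ≤ 2 * squareVariation m a δ N f x + C1 * M x := fun x => by
    refine iSup₂_le fun j _ => iSup₂_le fun y hy => ?_
    refine (hC1 f hfm hf j N x y ?_).trans (add_le_add (mul_le_mul' le_rfl ?_) le_rfl)
    · rw [dist_comm]
      linarith [𝒟.dist_le_of_mem_cube hy, hs.scale_pos j]
    · exact Finset.sum_le_sum_of_subset fun i hi => by simpa using (Finset.mem_Ico.1 hi).2
  set P : ℕ → G → ℝ≥0∞ := fun k x => H k x ^ (s - 1) with hP
  have hPc : ∀ k, 𝒟.IsConst k (P k) := fun k x y hxy => by simp only [hP, hHc k x y hxy]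
  have hPa : ∀ x, Antitone fun k => P k x := fun x k l hkl => ENNReal.rpow_le_rpow (hHa x hkl) hs0
  have hPN : ∀ x, P N x = 0 := fun x => by
    simp only [hP, hHN]
    exact ENNReal.zero_rpow_of_pos (by linarith)
  have hwc : ∀ j, 𝒟.IsConst j fun x => P j x - P (j + 1) x := fun j x y hxy => by
    simp only [hPc j x y hxy, (hPc (j + 1)).of_le (Nat.le_succ j) x y hxy]
  have hwm : ∀ j, Measurable fun x => P j x - P (j + 1) x := fun j => (hwc j).measurable
  have hpt : ∀ x, squareVariation m a δ N f x ^ s ≤ ENNReal.ofReal s *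
      ∑ j ∈ Finset.range N, (P j x - P (j + 1) x) * squareVariation m a δ (j + 1) f x := fun x => by
    refine (ENNReal.sum_Ico_add_rpow_le hs1.le _ N).trans (mul_le_mul' le_rfl ?_)
    simp only [squareVariation]
    rw [← ENNReal.sum_mul_eq_sum_tsub_mul (hPa x) (hPN x)]
    refine Finset.sum_le_sum fun i _ => ?_
    rw [mul_comm]
    exact mul_le_mul' (ENNReal.rpow_le_rpow (hTH i x) hs0) le_rfl
  have hSm : ∀ j, Measurable (squareVariation m a δ j f) := fun j =>
    measurable_squareVariation h hs j hfm hf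
  have hm1 : ∀ j, Measurable fun x =>
      (P j x - P (j + 1) x) * squareVariation m a δ (j + 1) f x := fun j => (hwm j).mul (hSm _)
  have hm2 : ∀ j, Measurable fun x => (P j x - P (j + 1) x) * (C2 * M x) := fun j =>
    (hwm j).mul (hMm.const_mul _)
  calc _ ≤ ∫⁻ x, ENNReal.ofReal s *
        ∑ j ∈ Finset.range N, (P j x - P (j + 1) x) * squareVariation m a δ (j + 1) f x ∂m :=
        lintegral_mono hpt
    _ = ENNReal.ofReal s * ∑ j ∈ Finset.range N,
          ∫⁻ x, (P j x - P (j + 1) x) * squareVariation m a δ (j + 1) f x ∂m := by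
        rw [lintegral_const_mul' _ _ ENNReal.ofReal_ne_top,
          lintegral_finsetSum _ fun j _ => hm1 j]
    _ ≤ ENNReal.ofReal s * ∑ j ∈ Finset.range N,
          ∫⁻ x, (P j x - P (j + 1) x) * (C2 * M x) ∂m := by
        refine mul_le_mul' le_rfl (Finset.sum_le_sum fun j hj => ?_)
        refine 𝒟.lintegral_mul_le_of_cube_le (hSm _) (hMm.const_mul _) (hwc j) fun x => ?_
        rw [lintegral_const_mul _ hMm]
        exact hC2 f hfm hf j N (Finset.mem_range.1 hj) x
    _ = ENNReal.ofReal s * (C2 * ∫⁻ x, P 0 x * M x ∂m) := by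
        rw [← lintegral_finsetSum _ fun j _ => hm2 j,
          ← lintegral_const_mul' _ _ ENNReal.coe_ne_top]
        congr 1
        refine lintegral_congr fun x => ?_
        rw [← Finset.sum_mul, ENNReal.eq_add_sum_tsub (hPa x) (Nat.zero_le N), hPN, zero_add,
          Finset.range_eq_Ico]
        ring
    _ ≤ _ := by
        refine mul_le_mul' le_rfl (mul_le_mul' (by push_cast; exact le_add_self)
          (lintegral_mono fun x => mul_le_mul' ?_ le_rfl))
        refine ENNReal.rpow_le_rpow ((hH0 x).trans (add_le_add le_rfl (mul_le_mul' ?_ le_rfl))) hs0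
        push_cast
        exact le_self_add

/-- The strong type bound for the short variation for `p > 2`. -/
theorem exists_lintegral_squareVariation_rpow_le_of_two_lt [SecondCountableTopology G] [Nonempty G]
    {p : ℝ} (hp : 2 < p) : ∃ C : ℝ≥0, ∀ f : G → ℂ, Measurable f →
      BallIntegrable m f → ∀ N, ∫⁻ x, squareVariation m a δ N f x ^ (p / 2) ∂m ≤
        C * ∫⁻ x, ‖f x‖ₑ ^ p ∂m := by
  obtain ⟨C, hC⟩ := exists_lintegral_squareVariation_rpow_le_maximal h hs
  set s := p / 2 with hsp
  have hs1 : 1 < s := by rw [hsp]; linarith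
  have hs0 : 0 ≤ s - 1 := by linarith
  obtain ⟨C2, hC2⟩ := h.exists_lintegral_maximalAverage_rpow_le hs1
  have := h.sigmaFinite
  set S := ENNReal.ofReal s with hS
  set A : ℝ≥0∞ := (2 + C) ^ (s - 1) with hA
  have hAt : A ≠ ∞ := ENNReal.rpow_ne_top_of_nonneg hs0 (by simp)
  -- Large enough that the coefficient `S * C * (l⁻¹ * A)` of the term to be absorbed is at most `1
  -- / 2`; the summand `1` ensures `l ≥ 1`.
  set l : ℝ≥0∞ := 2 * S * C * A + 1 with hl
  have hlt : l ≠ ∞ := by simp [hl, ENNReal.mul_eq_top, hAt, hS]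
  have hl1 : 1 ≤ l := le_add_self
  set D : ℝ≥0∞ := 2 * (S * C * (2 * l + C) ^ (s - 1) * C2) + 1 with hD
  have hDt : D ≠ ∞ := by
    have : (2 * l + C) ^ (s - 1) ≠ ∞ :=
      ENNReal.rpow_ne_top_of_nonneg hs0 (by simp [ENNReal.mul_eq_top, hlt])
    simp [hD, ENNReal.mul_eq_top, this, hS]
  refine ⟨D.toNNReal, fun f hfm hf N => ?_⟩
  rw [ENNReal.coe_toNNReal hDt]
  have hpow : ∀ x, (‖f x‖ₑ ^ 2) ^ s = ‖f x‖ₑ ^ p := fun x => by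
    rw [← ENNReal.rpow_two, ← ENNReal.rpow_mul]
    congr 1; rw [hsp]; ring
  rcases eq_or_ne (∫⁻ x, ‖f x‖ₑ ^ p ∂m) ∞ with hfin | hfin
  · rw [hfin, ENNReal.mul_top (by rw [hD]; simp)]
    exact le_top
  have hFt := lintegral_squareVariation_rpow_ne_top h hs hs1 hfm hf N (by simpa only [hpow])
  set M := maximalAverage m (fun i => 3 * (a * δ ^ (i + 2))) N (fun y => ‖f y‖ₑ ^ 2) with hM
  have hMm : Measurable M := measurable_maximalAverage (hfm.enorm.pow_const 2)
  have h2 : ∫⁻ x, M x ^ s ∂m ≤ C2 * ∫⁻ x, ‖f x‖ₑ ^ p ∂m := by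
    have := hC2 (fun i => 3 * (a * δ ^ (i + 2)))
      (fun i => by linarith [hs.le_scale (i + 2), hs.r₀_pos])
      N (fun y => ‖f y‖₊ ^ 2) (hfm.nnnorm.pow_const 2)
    simp_rw [← hpow]
    simp only [ENNReal.coe_pow] at this
    exact this
  have key : ∫⁻ x, squareVariation m a δ N f x ^ s ∂m ≤
      S * C * (2 * l + C) ^ (s - 1) * (C2 * ∫⁻ x, ‖f x‖ₑ ^ p ∂m) +
      2⁻¹ * ∫⁻ x, squareVariation m a δ N f x ^ s ∂m := by
    have hlA : S * C * (l⁻¹ * A) ≤ 2⁻¹ := by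
      have h0 : l ≠ 0 := (zero_lt_one.trans_le hl1).ne'
      calc S * C * (l⁻¹ * A) = 2⁻¹ * 2 * (S * C * (l⁻¹ * A)) := by
            rw [ENNReal.inv_mul_cancel (by norm_num) (by norm_num), one_mul]
        _ = 2⁻¹ * (2 * S * C * A * l⁻¹) := by ring
        _ ≤ 2⁻¹ * (l * l⁻¹) := by
            gcongr
            exact le_self_add
        _ = _ := by rw [ENNReal.mul_inv_cancel h0 hlt, mul_one]
    calc _ ≤ _ := hC s hs1 f hfm hf N
      _ ≤ S * (C * ∫⁻ x, ((2 * l + C) ^ (s - 1) * M x ^ s +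
            l⁻¹ * (A * squareVariation m a δ N f x ^ s)) ∂m) := by
          gcongr with x
          exact ENNReal.rpow_mul_le_add hs1.le hl1 hlt _ _
      _ = S * C * (2 * l + C) ^ (s - 1) * ∫⁻ x, M x ^ s ∂m +
            S * C * (l⁻¹ * A) * ∫⁻ x, squareVariation m a δ N f x ^ s ∂m := by
          have hFm := (measurable_squareVariation h hs N hfm hf).pow_const s
          rw [lintegral_add_left ((hMm.pow_const s).const_mul _),
            lintegral_const_mul _ (hMm.pow_const s), lintegral_const_mul _ (hFm.const_mul _),
            lintegral_const_mul _ hFm]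
          ring
      _ ≤ _ := add_le_add (mul_le_mul' le_rfl h2) (mul_le_mul' hlA le_rfl)
  refine (ENNReal.le_two_mul_of_le_add_half hFt key).trans ?_
  calc _ = 2 * (S * C * (2 * l + C) ^ (s - 1) * C2) * ∫⁻ x, ‖f x‖ₑ ^ p ∂m := by ring
    _ ≤ _ := by
        gcongr
        exact le_self_add

/-- The strong type bound for the short variation. -/
theorem exists_lintegral_squareVariation_rpow_le [SecondCountableTopology G] [Nonempty G]
    {p : ℝ} (hp : 1 < p) : ∃ C : ℝ≥0, ∀ f : G → ℂ, Measurable f →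
      BallIntegrable m f → ∀ N, ∫⁻ x, squareVariation m a δ N f x ^ (p / 2) ∂m ≤
        C * ∫⁻ x, ‖f x‖ₑ ^ p ∂m := by
  rcases lt_trichotomy p 2 with hp2 | rfl | hp2
  · exact exists_lintegral_squareVariation_rpow_le_of_lt_two h hs hp hp2
  · simpa using exists_lintegral_squareVariation_le h hs
  · exact exists_lintegral_squareVariation_rpow_le_of_two_lt h hs hp2

end

end

section

/-! ### Bounded ranges of radii -/

/-- The right side is the integral of the decreasing function `x ^ (-q)` over `[s, t]`; the proof
uses `x + 1 ≤ exp x` and `log x ≤ x - 1`. -/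
lemma Real.sub_mul_rpow_neg_le {q : ℝ} (hq : 1 < q) {s t : ℝ} (hs : 0 < s) (hst : s ≤ t) :
    (t - s) * t ^ (-q) ≤ (q - 1)⁻¹ * (s ^ (1 - q) - t ^ (1 - q)) := by
  have ht : 0 < t := hs.trans_le hst
  have hq0 : 0 < q - 1 := by linarith
  have h1 : 1 + (q - 1) * (1 - s / t) ≤ (s / t) ^ (1 - q) := by
    have hd : 0 < s / t := div_pos hs ht
    rw [Real.rpow_def_of_pos hd]
    have e1 := Real.add_one_le_exp (Real.log (s / t) * (1 - q))
    have e2 := Real.log_le_sub_one_of_pos hd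
    nlinarith
  have h2 : (s / t) ^ (1 - q) * t ^ (1 - q) = s ^ (1 - q) := by
    rw [Real.div_rpow hs.le ht.le, div_mul_cancel₀]
    exact (Real.rpow_pos_of_pos ht _).ne'
  have h3 : t ^ (-q) = t ^ (1 - q) / t := by
    rw [show -q = 1 - q - 1 by ring, Real.rpow_sub_one ht.ne']
  have h4 := mul_le_mul_of_nonneg_right h1 (Real.rpow_pos_of_pos ht (1 - q)).le
  rw [h2] at h4
  rw [h3, ← sub_nonneg]
  have h5 : (q - 1)⁻¹ * (s ^ (1 - q) - t ^ (1 - q)) - (t - s) * (t ^ (1 - q) / t) =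
      (q - 1)⁻¹ * (s ^ (1 - q) - (1 + (q - 1) * (1 - s / t)) * t ^ (1 - q)) := by
    field_simp
    ring
  rw [h5]
  exact mul_nonneg (by positivity) (by linarith)

lemma ENNReal.sum_sub_mul_rpow_neg_le {q : ℝ} (hq : 1 < q) {M : ℕ → ℝ} (hM : Monotone M)
    (h0 : 0 < M 0) (J : ℕ) :
    ∑ j ∈ Finset.range J, ENNReal.ofReal (M (j + 1) - M j) * ENNReal.ofReal (M (j + 1)) ^ (-q) ≤
      ENNReal.ofReal (q - 1)⁻¹ * ENNReal.ofReal (M 0) ^ (1 - q) := by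
  have hpos : ∀ j, 0 < M j := fun j => h0.trans_le (hM (Nat.zero_le j))
  have hq0 : 0 < q - 1 := by linarith
  calc _ = ∑ j ∈ Finset.range J, ENNReal.ofReal ((M (j + 1) - M j) * M (j + 1) ^ (-q)) := by
        refine Finset.sum_congr rfl fun j _ => ?_
        rw [ENNReal.ofReal_mul (sub_nonneg.2 (hM (Nat.le_succ j))),
          ENNReal.ofReal_rpow_of_pos (hpos _)]
    _ = ENNReal.ofReal (∑ j ∈ Finset.range J, (M (j + 1) - M j) * M (j + 1) ^ (-q)) := by
        refine (ENNReal.ofReal_sum_of_nonneg fun j _ => ?_).symm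
        exact mul_nonneg (sub_nonneg.2 (hM (Nat.le_succ j))) (Real.rpow_pos_of_pos (hpos _) _).le
    _ ≤ ENNReal.ofReal ((q - 1)⁻¹ * M 0 ^ (1 - q)) := by
        refine ENNReal.ofReal_le_ofReal ?_
        calc _ ≤ ∑ j ∈ Finset.range J, (q - 1)⁻¹ * (M j ^ (1 - q) - M (j + 1) ^ (1 - q)) :=
              Finset.sum_le_sum fun j _ =>
                Real.sub_mul_rpow_neg_le hq (hpos j) (hM (Nat.le_succ j))
          _ = (q - 1)⁻¹ * (M 0 ^ (1 - q) - M J ^ (1 - q)) := by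
              rw [← Finset.mul_sum, Finset.sum_range_sub']
          _ ≤ _ := by
              have := Real.rpow_pos_of_pos (hpos J) (1 - q)
              gcongr
              linarith
    _ = _ := by
        rw [ENNReal.ofReal_mul (by positivity), ENNReal.ofReal_rpow_of_pos h0]

variable {G : Type*} [MetricSpace G] [MeasurableSpace G] [OpensMeasurableSpace G]
variable {m : Measure G}

lemma ofReal_setIntegral_norm_div {f : G → ℂ} {S B : Set G} (hf : IntegrableOn f S m)
    (hB : 0 < m.real B) : ENNReal.ofReal ((∫ y in S, ‖f y‖ ∂m) / m.real B) =
      (m B)⁻¹ * ∫⁻ y in S, ‖f y‖ₑ ∂m := by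
  have hBt : m B ≠ ∞ := fun h => by simp [Measure.real, h] at hB
  rw [div_eq_inv_mul, ENNReal.ofReal_mul (by positivity), ENNReal.ofReal_inv_of_pos hB,
    ofReal_integral_norm_eq_lintegral_enorm hf, Measure.real, ENNReal.ofReal_toReal hBt]

lemma sum_enorm_ballAverage_sub_le' (hm : ∀ x r, m (closedBall x r) < ∞)
    {f : G → ℂ} (hf : BallIntegrable m f) {x : G} {J : ℕ} {r : ℕ → ℝ} (hr : Monotone r)
    (h0 : 0 < m.real (closedBall x (r 0))) :
    ∑ j ∈ Finset.range J, ‖ballAverage m (r (j + 1)) f x - ballAverage m (r j) f x‖ₑ ≤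
      2 * (∑ j ∈ Finset.range J, (m (closedBall x (r (j + 1))))⁻¹ *
        ∫⁻ y in closedBall x (r (j + 1)) \ closedBall x (r j), ‖f y‖ₑ ∂m) +
        (m (closedBall x (r 0)))⁻¹ * ∫⁻ y in closedBall x (r 0), ‖f y‖ₑ ∂m := by
  have hpos : ∀ j, 0 < m.real (closedBall x (r j)) := fun j => h0.trans_le
    (measureReal_mono (closedBall_subset_closedBall (hr (Nat.zero_le j))) (hm _ _).ne)
  have hnn : ∀ (S : Set G) j, 0 ≤ (∫ y in S, ‖f y‖ ∂m) / m.real (closedBall x (r j)) :=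
    fun S j => div_nonneg (integral_nonneg fun y => norm_nonneg _) (hpos j).le
  calc _ = ENNReal.ofReal (∑ j ∈ Finset.range J,
          ‖ballAverage m (r (j + 1)) f x - ballAverage m (r j) f x‖) := by
        rw [ENNReal.ofReal_sum_of_nonneg fun _ _ => norm_nonneg _]
        simp [ofReal_norm]
    _ ≤ _ := ENNReal.ofReal_le_ofReal (sum_enorm_ballAverage_sub_le hm hf hr h0)
    _ = _ := by
        rw [ENNReal.ofReal_add (mul_nonneg zero_le_two (Finset.sum_nonneg fun j _ => hnn _ _))
          (hnn _ _), ENNReal.ofReal_mul zero_le_two,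
          ENNReal.ofReal_sum_of_nonneg fun j _ => hnn _ _,
          ofReal_setIntegral_norm_div (hf x _) h0, ENNReal.ofReal_ofNat]
        congr 2
        refine congrArg _ (funext fun j => ?_)
        exact ofReal_setIntegral_norm_div
          ((hf x (r (j + 1))).mono_set sdiff_subset) (hpos (j + 1))

/-- Hölder on each shell and then over the shells. Keeping the individual denominators makes the
dual sum at most a multiple of `m (B 0) ^ (1 - q)`. As `(1 - q) * (p / q) = -1`, only one inverse
mass remains, with no ratio of masses of large to small balls, which is not controlled below `r₀`.
-/
lemma sum_shell_rpow_le (hm : ∀ x r, m (closedBall x r) < ∞) {p q : ℝ}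
    (hpq : p.HolderConjugate q) {u : G → ℝ≥0∞} (hu : Measurable u) {x : G} {J : ℕ} {r : ℕ → ℝ}
    (hr : Monotone r) (h0 : 0 < m.real (closedBall x (r 0))) :
    (∑ j ∈ Finset.range J, (m (closedBall x (r (j + 1))))⁻¹ *
      ∫⁻ y in closedBall x (r (j + 1)) \ closedBall x (r j), u y ∂m) ^ p ≤
      ENNReal.ofReal (q - 1)⁻¹ ^ (p / q) * ((m (closedBall x (r 0)))⁻¹ *
        ∫⁻ y in closedBall x (r J), u y ^ p ∂m) := by
  have hp0 := hpq.pos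
  have hq0 := hpq.symm.pos
  have hq1 := hpq.symm.lt
  set B : ℕ → Set G := fun j => closedBall x (r j) with hB
  set S : ℕ → Set G := fun j => B (j + 1) \ B j with hS
  have hBm : ∀ j, MeasurableSet (B j) := fun j => measurableSet_closedBall
  have hSm : ∀ j, MeasurableSet (S j) := fun j => (hBm _).diff (hBm _)
  have hBmono : Monotone B := fun i j hij => closedBall_subset_closedBall (hr hij)
  have hBt : ∀ j, m (B j) ≠ ∞ := fun j => (hm x _).ne
  have hB0 : ∀ j, m (B j) ≠ 0 := fun j hj => by
    have : m (B 0) = 0 := measure_mono_null (hBmono (Nat.zero_le j)) hj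
    exact h0.ne' (by rw [Measure.real, show m (closedBall x (r 0)) = 0 from this]; simp)
  set Φ : ℕ → ℝ≥0∞ := fun j => ∫⁻ y in S j, u y ^ p ∂m with hΦ
  have hj : ∀ j, (m (B (j + 1)))⁻¹ * ∫⁻ y in S j, u y ∂m ≤
      Φ j ^ (1 / p) * ((m (B (j + 1)))⁻¹ * m (S j) ^ (1 / q)) := fun j => by
    have := ENNReal.lintegral_mul_le_Lp_mul_Lq (m.restrict (S j)) hpq hu.aemeasurable
      (aemeasurable_const (b := (1 : ℝ≥0∞)))
    simp only [Pi.mul_apply, mul_one, ENNReal.one_rpow, lintegral_const, one_mul,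
      Measure.restrict_apply_univ] at this
    calc _ ≤ (m (B (j + 1)))⁻¹ * (Φ j ^ (1 / p) * m (S j) ^ (1 / q)) := by gcongr
      _ = _ := by ring
  have hΦsum : ∑ j ∈ Finset.range J, Φ j ≤ ∫⁻ y in B J, u y ^ p ∂m := by
    have hd : Pairwise (Function.onFun Disjoint S) := by
      intro i j hij
      wlog hlt : i < j generalizing i j
      · exact (this hij.symm (by omega)).symm
      refine Set.disjoint_left.2 fun y hy hy' => hy'.2 ?_
      exact hBmono hlt hy.1
    rw [← lintegral_biUnion_finset (fun i _ j _ hij => hd hij) fun j _ => hSm j]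
    refine lintegral_mono_set (iUnion₂_subset fun j hj => sdiff_subset.trans (hBmono ?_))
    exact Finset.mem_range.1 hj
  have hg : ∑ j ∈ Finset.range J, ((m (B (j + 1)))⁻¹ * m (S j) ^ (1 / q)) ^ q ≤
      ENNReal.ofReal (q - 1)⁻¹ * m (B 0) ^ (1 - q) := by
    have hofReal : ∀ j, ENNReal.ofReal (m.real (B j)) = m (B j) := fun j =>
      ENNReal.ofReal_toReal (hBt j)
    have := ENNReal.sum_sub_mul_rpow_neg_le hq1 (M := fun j => m.real (B j))
      (fun i j hij => measureReal_mono (hBmono hij) (hBt j)) h0 J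
    simp only [hofReal] at this
    refine le_trans (le_of_eq (Finset.sum_congr rfl fun j _ => ?_)) this
    rw [ENNReal.mul_rpow_of_nonneg _ _ hq0.le, ← ENNReal.rpow_mul, one_div_mul_cancel hq0.ne',
      ENNReal.rpow_one, ENNReal.inv_rpow, ENNReal.rpow_neg, mul_comm]
    congr 1
    rw [ENNReal.ofReal_sub _ measureReal_nonneg, hofReal, hofReal,
      measure_sdiff (hBmono (Nat.le_succ j)) (hBm j).nullMeasurableSet (hBt j)]
  have hH := ENNReal.inner_le_Lp_mul_Lq (Finset.range J) (fun j => Φ j ^ (1 / p))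
    (fun j => (m (B (j + 1)))⁻¹ * m (S j) ^ (1 / q)) hpq
  have hΦp : ∀ j, (Φ j ^ (1 / p)) ^ p = Φ j := fun j => by
    rw [← ENNReal.rpow_mul, one_div_mul_cancel hp0.ne', ENNReal.rpow_one]
  simp only [hΦp] at hH
  calc _ ≤ ((∑ j ∈ Finset.range J, Φ j) ^ (1 / p) *
        (∑ j ∈ Finset.range J, ((m (B (j + 1)))⁻¹ * m (S j) ^ (1 / q)) ^ q) ^ (1 / q)) ^ p := by
        refine ENNReal.rpow_le_rpow (le_trans (Finset.sum_le_sum fun j _ => hj j) hH) hp0.le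
    _ ≤ ((∫⁻ y in B J, u y ^ p ∂m) ^ (1 / p) *
        (ENNReal.ofReal (q - 1)⁻¹ * m (B 0) ^ (1 - q)) ^ (1 / q)) ^ p := by
        gcongr
    _ = (∫⁻ y in B J, u y ^ p ∂m) *
        (ENNReal.ofReal (q - 1)⁻¹ ^ (p / q) * m (B 0) ^ ((1 - q) * (p / q))) := by
        rw [ENNReal.mul_rpow_of_nonneg _ _ hp0.le, ← ENNReal.rpow_mul, one_div_mul_cancel hp0.ne',
          ENNReal.rpow_one, ← ENNReal.rpow_mul, show 1 / q * p = p / q by ring,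
          ENNReal.mul_rpow_of_nonneg _ _ (by positivity), ← ENNReal.rpow_mul]
    _ = _ := by
        have he : (1 - q) * (p / q) = -1 := by
          have := hpq.symm.sub_one_mul_conj
          field_simp
          linarith
        rw [he, ENNReal.rpow_neg_one]
        ring

/-- The bound is linear in `‖f‖ ^ p` and contains a single inverse mass, so it can be integrated in
`x` by exchanging integrals. -/
lemma exists_qVariation_one_ballAverage_rpow_le {p : ℝ} (hp : 1 ≤ p) :
    ∃ C : ℝ≥0, ∀ m : Measure G, (∀ x r, m (closedBall x r) < ∞) → ∀ f : G → ℂ, Measurable f →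
      BallIntegrable m f → ∀ x ρ R, m (closedBall x ρ) ≠ 0 →
      qVariation 1 (Ico ρ R) (fun r => ballAverage m r f x) ^ p ≤
        C * ((m (closedBall x ρ))⁻¹ * ∫⁻ y in closedBall x R, ‖f y‖ₑ ^ p ∂m) := by
  rcases hp.eq_or_lt with rfl | hp1
  · refine ⟨2, fun m hm f _ hf x ρ R h0 => ?_⟩
    simpa using qVariation_one_ballAverage_le hm hf (R := R)
      (ENNReal.toReal_pos h0 (hm x ρ).ne)
  have hpq := Real.HolderConjugate.conjExponent hp1
  set q := p.conjExponent with hq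
  have hp0 := hpq.pos
  set A : ℝ≥0∞ := 2 ^ (p - 1) * (2 ^ p * ENNReal.ofReal (q - 1)⁻¹ ^ (p / q) + 1) with hA
  have hAt : A ≠ ∞ := by
    have h1 : (2 : ℝ≥0∞) ^ (p - 1) ≠ ∞ := ENNReal.rpow_ne_top_of_nonneg (by linarith) (by norm_num)
    have h2 : (2 : ℝ≥0∞) ^ p ≠ ∞ := ENNReal.rpow_ne_top_of_nonneg hp0.le (by norm_num)
    have h3 : ENNReal.ofReal (q - 1)⁻¹ ^ (p / q) ≠ ∞ :=
      ENNReal.rpow_ne_top_of_nonneg (by have := hpq.symm.pos; positivity) ENNReal.ofReal_ne_top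
    simp [hA, ENNReal.mul_eq_top, h1, h2, h3]
  refine ⟨A.toNNReal, fun m hm f hfm hf x ρ R h0 => ?_⟩
  rw [ENNReal.coe_toNNReal hAt, ← ENNReal.le_rpow_inv_iff hp0]
  refine qVariation_one_le fun J r hrs hI => ?_
  rw [ENNReal.le_rpow_inv_iff hp0]
  have hmono := finExtend_monotone hrs
  set t := finExtend r with ht
  have htI : ∀ j, t j ∈ Ico ρ R := fun j => hI _
  have hle : m (closedBall x ρ) ≤ m (closedBall x (t 0)) :=
    measure_mono (closedBall_subset_closedBall (htI 0).1)
  have hpos : 0 < m.real (closedBall x (t 0)) :=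
    ENNReal.toReal_pos (fun h => h0 (le_antisymm (h ▸ hle) zero_le)) (hm _ _).ne
  have hinv : (m (closedBall x (t 0)))⁻¹ ≤ (m (closedBall x ρ))⁻¹ := ENNReal.inv_le_inv.2 hle
  have hR : ∀ j, ∫⁻ y in closedBall x (t j), ‖f y‖ₑ ^ p ∂m ≤ ∫⁻ y in closedBall x R, ‖f y‖ₑ ^ p ∂m :=
    fun j => lintegral_mono_set (closedBall_subset_closedBall (htI j).2.le)
  have hX : (m (closedBall x (t 0)))⁻¹ * ∫⁻ y in closedBall x (t J), ‖f y‖ₑ ^ p ∂m ≤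
      (m (closedBall x ρ))⁻¹ * ∫⁻ y in closedBall x R, ‖f y‖ₑ ^ p ∂m := mul_le_mul' hinv (hR J)
  have hX0 : (m (closedBall x (t 0)))⁻¹ * ∫⁻ y in closedBall x (t 0), ‖f y‖ₑ ^ p ∂m ≤
      (m (closedBall x ρ))⁻¹ * ∫⁻ y in closedBall x R, ‖f y‖ₑ ^ p ∂m := mul_le_mul' hinv (hR 0)
  rw [sum_fin_eq_sum_range_finExtend r (fun a b => ‖ballAverage m a f x - ballAverage m b f x‖ₑ)]
  refine (ENNReal.rpow_le_rpow (sum_enorm_ballAverage_sub_le' hm hf hmono hpos) hp0.le).trans ?_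
  refine (ENNReal.rpow_add_le_mul_rpow_add_rpow _ _ hp).trans ?_
  rw [hA, mul_assoc]
  refine mul_le_mul' le_rfl ?_
  rw [add_mul, one_mul, ENNReal.mul_rpow_of_nonneg _ _ hp0.le, mul_assoc]
  refine add_le_add (mul_le_mul' le_rfl ?_) ?_
  · exact (sum_shell_rpow_le hm hpq hfm.enorm hmono hpos).trans (mul_le_mul' le_rfl hX)
  · exact (ballLAverage_rpow_le hm hfm.enorm hp (t 0) x).trans hX0

/-! ### Covering numbers -/

/-- Every ball of radius `R` is covered by at most `n` balls of radius `σ`. -/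
def CoverBound (G : Type*) [MetricSpace G] (R σ : ℝ) (n : ℕ) : Prop :=
  ∀ x : G, ∃ t : Finset G, t.card ≤ n ∧ closedBall x R ⊆ ⋃ z ∈ t, closedBall z σ

lemma CoverBound.trans {R σ τ : ℝ} {n k : ℕ} (h1 : CoverBound G R σ n) (h2 : CoverBound G σ τ k) :
    CoverBound G R τ (n * k) := by
  classical
  intro x
  obtain ⟨t, ht, hxt⟩ := h1 x
  choose s hs hxs using h2
  refine ⟨t.biUnion s, Finset.card_biUnion_le_card_mul _ _ _ (fun z _ => hs z) |>.trans
    (Nat.mul_le_mul_right k ht), fun y hy => ?_⟩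
  obtain ⟨z, hz, hyz⟩ := mem_iUnion₂.1 (hxt hy)
  obtain ⟨w, hw, hyw⟩ := mem_iUnion₂.1 (hxs z hyz)
  exact mem_iUnion₂.2 ⟨w, Finset.mem_biUnion.2 ⟨z, hz, hw⟩, hyw⟩

lemma GeometricallyDoubling.coverBound {D r : ℝ} (h : GeometricallyDoubling G D r) (hr : 0 < r)
    (k : ℕ) : CoverBound G r (r / 2 ^ k) (⌊D⌋₊ ^ k) := by
  induction k with
  | zero => exact fun x => ⟨{x}, by simp, by simp⟩
  | succ k ih =>
    rw [pow_succ]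
    refine ih.trans fun x => ?_
    obtain ⟨t, ht, hx⟩ := h x (r / 2 ^ k) (by positivity)
      (div_le_self hr.le (one_le_pow₀ (by norm_num)))
    refine ⟨t, Nat.le_floor ht, ?_⟩
    rwa [← div_div]

/-- A packing argument: points of the ball separated by more than `4 * r₀` have disjoint balls of
radius `r₀`, each carrying a fixed proportion of the mass of the enlarged ball, so their number is
bounded. A family of largest cardinality covers. -/
lemma CoarseAnnular.exists_coverBound {r₀ ε K : ℝ} (h : CoarseAnnular m r₀ ε K) (R : ℝ) :
    ∃ n, CoverBound G R (4 * r₀) n := by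
  obtain ⟨C, hC1, hC⟩ := h.exists_doubling (2 * (|R| + r₀) / r₀)
  have hr₀ := h.r₀_pos
  obtain ⟨n, hn⟩ := exists_nat_gt C
  refine ⟨n, fun x => ?_⟩
  classical
  set P : Finset G → Prop := fun t => (↑t ⊆ closedBall x R) ∧
    (↑t : Set G).Pairwise fun z w => 4 * r₀ < dist z w with hP
  have hcard : ∀ t, P t → t.card ≤ n := fun t ht => by
    set A := m (closedBall x (|R| + r₀)) with hA
    have hA0 : A ≠ 0 := h.pos' x (by linarith [abs_nonneg R])
    have hAt : A ≠ ∞ := (h.lt_top _ _).ne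
    have h1 : ∀ z ∈ t, A ≤ C * m (closedBall z r₀) := fun z hz => hC z x r₀ _ le_rfl (by
      rw [div_mul_cancel₀ _ hr₀.ne']
      have := mem_closedBall.1 (ht.1 hz)
      linarith [le_abs_self R])
    have h2 : ∑ z ∈ t, m (closedBall z r₀) ≤ A := by
      rw [← measure_biUnion_finset (fun z hz w hw hne => ?_) fun z _ => measurableSet_closedBall]
      · refine measure_mono (iUnion₂_subset fun z hz y hy => ?_)
        have := mem_closedBall.1 (ht.1 hz)
        have := mem_closedBall.1 hy
        rw [mem_closedBall]
        linarith [le_abs_self R, dist_triangle y z x]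
      · refine closedBall_disjoint_closedBall ?_
        linarith [ht.2 hz hw hne]
    have h3 : (t.card : ℝ≥0∞) * A ≤ C * A := by
      calc (t.card : ℝ≥0∞) * A = ∑ z ∈ t, A := by simp
        _ ≤ ∑ z ∈ t, C * m (closedBall z r₀) := Finset.sum_le_sum h1
        _ ≤ _ := by rw [← Finset.mul_sum]; gcongr
    rw [ENNReal.mul_le_mul_iff_left hA0 hAt] at h3
    have h4 : (t.card : ℝ≥0) ≤ C := by exact_mod_cast h3
    exact_mod_cast (h4.trans hn.le)
  set k := Nat.findGreatest (fun k => ∃ t, P t ∧ t.card = k) n with hk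
  obtain ⟨t, ht, htk⟩ : ∃ t, P t ∧ t.card = k :=
    Nat.findGreatest_spec (P := fun k => ∃ t, P t ∧ t.card = k) (Nat.zero_le n)
      ⟨∅, by simp [hP], rfl⟩
  refine ⟨t, hcard t ht, fun y hy => ?_⟩
  by_contra hcon
  simp only [mem_iUnion, mem_closedBall, not_exists, not_le] at hcon
  have hyt : y ∉ t := fun hyt => by
    have := hcon y hyt
    rw [dist_self] at this
    linarith
  have hins : P (insert y t) := by
    refine ⟨?_, ?_⟩
    · rw [Finset.coe_insert]
      exact insert_subset hy ht.1
    · rw [Finset.coe_insert, Set.pairwise_insert]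
      refine ⟨ht.2, fun z hz _ => ⟨hcon z hz, ?_⟩⟩
      rw [dist_comm]
      exact hcon z hz
  refine Nat.findGreatest_is_greatest (P := fun k => ∃ t, P t ∧ t.card = k) (n := n)
    (k := k + 1) (Nat.lt_succ_self k) ?_ ⟨_, hins, ?_⟩
  · rw [← htk, ← Finset.card_insert_of_notMem hyt]
    exact hcard _ hins
  · rw [Finset.card_insert_of_notMem hyt, htk]

/-- From radius `R` down to `4 * r₀` by the measure, and from there down to `σ` by iterating
geometric doubling. -/
lemma CoarseAnnular.exists_coverBound_of_doubling {r₀ ε K D : ℝ} (h : CoarseAnnular m r₀ ε K)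
    (hD : GeometricallyDoubling G D (4 * r₀)) (R : ℝ) {σ : ℝ} (hσ : 0 < σ) :
    ∃ n, CoverBound G R σ n := by
  have hr₀ := h.r₀_pos
  obtain ⟨n, hn⟩ := h.exists_coverBound R
  obtain ⟨k, hk⟩ := pow_unbounded_of_one_lt (4 * r₀ / σ) one_lt_two
  have hk' : 4 * r₀ / 2 ^ k ≤ σ := by
    rw [div_lt_iff₀ hσ] at hk
    rw [div_le_iff₀ (by positivity)]
    linarith
  refine ⟨n * ⌊D⌋₊ ^ k, fun x => ?_⟩
  obtain ⟨t, ht, hxt⟩ := hn.trans (hD.coverBound (by linarith) k) x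
  exact ⟨t, ht, hxt.trans (iUnion₂_mono fun z _ => closedBall_subset_closedBall hk')⟩

/-- Every ball is covered by finitely many balls of any given radius, which yields countable nets at
every scale. -/
lemma CoarseAnnular.secondCountableTopology {r₀ ε K D : ℝ} (h : CoarseAnnular m r₀ ε K)
    (hD : GeometricallyDoubling G D (4 * r₀)) : SecondCountableTopology G := by
  rcases isEmpty_or_nonempty G with hG | ⟨⟨x⟩⟩
  · infer_instance
  refine Metric.secondCountable_of_almost_dense_set fun σ hσ => ?_
  have hc : ∀ k : ℕ, ∃ t : Finset G, closedBall x k ⊆ ⋃ z ∈ t, closedBall z σ := fun k => by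
    obtain ⟨n, hn⟩ := h.exists_coverBound_of_doubling hD k hσ
    obtain ⟨t, -, ht⟩ := hn x
    exact ⟨t, ht⟩
  choose t ht using hc
  refine ⟨⋃ k, t k, countable_iUnion fun k => (t k).countable_toSet, fun y => ?_⟩
  obtain ⟨k, hk⟩ := exists_nat_ge (dist y x)
  obtain ⟨z, hz, hyz⟩ := mem_iUnion₂.1 (ht k hk)
  exact ⟨z, mem_iUnion.2 ⟨k, hz⟩, hyz⟩

/-- The exceptional points have null neighbourhoods, so by second countability they form a null set.
Below `r₀` balls may indeed be null. -/
lemma ae_measure_closedBall_ne_zero [SecondCountableTopology G] (m : Measure G) {ρ : ℝ}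
    (hρ : 0 < ρ) : ∀ᵐ x ∂m, m (closedBall x ρ) ≠ 0 := by
  rw [ae_iff]
  simp only [ne_eq, not_not]
  refine measure_null_of_locally_null _ fun x hx => ⟨closedBall x ρ, ?_, hx⟩
  exact mem_nhdsWithin_of_mem_nhds (closedBall_mem_nhds x hρ)

/-- For `x` in a ball of radius `ρ / 2`, the ball of radius `ρ` about `x` contains it. Each ball of
the cover thus contributes at most `1`, without any doubling. -/
lemma setLIntegral_inv_measure_closedBall_le {R ρ : ℝ} {n : ℕ}
    (hn : CoverBound G R (ρ / 2) n) (y : G) :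
    ∫⁻ x in closedBall y R, (m (closedBall x ρ))⁻¹ ∂m ≤ n := by
  obtain ⟨t, ht, hyt⟩ := hn y
  have hone : ∀ z, ∫⁻ x in closedBall z (ρ / 2), (m (closedBall x ρ))⁻¹ ∂m ≤ 1 := fun z => by
    calc _ ≤ ∫⁻ x in closedBall z (ρ / 2), (m (closedBall z (ρ / 2)))⁻¹ ∂m := by
          refine setLIntegral_mono' measurableSet_closedBall fun x hx => ENNReal.inv_le_inv.2 ?_
          refine measure_mono fun w hw => ?_
          have h1 := mem_closedBall.1 hx
          have h2 := mem_closedBall.1 hw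
          rw [mem_closedBall]
          linarith [dist_triangle_right w x z]
      _ ≤ 1 := by
          rw [setLIntegral_const]
          exact ENNReal.inv_mul_le_one _
  calc _ ≤ ∫⁻ x in ⋃ z ∈ t, closedBall z (ρ / 2), (m (closedBall x ρ))⁻¹ ∂m := lintegral_mono_set hyt
    _ ≤ ∑ z ∈ t, ∫⁻ x in closedBall z (ρ / 2), (m (closedBall x ρ))⁻¹ ∂m := by
        have := lintegral_iUnion_le (μ := m) (fun z : t => closedBall z.1 (ρ / 2))
          (fun x => (m (closedBall x ρ))⁻¹)
        rwa [iUnion_subtype, tsum_fintype, Finset.univ_eq_attach, Finset.sum_attach t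
          (fun z => ∫⁻ x in closedBall z (ρ / 2), (m (closedBall x ρ))⁻¹ ∂m)] at this
    _ ≤ ∑ z ∈ t, 1 := Finset.sum_le_sum fun z _ => hone z
    _ ≤ n := by
        rw [Finset.sum_const, nsmul_eq_mul, mul_one]
        exact_mod_cast ht

lemma lintegral_inv_measure_mul_setLIntegral_le [SecondCountableTopology G] [SFinite m]
    {R ρ : ℝ} {n : ℕ} (hn : CoverBound G R (ρ / 2) n)
    {u : G → ℝ≥0∞} (hu : Measurable u) :
    ∫⁻ x, (m (closedBall x ρ))⁻¹ * ∫⁻ y in closedBall x R, u y ∂m ∂m ≤ n * ∫⁻ x, u x ∂m := by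
  have hS : ∀ R, MeasurableSet {z : G × G | dist z.2 z.1 ≤ R} := fun R =>
    measurableSet_le (measurable_snd.dist measurable_fst) measurable_const
  have hV : Measurable fun x => (m (closedBall x ρ))⁻¹ :=
    (measurable_measure_prodMk_left (ν := m) (hS ρ)).inv
  calc _ = ∫⁻ x, ∫⁻ y, {z : G × G | dist z.2 z.1 ≤ R}.indicator
          (fun z => (m (closedBall z.1 ρ))⁻¹ * u z.2) (x, y) ∂m ∂m := by
        refine lintegral_congr fun x => ?_
        rw [← lintegral_const_mul _ hu, ← lintegral_indicator measurableSet_closedBall]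
        rfl
    _ = ∫⁻ y, ∫⁻ x, {z : G × G | dist z.2 z.1 ≤ R}.indicator
          (fun z => (m (closedBall z.1 ρ))⁻¹ * u z.2) (x, y) ∂m ∂m := by
        refine lintegral_lintegral_swap (Measurable.aemeasurable ?_)
        exact ((hV.comp measurable_fst).mul (hu.comp measurable_snd)).indicator (hS R)
    _ = ∫⁻ y, u y * ∫⁻ x in closedBall y R, (m (closedBall x ρ))⁻¹ ∂m ∂m := by
        refine lintegral_congr fun y => ?_
        rw [← lintegral_const_mul _ hV, ← lintegral_indicator measurableSet_closedBall]
        refine lintegral_congr fun x => ?_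
        simp only [indicator, mem_ofPred_eq, mem_closedBall, dist_comm y x, mul_comm]
    _ ≤ ∫⁻ y, u y * n ∂m := by
        gcongr with y
        exact setLIntegral_inv_measure_closedBall_le hn y
    _ = _ := by rw [lintegral_mul_const _ hu, mul_comm]

/-- The strong type bound, for `1 ≤ p < ∞`, for the variation over a bounded range of radii. -/
theorem CoarseAnnular.exists_lintegral_qVariation_one_rpow_le [SecondCountableTopology G]
    {r₀ ε K D : ℝ} (h : CoarseAnnular m r₀ ε K) (hD : GeometricallyDoubling G D (4 * r₀))
    {ρ R : ℝ} (hρ : 0 < ρ) {p : ℝ} (hp : 1 ≤ p) : ∃ C : ℝ≥0, ∀ f : G → ℂ, Measurable f →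
      BallIntegrable m f →
      ∫⁻ x, qVariation 1 (Ico ρ R) (fun r => ballAverage m r f x) ^ p ∂m ≤
        C * ∫⁻ x, ‖f x‖ₑ ^ p ∂m := by
  have := h.sigmaFinite
  obtain ⟨n, hn⟩ := h.exists_coverBound_of_doubling hD R (half_pos hρ)
  obtain ⟨C, hC⟩ := exists_qVariation_one_ballAverage_rpow_le (G := G) hp
  refine ⟨C * n, fun f hfm hf => ?_⟩
  calc _ ≤ ∫⁻ x, C * ((m (closedBall x ρ))⁻¹ * ∫⁻ y in closedBall x R, ‖f y‖ₑ ^ p ∂m) ∂m := by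
        refine lintegral_mono_ae ?_
        filter_upwards [ae_measure_closedBall_ne_zero m hρ] with x hx
        exact hC m h.lt_top f hfm hf x ρ R hx
    _ ≤ C * (n * ∫⁻ x, ‖f x‖ₑ ^ p ∂m) := by
        rw [lintegral_const_mul' _ _ ENNReal.coe_ne_top]
        exact mul_le_mul' le_rfl
          (lintegral_inv_measure_mul_setLIntegral_le hn (hfm.enorm.pow_const p))
    _ = _ := by push_cast; ring

end

/-! ### From scales above `r₀` to the full short variation. -/

section

variable {G : Type*} [MetricSpace G] [MeasurableSpace G] [OpensMeasurableSpace G]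
variable {m : Measure G} {r₀ ε δ D : ℝ} {n₀ : ℤ}

/-- A nonzero measure with annular decay has positive mass on the balls of radius at least `r₀`. -/
lemma AnnularDecay.exists_coarseAnnular (hr₀ : 0 < r₀) (hε : 0 < ε) (hε1 : ε ≤ 1)
    (hm : ∀ (h : G) (r : ℝ), m (closedBall h r) < ∞) (hdecay : AnnularDecay m ε r₀) (h0 : m ≠ 0) :
    ∃ K, CoarseAnnular m r₀ ε K := by
  obtain ⟨K, hK, hd⟩ := hdecay
  -- The endpoint `r = r₀` is reached by right continuity of the mass of closed balls.
  have hdec : ∀ x r s, r₀ ≤ r → 0 < s → s ≤ r →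
      m.real (closedBall x (r + s)) - m.real (closedBall x r) ≤
        K * (s / r) ^ ε * m.real (closedBall x r) := by
    intro x r s hr hs hsr
    have hr0 : 0 < r := hr₀.trans_le hr
    suffices H : m.real (closedBall x (r + s)) ≤
        (1 + K * (s / r) ^ ε) * m.real (closedBall x r) by linarith
    have hlim : Tendsto (fun t => (1 + K * (s / r) ^ ε) * m.real (closedBall x t)) (𝓝[>] r)
        (𝓝 ((1 + K * (s / r) ^ ε) * m.real (closedBall x r))) :=
      (((continuousWithinAt_measureReal_closedBall hm x r).mono Ioi_subset_Ici_self).tendsto).const_mul _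
    refine ge_of_tendsto hlim ?_
    filter_upwards [self_mem_nhdsWithin] with t ht
    have ht' : r < t := ht
    have h1 := hd x t s (hr.trans_lt ht') hs (hsr.trans ht'.le)
    have h2 : m.real (closedBall x (r + s)) ≤ m.real (closedBall x (t + s)) :=
      measureReal_mono (closedBall_subset_closedBall (by linarith)) (hm _ _).ne
    have ht0 : 0 < t := hr0.trans ht'
    have h3 : (s / t) ^ ε ≤ (s / r) ^ ε := by gcongr
    have h4 : K * (s / t) ^ ε * m.real (closedBall x t) ≤
        K * (s / r) ^ ε * m.real (closedBall x t) := by gcongr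
    linarith
  refine ⟨K, hr₀, hε, hε1, hK.le, hm, fun x r hr => ?_, hdec⟩
  by_contra hcon
  have hz : m.real (closedBall x r) = 0 := le_antisymm (not_lt.1 hcon) measureReal_nonneg
  have hr0 : 0 < r := hr₀.trans_le hr
  -- A single null ball of radius at least `r₀` forces all its doublings to be null, hence `m = 0`.
  have hall : ∀ k : ℕ, m (closedBall x (2 ^ k * r)) = 0 := fun k => by
    induction k with
    | zero =>
      have := (measureReal_eq_zero_iff (hm x r).ne).1 hz
      simpa using this
    | succ k ih =>
      have hk : r ≤ 2 ^ k * r := le_mul_of_one_le_left hr0.le (one_le_pow₀ (by norm_num))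
      have h1 := hdec x (2 ^ k * r) (2 ^ k * r) (hr.trans hk) (hr0.trans_le hk) le_rfl
      rw [show m.real (closedBall x (2 ^ k * r)) = 0 by rw [Measure.real, ih]; rfl,
        mul_zero, sub_zero] at h1
      rw [← measureReal_eq_zero_iff (hm _ _).ne]
      refine le_antisymm ?_ measureReal_nonneg
      rwa [show 2 ^ (k + 1) * r = 2 ^ k * r + 2 ^ k * r by ring]
  refine h0 (Measure.measure_univ_eq_zero.1 ?_)
  have hU : (univ : Set G) ⊆ ⋃ k : ℕ, closedBall x (2 ^ k * r) := fun y _ => by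
    obtain ⟨k, hk⟩ := pow_unbounded_of_one_lt (dist y x / r) one_lt_two
    rw [div_lt_iff₀ hr0] at hk
    exact mem_iUnion.2 ⟨k, hk.le⟩
  exact measure_mono_null hU (measure_iUnion_null hall)

lemma GoodScales.of_base (hr₀ : 0 < r₀) (hδ : 18 ≤ δ) (hn₀ : r₀ ≤ δ ^ (n₀ + 1)) :
    GoodScales (δ ^ (n₀ + 2)) δ r₀ := by
  have hδ0 : 0 < δ := by linarith
  refine ⟨hr₀, ?_, hδ⟩
  rw [show n₀ + 2 = (n₀ + 1) + 1 by ring, zpow_add_one₀ hδ0.ne', mul_comm]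
  exact mul_le_mul hn₀ hδ (by norm_num) (by positivity)

lemma shortVariation_congr_ae {f g : G → ℂ} (hfg : f =ᵐ[m] g) (I : Set ℝ) :
    shortVariation m δ n₀ I f = shortVariation m δ n₀ I g := by
  funext x
  simp only [shortVariation, ballAverage_congr_ae hfg]

lemma shortVariation_sq (m : Measure G) (δ : ℝ) (n₀ : ℤ) (I : Set ℝ) (f : G → ℂ) (x : G) :
    shortVariation m δ n₀ I f x ^ 2 = ∑' k : ℕ,
      qVariation 2 (Ico (δ ^ (n₀ + k)) (δ ^ (n₀ + k + 1)) ∩ I) (fun r => ballAverage m r f x) ^ 2 := by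
  let e : ℕ ≃ {n : ℤ // n₀ ≤ n} :=
    { toFun := fun k => ⟨n₀ + k, by omega⟩
      invFun := fun n => (n.1 - n₀).toNat
      left_inv := fun k => by simp
      right_inv := fun n => by
        ext
        have := n.2
        simp only
        omega }
  rw [shortVariation, ← ENNReal.rpow_two, ← ENNReal.rpow_mul]
  norm_num
  rw [← e.tsum_eq]
  rfl

lemma scaleVariation_base (hδ : 0 < δ) (i : ℕ) (f : G → ℂ) (x : G) :
    scaleVariation m (δ ^ (n₀ + 2)) δ i f x =
      qVariation 2 (Ico (δ ^ (n₀ + (i + 3 : ℕ))) (δ ^ (n₀ + (i + 3 : ℕ) + 1)))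
        (fun r => ballAverage m r f x) := by
  rw [scaleVariation, ← zpow_natCast, ← zpow_natCast, ← zpow_add₀ hδ.ne', ← zpow_add₀ hδ.ne']
  congr 3 <;> push_cast <;> ring

/-- With base `δ ^ (n₀ + 2)` the scale `i` is the interval starting at `δ ^ (n₀ + 3 + i)`; the three
earlier intervals are estimated separately. -/
lemma shortVariation_sq_le (hδ : 0 < δ) {I : Set ℝ} {f : G → ℂ} {x : G} {L : ℝ≥0∞}
    (hL : ∀ k < 3, qVariation 2 (Ico (δ ^ (n₀ + (k : ℕ))) (δ ^ (n₀ + (k : ℕ) + 1)) ∩ I)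
      (fun r => ballAverage m r f x) ≤ L) :
    shortVariation m δ n₀ I f x ^ 2 ≤ 3 * L ^ 2 +
      ⨆ N, squareVariation m (δ ^ (n₀ + 2)) δ N f x := by
  rw [shortVariation_sq, ← Summable.sum_add_tsum_nat_add' (k := 3) ENNReal.summable]
  refine add_le_add ?_ ?_
  · calc _ ≤ ∑ k ∈ Finset.range 3, L ^ 2 := Finset.sum_le_sum fun k hk =>
          pow_le_pow_left₀ zero_le (hL k (Finset.mem_range.1 hk)) 2
      _ = _ := by simp
  · rw [ENNReal.tsum_eq_iSup_nat]
    refine iSup_mono fun N => Finset.sum_le_sum fun i _ => pow_le_pow_left₀ zero_le ?_ 2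
    rw [scaleVariation_base hδ]
    exact qVariation_mono inter_subset_left _

/-- All radii involved are at least `δ ^ (n₀ + 3) ≥ r₀`, so the cut at `r₀` does not affect them. -/
lemma iSup_squareVariation_le (hδ : 1 < δ) (hn₀ : r₀ ≤ δ ^ (n₀ + 1)) (f : G → ℂ) (x : G) :
    ⨆ N, squareVariation m (δ ^ (n₀ + 2)) δ N f x ≤ shortVariation m δ n₀ (Ici r₀) f x ^ 2 := by
  rw [shortVariation_sq, ← Summable.sum_add_tsum_nat_add' (k := 3) ENNReal.summable]
  refine le_trans (le_of_eq ?_) le_add_self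
  rw [ENNReal.tsum_eq_iSup_nat]
  refine iSup_congr fun N => Finset.sum_congr rfl fun i _ => ?_
  rw [scaleVariation_base (by linarith)]
  congr 2
  refine (inter_eq_left.2 fun r hr => hn₀.trans (le_trans ?_ hr.1)).symm
  exact zpow_le_zpow_right₀ hδ.le (by push_cast; omega)

section

variable [SecondCountableTopology G] [SFinite m]

lemma aemeasurable_qVariation_ballAverage (hm : ∀ x r, m (closedBall x r) < ∞) {f : G → ℂ}
    (hfm : Measurable f) (hf : BallIntegrable m f) {ρ R : ℝ} (hρ : 0 < ρ) (q : ℝ) :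
    AEMeasurable (fun x => qVariation q (Ico ρ R) fun r => ballAverage m r f x) m := by
  refine aemeasurable_qVariation (fun r => measurable_ballAverage r hfm) ?_
  filter_upwards [ae_measure_closedBall_ne_zero m hρ] with x hx r hr
  refine continuousWithinAt_ballAverage hm hf (ENNReal.toReal_pos (fun h0 => hx ?_) (hm x r).ne)
  exact measure_mono_null (closedBall_subset_closedBall hr.1) h0

lemma aemeasurable_shortVariation (hm : ∀ x r, m (closedBall x r) < ∞) (hδ : 0 < δ) {f : G → ℂ}
    (hfm : Measurable f) (hf : BallIntegrable m f) {I : Set ℝ} (hI : I = univ ∨ ∃ s, I = Ici s) :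
    AEMeasurable (shortVariation m δ n₀ I f) m := by
  refine (AEMeasurable.tsum fun n => ?_).pow_const _
  refine AEMeasurable.pow_const ?_ _
  have hn : 0 < δ ^ n.1 := zpow_pos hδ _
  rcases hI with rfl | ⟨s, rfl⟩
  · rw [inter_univ]
    exact aemeasurable_qVariation_ballAverage hm hfm hf hn 2
  · rw [show Ico (δ ^ n.1) (δ ^ (n.1 + 1)) ∩ Ici s = Ico (max (δ ^ n.1) s) (δ ^ (n.1 + 1)) by
      ext r; simp only [mem_inter_iff, mem_Ico, mem_Ici, max_le_iff]; tauto]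
    exact aemeasurable_qVariation_ballAverage hm hfm hf (lt_max_of_lt_left hn) 2

end

lemma shortVariation_univ_sq_le (hδ : 1 < δ) (f : G → ℂ) (x : G) :
    shortVariation m δ n₀ univ f x ^ 2 ≤
      3 * qVariation 1 (Ico (δ ^ n₀) (δ ^ (n₀ + 3))) (fun r => ballAverage m r f x) ^ 2 +
      ⨆ N, squareVariation m (δ ^ (n₀ + 2)) δ N f x := by
  refine shortVariation_sq_le (by linarith) fun k hk => (qVariation_two_le_one _ _).trans ?_
  rw [inter_univ]
  refine qVariation_mono (Ico_subset_Ico ?_ ?_) _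
  · exact zpow_le_zpow_right₀ hδ.le (by omega)
  · exact zpow_le_zpow_right₀ hδ.le (by omega)

lemma ENNReal.add_rpow_le_two_rpow_mul {t : ℝ} (ht : 0 ≤ t) (x y : ℝ≥0∞) :
    (x + y) ^ t ≤ 2 ^ t * (x ^ t + y ^ t) := by
  rcases le_total x y with hxy | hxy
  · calc _ ≤ (2 * y) ^ t := by gcongr; rw [two_mul]; gcongr
      _ ≤ _ := by rw [ENNReal.mul_rpow_of_nonneg _ _ ht]; gcongr; exact le_add_self
  · calc _ ≤ (2 * x) ^ t := by gcongr; rw [two_mul]; gcongr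
      _ ≤ _ := by rw [ENNReal.mul_rpow_of_nonneg _ _ ht]; gcongr; exact le_self_add

lemma monotone_squareVariation (m : Measure G) (a δ : ℝ) (f : G → ℂ) (x : G) :
    Monotone fun N => squareVariation m a δ N f x := fun _ _ hMN =>
  Finset.sum_le_sum_of_subset (Finset.range_mono hMN)

section

variable [SecondCountableTopology G] [Nonempty G] {K : ℝ}
variable (h : CoarseAnnular m r₀ ε K) (hD : GeometricallyDoubling G D (4 * r₀))
variable (hδ : 18 ≤ δ) (hn₀ : r₀ ≤ δ ^ (n₀ + 1))
include h hD hδ hn₀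

lemma exists_lintegral_shortVariation_rpow_le {p : ℝ} (hp : 1 < p) : ∃ C : ℝ≥0, ∀ f : G → ℂ,
    Measurable f → BallIntegrable m f → ∫⁻ x, shortVariation m δ n₀ univ f x ^ p ∂m ≤
      C * ∫⁻ x, ‖f x‖ₑ ^ p ∂m := by
  have hs := GoodScales.of_base h.r₀_pos hδ hn₀
  have := h.sigmaFinite
  have hδ0 : 0 < δ := by linarith
  have hp2 : 0 < p / 2 := by linarith
  obtain ⟨C1, hC1⟩ := h.exists_lintegral_qVariation_one_rpow_le hD (ρ := δ ^ n₀) (R := δ ^ (n₀ + 3))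
    (zpow_pos hδ0 _) hp.le
  obtain ⟨C2, hC2⟩ := exists_lintegral_squareVariation_rpow_le h hs hp
  refine ⟨2 ^ (p / 2) * (3 ^ (p / 2) * C1 + C2), fun f hfm hf => ?_⟩
  set L := fun x => qVariation 1 (Ico (δ ^ n₀) (δ ^ (n₀ + 3))) (fun r => ballAverage m r f x) with hL
  set S := fun x => ⨆ N, squareVariation m (δ ^ (n₀ + 2)) δ N f x with hS
  have hSint : ∫⁻ x, S x ^ (p / 2) ∂m ≤ C2 * ∫⁻ x, ‖f x‖ₑ ^ p ∂m := by
    have e : ∀ x, S x ^ (p / 2) = ⨆ N, squareVariation m (δ ^ (n₀ + 2)) δ N f x ^ (p / 2) :=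
      fun x => (ENNReal.orderIsoRpow (p / 2) hp2).map_iSup _
    simp_rw [e]
    rw [lintegral_iSup (fun N => (measurable_squareVariation h hs N hfm hf).pow_const _)
      fun M N hMN x => ENNReal.rpow_le_rpow (monotone_squareVariation m _ δ f x hMN) hp2.le]
    exact iSup_le fun N => hC2 f hfm hf N
  have hLm : AEMeasurable L m := aemeasurable_qVariation_ballAverage h.lt_top hfm hf (zpow_pos hδ0 _) 1
  have hpt : ∀ x, shortVariation m δ n₀ univ f x ^ p ≤
      2 ^ (p / 2) * (3 ^ (p / 2) * L x ^ p + S x ^ (p / 2)) := fun x => by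
    calc _ = (shortVariation m δ n₀ univ f x ^ 2) ^ (p / 2) := by
          rw [← ENNReal.rpow_two, ← ENNReal.rpow_mul]; congr 1; ring
      _ ≤ (3 * L x ^ 2 + S x) ^ (p / 2) := by
          gcongr
          exact shortVariation_univ_sq_le (by linarith) f x
      _ ≤ 2 ^ (p / 2) * ((3 * L x ^ 2) ^ (p / 2) + S x ^ (p / 2)) :=
          ENNReal.add_rpow_le_two_rpow_mul hp2.le _ _
      _ = _ := by
          rw [ENNReal.mul_rpow_of_nonneg _ _ hp2.le, ← ENNReal.rpow_two, ← ENNReal.rpow_mul]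
          congr 4; ring
  have hc2 : (2 : ℝ≥0∞) ^ (p / 2) ≠ ∞ := ENNReal.rpow_ne_top_of_nonneg hp2.le (by norm_num)
  have hc3 : (3 : ℝ≥0∞) ^ (p / 2) ≠ ∞ := ENNReal.rpow_ne_top_of_nonneg hp2.le (by norm_num)
  calc _ ≤ ∫⁻ x, 2 ^ (p / 2) * (3 ^ (p / 2) * L x ^ p + S x ^ (p / 2)) ∂m := lintegral_mono hpt
    _ = 2 ^ (p / 2) * (3 ^ (p / 2) * ∫⁻ x, L x ^ p ∂m + ∫⁻ x, S x ^ (p / 2) ∂m) := by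
        rw [lintegral_const_mul' _ _ hc2, lintegral_add_left' ((hLm.pow_const p).const_mul _),
          lintegral_const_mul' _ _ hc3]
    _ ≤ 2 ^ (p / 2) * (3 ^ (p / 2) * (C1 * ∫⁻ x, ‖f x‖ₑ ^ p ∂m) + C2 * ∫⁻ x, ‖f x‖ₑ ^ p ∂m) := by
        gcongr
        exact hC1 f hfm hf
    _ = _ := by
        push_cast
        rw [ENNReal.coe_rpow_of_nonneg _ hp2.le, ENNReal.coe_rpow_of_nonneg _ hp2.le]
        push_cast
        ring

lemma exists_measure_shortVariation_le : ∃ C : ℝ≥0, ∀ f : G → ℂ, Measurable f →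
    BallIntegrable m f → ∀ l : ℝ≥0, l ≠ 0 →
      l * m {x | (l : ℝ≥0∞) < shortVariation m δ n₀ univ f x} ≤ C * ∫⁻ x, ‖f x‖ₑ ∂m := by
  have hs := GoodScales.of_base h.r₀_pos hδ hn₀
  have := h.sigmaFinite
  have hδ0 : 0 < δ := by linarith
  obtain ⟨C1, hC1⟩ := h.exists_lintegral_qVariation_one_rpow_le hD (ρ := δ ^ n₀) (R := δ ^ (n₀ + 3))
    (zpow_pos hδ0 _) le_rfl
  obtain ⟨C2, hC2⟩ := exists_measure_squareVariation_le h hs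
  refine ⟨3 * C1 + 2 * C2, fun f hfm hf l hl => ?_⟩
  set L := fun x => qVariation 1 (Ico (δ ^ n₀) (δ ^ (n₀ + 3))) (fun r => ballAverage m r f x) with hL
  set I := ∫⁻ x, ‖f x‖ₑ ∂m with hI
  have hLm : AEMeasurable L m := aemeasurable_qVariation_ballAverage h.lt_top hfm hf (zpow_pos hδ0 _) 1
  have h1 : l * m {x | ((l / 3 : ℝ≥0) : ℝ≥0∞) ≤ L x} ≤ 3 * C1 * I := by
    have := (mul_meas_ge_le_lintegral₀ hLm ((l / 3 : ℝ≥0) : ℝ≥0∞)).trans (by simpa using hC1 f hfm hf)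
    calc _ = 3 * (((l / 3 : ℝ≥0) : ℝ≥0∞) * m {x | ((l / 3 : ℝ≥0) : ℝ≥0∞) ≤ L x}) := by
          rw [← mul_assoc]
          congr 1
          rw [← ENNReal.coe_ofNat, ← ENNReal.coe_mul]
          congr 1; field_simp
      _ ≤ 3 * (C1 * I) := by gcongr
      _ = _ := by ring
  have h2 : l * m (⋃ N, {x | ((l / 2 : ℝ≥0) : ℝ≥0∞) ^ 2 <
      squareVariation m (δ ^ (n₀ + 2)) δ N f x}) ≤ 2 * C2 * I := by
    have hmono : Monotone fun N => {x | ((l / 2 : ℝ≥0) : ℝ≥0∞) ^ 2 <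
        squareVariation m (δ ^ (n₀ + 2)) δ N f x} := fun M N hMN x hx =>
      lt_of_lt_of_le hx (monotone_squareVariation m _ δ f x hMN)
    rw [hmono.measure_iUnion, ENNReal.mul_iSup]
    refine iSup_le fun N => ?_
    have := hC2 f hfm hf N (l / 2) (by positivity)
    calc _ = 2 * (((l / 2 : ℝ≥0) : ℝ≥0∞) * m {x | ((l / 2 : ℝ≥0) : ℝ≥0∞) ^ 2 <
          squareVariation m (δ ^ (n₀ + 2)) δ N f x}) := by
          rw [← mul_assoc]
          congr 1
          rw [← ENNReal.coe_ofNat, ← ENNReal.coe_mul]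
          congr 1; field_simp
      _ ≤ 2 * (C2 * I) := by gcongr
      _ = _ := by ring
  calc _ ≤ l * (m {x | ((l / 3 : ℝ≥0) : ℝ≥0∞) ≤ L x} + m (⋃ N, {x | ((l / 2 : ℝ≥0) : ℝ≥0∞) ^ 2 <
      squareVariation m (δ ^ (n₀ + 2)) δ N f x})) := by
        refine mul_le_mul' le_rfl ((measure_mono fun x hx => ?_).trans (measure_union_le _ _))
        by_contra hcon
        rw [mem_union, not_or, mem_iUnion, not_exists] at hcon
        have c1 : L x ≤ ((l / 3 : ℝ≥0) : ℝ≥0∞) := (not_le.1 hcon.1).le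
        have c2 : ⨆ N, squareVariation m (δ ^ (n₀ + 2)) δ N f x ≤ ((l / 2 : ℝ≥0) : ℝ≥0∞) ^ 2 :=
          iSup_le fun N => not_lt.1 (hcon.2 N)
        have c3 : (l : ℝ≥0∞) < shortVariation m δ n₀ univ f x := hx
        refine absurd (shortVariation_univ_sq_le (m := m) (n₀ := n₀)
          (show 1 < δ by linarith) f x) (not_le.2 ?_)
        calc _ ≤ 3 * ((l / 3 : ℝ≥0) : ℝ≥0∞) ^ 2 + ((l / 2 : ℝ≥0) : ℝ≥0∞) ^ 2 := by gcongr
          _ ≤ (l : ℝ≥0∞) ^ 2 := by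
              -- The thresholds `l / 3` and `l / 2` give `1 / 3 + 1 / 4 < 1`.
              have : 3 * (l / 3) ^ 2 + (l / 2) ^ 2 ≤ l ^ 2 := by
                rw [← NNReal.coe_le_coe]
                push_cast
                nlinarith [sq_nonneg (l : ℝ)]
              exact_mod_cast this
          _ < _ := ENNReal.pow_lt_pow_left two_ne_zero c3
    _ ≤ 3 * C1 * I + 2 * C2 * I := by rw [mul_add]; gcongr
    _ = _ := by push_cast; ring

end

end

/-! ### Oscillation of the short variation over dyadic cubes. -/

section

lemma ENNReal.tsum_sq_rpow_half_le {u v w : ℕ → ℝ≥0∞} {D : ℝ≥0∞} (huvw : ∀ i, u i ≤ v i + w i)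
    (hD : ∑' i, w i ^ 2 ≤ D) :
    (∑' i, u i ^ 2) ^ (1 / 2 : ℝ) ≤ (∑' i, v i ^ 2) ^ (1 / 2 : ℝ) + D ^ (1 / 2 : ℝ) := by
  refine ENNReal.le_of_sq_le_sq ?_
  rw [ENNReal.sqrt_sq]
  refine ENNReal.tsum_le_of_sum_range_le fun N => ?_
  have h := ENNReal.Lp_add_le (Finset.range N) v w (p := 2) one_le_two
  simp only [ENNReal.rpow_two] at h
  calc ∑ i ∈ Finset.range N, u i ^ 2 ≤ ∑ i ∈ Finset.range N, (v i + w i) ^ 2 :=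
        Finset.sum_le_sum fun i _ => pow_le_pow_left₀ zero_le (huvw i) 2
    _ = ((∑ i ∈ Finset.range N, (v i + w i) ^ 2) ^ (1 / 2 : ℝ)) ^ 2 := (ENNReal.sqrt_sq _).symm
    _ ≤ _ := by
        refine pow_le_pow_left₀ zero_le (h.trans (add_le_add ?_ ?_)) 2
        · exact ENNReal.rpow_le_rpow (ENNReal.sum_le_tsum _) (by norm_num)
        · exact ENNReal.rpow_le_rpow ((ENNReal.sum_le_tsum _).trans hD) (by norm_num)

lemma ENNReal.add_rpow_half_le (a b : ℝ≥0∞) :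
    (a + b) ^ (1 / 2 : ℝ) ≤ a ^ (1 / 2 : ℝ) + b ^ (1 / 2 : ℝ) :=
  ENNReal.rpow_add_le_add_rpow _ _ (by norm_num) (by norm_num)

lemma ENNReal.sq_rpow_half (a : ℝ≥0∞) : (a ^ 2) ^ (1 / 2 : ℝ) = a := by
  rw [← ENNReal.rpow_two, ← ENNReal.rpow_mul]; norm_num

variable {G : Type*} [MetricSpace G] [MeasurableSpace G] [OpensMeasurableSpace G]
variable {m : Measure G} {r₀ ε δ D : ℝ} {n₀ : ℤ} {a K : ℝ}

lemma iSup_squareVariation (m : Measure G) (a δ : ℝ) (f : G → ℂ) (x : G) :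
    ⨆ N, squareVariation m a δ N f x = ∑' i, scaleVariation m a δ i f x ^ 2 :=
  ENNReal.tsum_eq_iSup_nat.symm

/-- The square variation over the scales above `j` has bounded oscillation at scale `j`. -/
lemma exists_tsum_scaleVariation_sq_le (h : CoarseAnnular m r₀ ε K) (hs : GoodScales a δ r₀) :
    ∃ C : ℝ≥0, ∀ f : G → ℂ, Measurable f → BallIntegrable m f → ∀ B : ℝ≥0∞, (∀ y, ‖f y‖ₑ ≤ B) →
      ∀ j x y, dist x y ≤ 5 * (a * δ ^ j) →
      (∑' i, scaleVariation m a δ (i + j) f y ^ 2) ^ (1 / 2 : ℝ) ≤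
        (∑' i, scaleVariation m a δ (i + j) f x ^ 2) ^ (1 / 2 : ℝ) + C * B := by
  obtain ⟨C, hC⟩ := h.exists_scale_qVariation_sub_sq_le hs
  have hϑ1 := ratio_lt_one h hs
  set ϑ := (δ ^ (-(ε / 2))).toNNReal with hϑ
  have hAt : (1 - (ϑ : ℝ≥0∞))⁻¹ ≠ ∞ :=
    ENNReal.inv_ne_top.2 (tsub_pos_of_lt (by exact_mod_cast hϑ1)).ne'
  have hCt : (C * (1 - (ϑ : ℝ≥0∞))⁻¹) ^ (1 / 2 : ℝ) ≠ ∞ :=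
    ENNReal.rpow_ne_top_of_nonneg (by norm_num) (ENNReal.mul_ne_top ENNReal.coe_ne_top hAt)
  refine ⟨((C * (1 - (ϑ : ℝ≥0∞))⁻¹) ^ (1 / 2 : ℝ)).toNNReal,
    fun f hfm hf B hB j x y hxy => ?_⟩
  rw [ENNReal.coe_toNNReal hCt]
  have := ENNReal.tsum_sq_rpow_half_le (fun i => scaleVariation_le_add (m := m) (a := a) (δ := δ)
    (i + j) f x y) (D := C * (1 - (ϑ : ℝ≥0∞))⁻¹ * B ^ 2) ?_
  · rwa [ENNReal.mul_rpow_of_nonneg _ _ (by norm_num), ENNReal.sq_rpow_half] at this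
  · rw [← ENNReal.tsum_geometric, ← ENNReal.tsum_mul_left, ← ENNReal.tsum_mul_right]
    refine ENNReal.tsum_le_tsum fun i => ?_
    have h1 := hC f hfm hf j (i + j) (Nat.le_add_left j i) x y hxy
    rw [Nat.add_sub_cancel] at h1
    refine h1.trans (mul_le_mul' le_rfl (ballLAverage_le fun z _ => ?_))
    exact pow_le_pow_left₀ zero_le (hB z) 2

/-- The `L²` bound for the square variation over the scales below `j`, localised to a set of
diameter about `a * δ ^ j`. -/
lemma exists_setLIntegral_squareVariation_le_of_bound [SecondCountableTopology G] [Nonempty G]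
    (h : CoarseAnnular m r₀ ε K) (hs : GoodScales a δ r₀) :
    ∃ C : ℝ≥0, ∀ f : G → ℂ, Measurable f → BallIntegrable m f → ∀ B : ℝ≥0∞, (∀ y, ‖f y‖ₑ ≤ B) →
      ∀ (j : ℕ) (z : G) (r : ℝ) (Q : Set G), MeasurableSet Q → r₀ ≤ r → a * δ ^ j ≤ δ ^ 2 * r →
      closedBall z r ⊆ Q → Q ⊆ closedBall z (5 * (a * δ ^ j)) →
      ∫⁻ y in Q, squareVariation m a δ j f y ∂m ≤ C * B ^ 2 * m Q := by
  obtain ⟨C1, hC1⟩ := exists_lintegral_squareVariation_le h hs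
  obtain ⟨C2, -, hC2⟩ := h.exists_doubling (6 * δ ^ 3)
  refine ⟨C1 * C2, fun f hfm hf B hB j z r Q hQm hr hrj hrQ hQ => ?_⟩
  have hδ := hs.le_δ
  have hsc := hs.scale_pos j
  set R := 6 * (a * δ ^ (j + 1)) with hR
  have hSm : MeasurableSet (closedBall z R) := isClosed_closedBall.measurableSet
  have hcongr : ∀ y ∈ Q, squareVariation m a δ j f y =
      squareVariation m a δ j ((closedBall z R).indicator f) y := fun y hy => by
    refine squareVariation_congr_on fun i hi w hw => ?_
    rw [indicator_of_mem]
    have h1 : dist y z ≤ 5 * (a * δ ^ j) := hQ hy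
    have h2 : dist w y ≤ a * δ ^ (i + 2) := hw
    have h3 : a * δ ^ (i + 2) ≤ a * δ ^ (j + 1) := hs.scale_mono (by omega)
    have h4 : a * δ ^ j ≤ a * δ ^ (j + 1) := hs.scale_mono (by omega)
    refine (dist_triangle w y z).trans ?_
    linarith
  calc ∫⁻ y in Q, squareVariation m a δ j f y ∂m
      = ∫⁻ y in Q, squareVariation m a δ j ((closedBall z R).indicator f) y ∂m :=
        setLIntegral_congr_fun hQm hcongr
    _ ≤ ∫⁻ y, squareVariation m a δ j ((closedBall z R).indicator f) y ∂m :=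
        setLIntegral_le_lintegral _ _
    _ ≤ C1 * ∫⁻ y, ‖(closedBall z R).indicator f y‖ₑ ^ 2 ∂m :=
        hC1 _ (hfm.indicator hSm) (hf.indicator hSm) j
    _ ≤ C1 * (B ^ 2 * m (closedBall z R)) := by
        refine mul_le_mul' le_rfl ?_
        rw [← setLIntegral_const, ← lintegral_indicator hSm]
        refine lintegral_mono fun y => ?_
        by_cases hy : y ∈ closedBall z R
        · rw [indicator_of_mem hy, indicator_of_mem hy]
          exact pow_le_pow_left₀ zero_le (hB y) 2
        · rw [indicator_of_notMem hy, indicator_of_notMem hy]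
          simp
    _ ≤ C1 * (B ^ 2 * (C2 * m Q)) := by
        refine mul_le_mul' le_rfl (mul_le_mul' le_rfl ?_)
        refine (hC2 z z r R hr ?_).trans (mul_le_mul' le_rfl (measure_mono hrQ))
        rw [dist_self, zero_add, hR, pow_succ]
        calc 6 * (a * (δ ^ j * δ)) = 6 * δ * (a * δ ^ j) := by ring
          _ ≤ 6 * δ * (δ ^ 2 * r) := by gcongr
          _ = _ := by ring
    _ = _ := by push_cast; ring

/-- The small scales of the short variation of a bounded function, for radii at least `r₀`. -/
lemma exists_shortVariation_sq_le (h : CoarseAnnular m r₀ ε K) (hδ : 1 < δ) :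
    ∃ C : ℝ≥0, ∀ f : G → ℂ, BallIntegrable m f → ∀ B : ℝ≥0∞, (∀ y, ‖f y‖ₑ ≤ B) → ∀ x,
      shortVariation m δ n₀ (Ici r₀) f x ^ 2 ≤
        (C * B) ^ 2 + ⨆ N, squareVariation m (δ ^ (n₀ + 2)) δ N f x := by
  have hr₀ := h.r₀_pos
  obtain ⟨C, -, hC⟩ := h.exists_qVariation_one_le (δ ^ (n₀ + 3) / r₀)
  refine ⟨2 * C, fun f hf B hB x => (shortVariation_sq_le (by linarith) (L := C * B)
    fun k hk => ?_).trans (add_le_add ?_ le_rfl)⟩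
  -- The cut at `r₀` makes doubling available, so the total variation over the initial scales is at
  -- most a multiple of `B`. Below `r₀` the ratio of masses of concentric balls is not controlled.
  · refine (qVariation_mono (J := Ico r₀ (δ ^ (n₀ + 3))) ?_ _).trans
      ((qVariation_two_le_one _ _).trans ((hC f hf x x r₀ (δ ^ (n₀ + 3)) (δ ^ (n₀ + 3)) le_rfl
        ?_ ?_).trans (mul_le_mul' le_rfl (ballLAverage_le fun y _ => hB y))))
    · intro s hs
      exact ⟨hs.2, hs.1.2.trans_le (zpow_le_zpow_right₀ hδ.le (by omega))⟩
    · rw [dist_self, zero_add]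
    · rw [dist_self, zero_add, div_mul_cancel₀ _ hr₀.ne']
  · calc 3 * (C * B : ℝ≥0∞) ^ 2 ≤ 4 * (C * B) ^ 2 := mul_le_mul' (by norm_num) le_rfl
      _ = _ := by push_cast; ring

/-- The scale of a dyadic cube relative to the scales of the short variation. -/
lemma DyadicSystem.exists_scale (hs : GoodScales a δ r₀) (haδ : δ * r₀ ≤ a) {c₀ C₀ : ℝ}
    (hδC : 18 * C₀ * δ⁻¹ ≤ c₀) (k : ℤ) : ∃ j : ℕ, 2 * C₀ * δ ^ k ≤ 5 * (a * δ ^ j) ∧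
      (j = 0 ∨ r₀ ≤ c₀ / 3 * δ ^ k ∧ a * δ ^ j ≤ δ ^ 2 * (c₀ / 3 * δ ^ k)) := by
  have hδ := hs.le_δ
  have hr₀ := hs.r₀_pos
  have hδ0 : 0 < δ := by linarith
  have ha := hs.a_pos
  -- The least such `j` is used. If it is positive, the failure at `j - 1` and `18 * C₀ ≤ c₀ * δ`
  -- bound the scale by the inner radius of the cube, which is then also at least `r₀`.
  have hex : ∃ j : ℕ, 2 * C₀ * δ ^ k ≤ 5 * (a * δ ^ j) := by
    obtain ⟨j, hj⟩ := pow_unbounded_of_one_lt (2 * C₀ * δ ^ k / (5 * a)) (by linarith : 1 < δ)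
    rw [div_lt_iff₀ (by positivity)] at hj
    exact ⟨j, by linarith⟩
  classical
  refine ⟨Nat.find hex, Nat.find_spec hex, ?_⟩
  rcases Nat.eq_zero_or_pos (Nat.find hex) with h0 | h0
  · exact .inl h0
  right
  obtain ⟨i, hi⟩ := Nat.exists_eq_add_of_le' h0
  have hmin := Nat.find_min hex (m := i) (by omega)
  rw [not_le] at hmin
  rw [hi]
  have hk : 0 < δ ^ k := zpow_pos hδ0 k
  have h1 : 18 * C₀ ≤ c₀ * δ := by
    rwa [← div_eq_mul_inv, div_le_iff₀ hδ0] at hδC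
  have h2 : 15 * (a * δ ^ i) ≤ δ * (c₀ / 3 * δ ^ k) := by
    nlinarith [mul_le_mul_of_nonneg_right h1 hk.le]
  have h3 : a ≤ a * δ ^ i := le_mul_of_one_le_right ha.le (one_le_pow₀ (by linarith))
  constructor
  · refine le_of_mul_le_mul_left ?_ hδ0
    linarith
  · calc a * δ ^ (i + 1) = δ * (a * δ ^ i) := by ring
      _ ≤ δ * (δ * (c₀ / 3 * δ ^ k)) :=
          mul_le_mul_of_nonneg_left (by linarith [mul_pos ha (pow_pos hδ0 i)]) hδ0.le
      _ = _ := by ring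

end

section

lemma ENNReal.enorm_toReal_sub_le {s t u : ℝ≥0∞} (hs : s ≠ ∞) (ht : t ≠ ∞) (h1 : s ≤ t + u)
    (h2 : t ≤ s + u) : ‖s.toReal - t.toReal‖ₑ ≤ u := by
  rcases eq_or_ne u ∞ with rfl | hu
  · exact le_top
  rw [Real.enorm_eq_ofReal_abs, ENNReal.ofReal_le_iff_le_toReal hu, abs_le]
  have h3 := ENNReal.toReal_mono (ENNReal.add_ne_top.2 ⟨ht, hu⟩) h1
  have h4 := ENNReal.toReal_mono (ENNReal.add_ne_top.2 ⟨hs, hu⟩) h2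
  rw [ENNReal.toReal_add ht hu] at h3
  rw [ENNReal.toReal_add hs hu] at h4
  constructor <;> linarith

variable {G : Type*} [MetricSpace G] [MeasurableSpace G] [OpensMeasurableSpace G]
variable {m : Measure G} {r₀ ε δ D : ℝ} {n₀ : ℤ} {K : ℝ}

/-- The oscillation of the short variation of a bounded function over dyadic cubes. -/
lemma exists_dyadicSharp_shortVariation_le [SecondCountableTopology G] [Nonempty G]
    (h : CoarseAnnular m r₀ ε K) (hδ : 18 ≤ δ) (hn₀ : r₀ ≤ δ ^ (n₀ + 1)) {c₀ C₀ : ℝ}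
    (hδC : 18 * C₀ * δ⁻¹ ≤ c₀) : ∃ C : ℝ≥0, ∀ f : G → ℂ, Measurable f →
      BallIntegrable m f → ∀ B : ℝ≥0∞, B ≠ ∞ → (∀ y, ‖f y‖ₑ ≤ B) →
      (∀ᵐ x ∂m, shortVariation m δ n₀ (Ici r₀) f x < ∞) →
      ∀ (𝒬 : DyadicSystem G c₀ C₀ δ) (x : G),
        dyadicSharp m 𝒬 (fun x => (shortVariation m δ n₀ (Ici r₀) f x).toReal) x ≤ C * B := by
  have hs := GoodScales.of_base h.r₀_pos hδ hn₀
  have hδ1 : 1 < δ := by linarith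
  have hδ0 : 0 < δ := by linarith
  have haδ : δ * r₀ ≤ δ ^ (n₀ + 2) := by
    rw [show n₀ + 2 = 1 + (n₀ + 1) by ring, zpow_add₀ hδ0.ne' 1, zpow_one]
    gcongr
  set a := δ ^ (n₀ + 2) with ha
  obtain ⟨C1, hC1⟩ := exists_tsum_scaleVariation_sq_le h hs
  obtain ⟨C2, hC2⟩ := exists_setLIntegral_squareVariation_le_of_bound h hs
  obtain ⟨C3, hC3⟩ := exists_shortVariation_sq_le (n₀ := n₀) h hδ1
  have hC2t : (C2 : ℝ≥0∞) ^ (1 / 2 : ℝ) ≠ ∞ :=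
    ENNReal.rpow_ne_top_of_nonneg (by norm_num) ENNReal.coe_ne_top
  refine ⟨C3 + C1 + ((C2 : ℝ≥0∞) ^ (1 / 2 : ℝ)).toNNReal, fun f hfm hf B hBt hB hfin 𝒬 x => ?_⟩
  push_cast
  rw [ENNReal.coe_toNNReal hC2t]
  refine iSup_le fun k => iSup_le fun z => iSup_le fun hz => iSup_le fun hx => ?_
  set Q := 𝒬.cube k z with hQ
  set F := shortVariation m δ n₀ (Ici r₀) f with hF
  have hQm : MeasurableSet Q := 𝒬.measurable k z hz
  rcases eq_or_ne (m Q) 0 with hQ0 | hQ0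
  · refine (iInf_le _ 0).trans ?_
    rw [Measure.restrict_eq_zero.2 hQ0, laverage_zero_measure]
    exact zero_le
  have hQt : m Q ≠ ∞ := ((measure_mono (𝒬.outer k z hz)).trans_lt (h.lt_top _ _)).ne
  obtain ⟨j, hj, hj'⟩ := DyadicSystem.exists_scale hs haδ hδC k
  have hQsub : Q ⊆ closedBall z (5 * (a * δ ^ j)) :=
    (𝒬.outer k z hz).trans (closedBall_subset_closedBall hj)
  -- The large scales, comparable to the cube and above, whose value at `z` will be the constant
  -- subtracted on `Q`.
  set T : G → ℝ≥0∞ := fun y => (∑' i, scaleVariation m a δ (i + j) f y ^ 2) ^ (1 / 2 : ℝ) with hT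
  have hsplit : ∀ y, ⨆ N, squareVariation m a δ N f y =
      squareVariation m a δ j f y + T y ^ 2 := fun y => by
    rw [iSup_squareVariation, hT, ENNReal.sqrt_sq]
    exact (Summable.sum_add_tsum_nat_add' (k := j) ENNReal.summable).symm
  have hTF : ∀ y, T y ≤ F y := fun y => by
    refine ENNReal.le_of_sq_le_sq (le_trans ?_ (iSup_squareVariation_le hδ1 hn₀ f y))
    rw [hsplit]
    exact le_add_self
  have hFT : ∀ y, F y ≤ T y + (C3 * B + squareVariation m a δ j f y ^ (1 / 2 : ℝ)) := fun y => by
    have h1 := ENNReal.rpow_le_rpow (hC3 f hf B hB y) (z := 1 / 2) (by norm_num)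
    rw [ENNReal.sq_rpow_half, hsplit] at h1
    refine (h1.trans (ENNReal.add_rpow_half_le _ _)).trans ?_
    refine (add_le_add le_rfl (ENNReal.add_rpow_half_le _ _)).trans ?_
    rw [ENNReal.sq_rpow_half, ENNReal.sq_rpow_half]
    exact le_of_eq (by ring)
  have hTyz : ∀ y ∈ Q, T y ≤ T z + C1 * B := fun y hy => by
    refine hC1 f hfm hf B hB j z y ?_
    rw [dist_comm]
    exact hQsub hy
  have hTzy : ∀ y ∈ Q, T z ≤ T y + C1 * B := fun y hy => hC1 f hfm hf B hB j y z (hQsub hy)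
  -- If `T z` were infinite, `T` and with it `F` would be infinite on all of `Q`, a set of positive
  -- measure.
  have hTz : T z ≠ ∞ := by
    intro hcon
    refine hQ0 (measure_mono_null ?_ (ae_iff.1 hfin))
    intro y hy
    have h1 := hTzy y hy
    rw [hcon, top_le_iff, ENNReal.add_eq_top] at h1
    have h2 : T y = ∞ := h1.resolve_right (ENNReal.mul_ne_top ENNReal.coe_ne_top hBt)
    have h3 := hTF y
    rw [h2, top_le_iff] at h3
    simp [h3]
  refine (iInf_le _ (T z).toReal).trans ?_
  have hSm := measurable_squareVariation h hs j hfm hf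
  rw [setLAverage_eq]
  refine ENNReal.div_le_of_le_mul ?_
  have hSl : ∫⁻ y in Q, squareVariation m a δ j f y ^ (1 / 2 : ℝ) ∂m ≤
      (C2 : ℝ≥0∞) ^ (1 / 2 : ℝ) * B * m Q := by
    refine ENNReal.le_of_sq_le_sq ((lintegral_sq_le_measure_mul _
      (hSm.pow_const _).aemeasurable).trans ?_)
    simp only [ENNReal.sqrt_sq, Measure.restrict_apply_univ]
    rw [mul_pow, mul_pow, ENNReal.sqrt_sq]
    have h1 : ∫⁻ y in Q, squareVariation m a δ j f y ∂m ≤ C2 * B ^ 2 * m Q := by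
      -- When `j = 0` the cube is smaller than every scale in use, and the sum over the scales below
      -- it is empty.
      rcases hj' with rfl | ⟨hj1, hj2⟩
      · simp [squareVariation]
      · exact hC2 f hfm hf B hB j z _ Q hQm hj1 hj2 (𝒬.inner k z hz) hQsub
    calc _ ≤ m Q * (C2 * B ^ 2 * m Q) := mul_le_mul' le_rfl h1
      _ = _ := by ring
  calc ∫⁻ y in Q, ‖(F y).toReal - (T z).toReal‖ₑ ∂m
      ≤ ∫⁻ y in Q, ((C3 * B + C1 * B) + squareVariation m a δ j f y ^ (1 / 2 : ℝ)) ∂m := by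
        refine lintegral_mono_ae ?_
        filter_upwards [ae_restrict_mem hQm, ae_restrict_of_ae hfin] with y hy hyf
        refine ENNReal.enorm_toReal_sub_le hyf.ne hTz ?_ ?_
        · refine (hFT y).trans ((add_le_add (hTyz y hy) le_rfl).trans (le_of_eq ?_))
          ring
        · refine (hTzy y hy).trans (add_le_add (hTF y) ?_)
          rw [add_assoc, add_left_comm]
          exact le_self_add
    _ = (C3 * B + C1 * B) * m Q +
        ∫⁻ y in Q, squareVariation m a δ j f y ^ (1 / 2 : ℝ) ∂m := by
        rw [lintegral_add_left measurable_const, setLIntegral_const]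
    _ ≤ (C3 * B + C1 * B) * m Q + (C2 : ℝ≥0∞) ^ (1 / 2 : ℝ) * B * m Q := add_le_add le_rfl hSl
    _ = _ := by ring

end

/-! ### Passage to `Lᵖ` classes and the final bounds. -/

section

variable {G : Type*} [MetricSpace G] [MeasurableSpace G] [OpensMeasurableSpace G]
variable {m : Measure G} {r₀ ε δ D : ℝ} {n₀ : ℤ} {K : ℝ}

lemma shortVariation_mono {I J : Set ℝ} (hIJ : I ⊆ J) (f : G → ℂ) (x : G) :
    shortVariation m δ n₀ I f x ≤ shortVariation m δ n₀ J f x := by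
  refine ENNReal.rpow_le_rpow (ENNReal.tsum_le_tsum fun n => ?_) (by norm_num)
  exact ENNReal.rpow_le_rpow (qVariation_mono (inter_subset_inter_right _ hIJ) _) (by norm_num)

/-- An essentially bounded function has a measurable representative with the same bound. -/
lemma MeasureTheory.MemLp.exists_measurable_enorm_le {f : G → ℂ} (hf : MemLp f ∞ m) :
    ∃ g : G → ℂ, Measurable g ∧ f =ᵐ[m] g ∧ ∀ y, ‖g y‖ₑ ≤ eLpNorm f ∞ m := by
  set u := hf.1.mk f with hu
  have hum : Measurable u := hf.1.stronglyMeasurable_mk.measurable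
  refine ⟨{y | ‖u y‖ₑ ≤ eLpNorm f ∞ m}.indicator u,
    hum.indicator (measurableSet_le hum.enorm measurable_const), ?_, fun y => ?_⟩
  · have h1 : ∀ᵐ y ∂m, ‖f y‖ₑ ≤ eLpNorm f ∞ m := by
      rw [eLpNorm_exponent_top]
      exact enorm_ae_le_eLpNormEssSup f m
    filter_upwards [hf.1.ae_eq_mk, h1] with y hy hy1
    rw [hy] at hy1
    rw [indicator_of_mem (s := {y | ‖u y‖ₑ ≤ eLpNorm f ∞ m}) hy1, hy]
  · by_cases hy : y ∈ {y | ‖u y‖ₑ ≤ eLpNorm f ∞ m}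
    · rw [indicator_of_mem hy]
      exact hy
    · rw [indicator_of_notMem hy]
      simp

section

variable [SecondCountableTopology G] [Nonempty G]
variable (h : CoarseAnnular m r₀ ε K)
include h

lemma aemeasurable_shortVariation_of_memLp (hδ : 0 < δ) {p : ℝ≥0∞} (hp : 1 ≤ p) {f : G → ℂ}
    (hf : MemLp f p m) : AEMeasurable (shortVariation m δ n₀ univ f) m := by
  have := h.sigmaFinite
  obtain ⟨g, hgm, hfg⟩ := hf.1.aemeasurable
  rw [shortVariation_congr_ae hfg univ]
  exact aemeasurable_shortVariation h.lt_top hδ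
    hgm ((hf.ae_eq hfg).ballIntegrable h.lt_top hp) (.inl rfl)

variable (hD : GeometricallyDoubling G D (4 * r₀)) (hδ : 18 ≤ δ) (hn₀ : r₀ ≤ δ ^ (n₀ + 1))
include hD hδ hn₀

/-- The strong type `(p, p)` bound for the short variation. -/
lemma exists_eLpNorm_shortVariation_le {p : ℝ} (hp : 1 < p) : ∃ C : ℝ≥0, ∀ f : G → ℂ,
    MemLp f (ENNReal.ofReal p) m →
    eLpNorm (shortVariation m δ n₀ univ f) (ENNReal.ofReal p) m ≤
      C * eLpNorm f (ENNReal.ofReal p) m := by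
  obtain ⟨C, hC⟩ := exists_lintegral_shortVariation_rpow_le h hD hδ hn₀ hp
  have hp0 : 0 < p := by linarith
  have hp1 : 1 ≤ ENNReal.ofReal p := by rw [ENNReal.one_le_ofReal]; exact hp.le
  refine ⟨C ^ (1 / p), fun f hf => ?_⟩
  obtain ⟨g, hgm, hfg⟩ := hf.1.aemeasurable
  have hb := (hf.ae_eq hfg).ballIntegrable h.lt_top hp1
  rw [eLpNorm_congr_ae hfg, shortVariation_congr_ae hfg univ]
  have hne : ENNReal.ofReal p ≠ 0 := (zero_lt_one.trans_le hp1).ne'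
  rw [eLpNorm_eq_lintegral_rpow_enorm_toReal hne ENNReal.ofReal_ne_top,
    eLpNorm_eq_lintegral_rpow_enorm_toReal hne ENNReal.ofReal_ne_top, ENNReal.toReal_ofReal hp0.le,
    ENNReal.coe_rpow_of_nonneg _ (by positivity), ← ENNReal.mul_rpow_of_nonneg _ _ (by positivity)]
  refine ENNReal.rpow_le_rpow ?_ (by positivity)
  simpa only [enorm_eq_self] using hC _ hgm hb

/-- The weak type `(1, 1)` bound for the short variation. -/
lemma exists_measure_shortVariation_le_eLpNorm : ∃ C : ℝ≥0, ∀ f : G → ℂ, MemLp f 1 m →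
    ∀ l : ℝ≥0, l ≠ 0 → l * m {x | l < shortVariation m δ n₀ univ f x} ≤ C * eLpNorm f 1 m := by
  obtain ⟨C, hC⟩ := exists_measure_shortVariation_le h hD hδ hn₀
  refine ⟨C, fun f hf l hl => ?_⟩
  obtain ⟨g, hgm, hfg⟩ := hf.1.aemeasurable
  rw [eLpNorm_congr_ae hfg, shortVariation_congr_ae hfg univ, eLpNorm_one_eq_lintegral_enorm]
  exact hC _ hgm
    ((hf.ae_eq hfg).ballIntegrable h.lt_top le_rfl) l hl

/-- The dyadic `BMO` bound for the short variation. -/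
lemma exists_dyadicBMONorm_shortVariation_le (τ : TopologicalSpace G)
    (hτ : ∀ S : Set G, @IsCompact G τ S → m S < ∞) {c₀ C₀ : ℝ} (hδC : 18 * C₀ * δ⁻¹ ≤ c₀) :
    ∃ C : ℝ≥0, ∀ (𝒬 : DyadicSystem G c₀ C₀ δ) (f : G → ℂ), MemLinftyCompact m τ f →
      (∀ᵐ x ∂m, shortVariation m δ n₀ (Ici r₀) f x < ∞) ∧
      IntegrableOnCompacts m τ (fun x => (shortVariation m δ n₀ (Ici r₀) f x).toReal) ∧
      dyadicBMONorm m 𝒬 (fun x => (shortVariation m δ n₀ (Ici r₀) f x).toReal) ≤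
        C * eLpNorm f ∞ m := by
  have hδ0 : 0 < δ := by linarith
  have := h.sigmaFinite
  obtain ⟨C1, hC1⟩ := exists_lintegral_shortVariation_rpow_le h hD hδ hn₀ one_lt_two
  obtain ⟨C2, hC2⟩ := exists_dyadicSharp_shortVariation_le h hδ hn₀ hδC
  refine ⟨C2, fun 𝒬 f ⟨hf, S, hS, hfS⟩ => ?_⟩
  obtain ⟨g, hgm, hfg, hgB⟩ := hf.exists_measurable_enorm_le
  have hB : eLpNorm f ∞ m ≠ ∞ := hf.2.ne
  set B := eLpNorm f ∞ m with hBdef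
  have hgb : BallIntegrable m g := (hf.ae_eq hfg).ballIntegrable h.lt_top le_top
  rw [shortVariation_congr_ae hfg (Ici r₀)]
  set F := shortVariation m δ n₀ (Ici r₀) g with hF
  have hFm : AEMeasurable F m := aemeasurable_shortVariation h.lt_top hδ0 hgm hgb (.inr ⟨r₀, rfl⟩)
  -- A set compact for `τ` need not be measurable, so it is replaced by a measurable hull of the
  -- same finite measure.
  have hg2 : ∫⁻ x, ‖g x‖ₑ ^ (2 : ℝ) ∂m ≠ ∞ := by
    refine ne_top_of_le_ne_top (b := B ^ 2 * m (toMeasurable m S)) ?_ ?_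
    · rw [measure_toMeasurable]
      exact ENNReal.mul_ne_top (ENNReal.pow_ne_top hB) (hτ S hS).ne
    · rw [← setLIntegral_const, ← lintegral_indicator (measurableSet_toMeasurable m S)]
      refine lintegral_mono_ae ?_
      filter_upwards [hfg, hfS] with x hx hxS
      by_cases hxT : x ∈ toMeasurable m S
      · rw [indicator_of_mem hxT, ENNReal.rpow_two]
        exact pow_le_pow_left₀ zero_le (hgB x) 2
      · rw [indicator_of_notMem hxT, ← hx, hxS fun hc => hxT (subset_toMeasurable m S hc)]
        simp
  -- The `L²` bound yields both finiteness almost everywhere and, by Cauchy–Schwarz, integrability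
  -- on compact sets.
  have hF2 : ∫⁻ x, F x ^ 2 ∂m ≠ ∞ := by
    refine ne_top_of_le_ne_top (ENNReal.mul_ne_top ENNReal.coe_ne_top hg2)
      ((lintegral_mono fun x => ?_).trans (hC1 g hgm hgb))
    rw [ENNReal.rpow_two]
    exact pow_le_pow_left₀ zero_le (shortVariation_mono (subset_univ _) g x) 2
  have hfin : ∀ᵐ x ∂m, F x < ∞ := by
    filter_upwards [ae_lt_top' (hFm.pow_const 2) hF2] with x hx
    exact (ENNReal.pow_lt_top_iff.1 hx).resolve_right two_ne_zero
  refine ⟨hfin, fun T hT => ?_, essSup_le_of_ae_le _ (.of_forall (hC2 g hgm hgb B hB hgB hfin 𝒬))⟩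
  refine integrable_toReal_of_lintegral_ne_top hFm.restrict ?_
  have h1 := lintegral_sq_le_measure_mul (m.restrict T) hFm.restrict
  rw [Measure.restrict_apply_univ] at h1
  have h2 : m T * ∫⁻ x in T, F x ^ 2 ∂m ≠ ∞ :=
    ENNReal.mul_ne_top (hτ T hT).ne (ne_top_of_le_ne_top hF2 (setLIntegral_le_lintegral _ _))
  intro hcon
  rw [hcon] at h1
  exact h2 (top_le_iff.1 (by simpa using h1))

end

end

end

end

/-- The metric structure on `G` is the metric `d`; the locally compact group topology of `G` is `τ`,
which need not be the topology of `d` and enters only through compact sets. The strong and weak type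
bounds are for all radii in `⋃_{n ≥ n₀} [δ ^ n, δ ^ (n + 1))`, the `BMO` bound for those that are at
least `r₀`. -/
theorem theorem1p5 {G : Type*} [Group G] [MetricSpace G] [MeasurableSpace G]
    [OpensMeasurableSpace G] (m : Measure G)
    (τ : TopologicalSpace G) (hτ : @IsTopologicalGroup G τ _) (hlc : @LocallyCompactSpace G τ)
    (hball : ∀ (h : G) (r : ℝ), m (Metric.closedBall h r) < ∞)
    (hcompact : ∀ K : Set G, @IsCompact G τ K → m K < ∞)
    (r₀ ε D₀ : ℝ) (hr₀ : 0 < r₀) (hε : 0 < ε) (hε1 : ε ≤ 1)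
    (hdecay : AnnularDecay m ε r₀) (hdoubling : GeometricallyDoubling G D₀ (4 * r₀))
    (c₀ C₀ δ : ℝ) (hc₀ : 0 < c₀) (hcC : c₀ < C₀) (hδ : 1 < δ) (hδC : 18 * C₀ * δ⁻¹ ≤ c₀)
    (n₀ : ℤ) (hn₀ : δ ^ n₀ < r₀) (hn₀' : r₀ ≤ δ ^ (n₀ + 1)) :
    (∀ p : ℝ, 1 < p → ∃ c : ℝ, 0 < c ∧ ∀ f : G → ℂ, MemLp f (ENNReal.ofReal p) m →
      AEMeasurable (shortVariation m δ n₀ Set.univ f) m ∧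
      eLpNorm (shortVariation m δ n₀ Set.univ f) (ENNReal.ofReal p) m ≤
        ENNReal.ofReal c * eLpNorm f (ENNReal.ofReal p) m) ∧
    ∃ c : ℝ, 0 < c ∧
      (∀ f : G → ℂ, MemLp f 1 m →
        AEMeasurable (shortVariation m δ n₀ Set.univ f) m ∧
        ∀ γ : ℝ, 0 < γ →
          m {g | ENNReal.ofReal γ < shortVariation m δ n₀ Set.univ f g} ≤
            ENNReal.ofReal (c / γ) * eLpNorm f 1 m) ∧
      ∀ (𝒬 : DyadicSystem G c₀ C₀ δ) (f : G → ℂ), MemLinftyCompact m τ f →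
        (∀ᵐ x ∂m, shortVariation m δ n₀ (Set.Ici r₀) f x < ∞) ∧
        MemDyadicBMO m 𝒬 τ (fun x => (shortVariation m δ n₀ (Set.Ici r₀) f x).toReal) ∧
        dyadicBMONorm m 𝒬 (fun x => (shortVariation m δ n₀ (Set.Ici r₀) f x).toReal) ≤
          ENNReal.ofReal c * eLpNorm f ∞ m := by
  have hδ0 : 0 < δ := by linarith
  -- From `18 * C₀ ≤ c₀ * δ` and `c₀ < C₀`. This separation of scales is what the cube construction
  -- requires.
  have hδ18 : 18 ≤ δ := by
    rw [← div_eq_mul_inv, div_le_iff₀ hδ0] at hδC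
    have h1 : c₀ * 18 ≤ c₀ * δ := by linarith
    exact le_of_mul_le_mul_left h1 hc₀
  -- The zero measure is set apart because for it the positivity of balls of radius at least `r₀`
  -- fails.
  rcases eq_or_ne m 0 with rfl | hm0
  · refine ⟨fun p _ => ⟨1, one_pos, fun f _ => ⟨aemeasurable_zero_measure, by simp⟩⟩, 1, one_pos,
      fun f _ => ⟨aemeasurable_zero_measure, fun γ _ => by simp⟩, fun 𝒬 f _ => ?_⟩
    refine ⟨by simp, ⟨fun T _ => ?_, ?_⟩, ?_⟩
    · rw [IntegrableOn, Measure.restrict_zero]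
      exact integrable_zero_measure
    · simp [dyadicBMONorm]
    · simp [dyadicBMONorm]
  have : Nonempty G := by
    by_contra hG
    rw [not_nonempty_iff] at hG
    exact hm0 (Measure.eq_zero_of_isEmpty m)
  obtain ⟨K, h⟩ := hdecay.exists_coarseAnnular hr₀ hε hε1 hball hm0
  have := h.secondCountableTopology hdoubling
  refine ⟨fun p hp => ?_, ?_⟩
  · obtain ⟨C, hC⟩ := exists_eLpNorm_shortVariation_le h hdoubling hδ18 hn₀' hp
    refine ⟨C + 1, by positivity, fun f hf => ⟨aemeasurable_shortVariation_of_memLp h hδ0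
      (by rw [ENNReal.one_le_ofReal]; exact hp.le) hf, (hC f hf).trans (mul_le_mul' ?_ le_rfl)⟩⟩
    rw [← ENNReal.ofReal_coe_nnreal]
    exact ENNReal.ofReal_le_ofReal (by linarith)
  · obtain ⟨C1, hC1⟩ := exists_measure_shortVariation_le_eLpNorm h hdoubling hδ18 hn₀'
    obtain ⟨C2, hC2⟩ := exists_dyadicBMONorm_shortVariation_le h hdoubling hδ18 hn₀' τ hcompact hδC
    refine ⟨C1 + C2 + 1, by positivity, fun f hf => ⟨aemeasurable_shortVariation_of_memLp h hδ0
      le_rfl hf, fun γ hγ => ?_⟩, fun 𝒬 f hf => ?_⟩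
    · have h1 := hC1 f hf γ.toNNReal (Real.toNNReal_pos.2 hγ).ne'
      have hγ0 : ENNReal.ofReal γ ≠ 0 := (ENNReal.ofReal_pos.2 hγ).ne'
      rw [ENNReal.ofReal_div_of_pos hγ, ← ENNReal.mul_div_right_comm,
        ENNReal.le_div_iff_mul_le (.inl hγ0) (.inl ENNReal.ofReal_ne_top), mul_comm]
      refine h1.trans (mul_le_mul' ?_ le_rfl)
      rw [← ENNReal.ofReal_coe_nnreal]
      exact ENNReal.ofReal_le_ofReal (by linarith [C2.coe_nonneg])
    · obtain ⟨h1, h2, h3⟩ := hC2 𝒬 f hf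
      refine ⟨h1, ⟨h2, h3.trans_lt (ENNReal.mul_lt_top ENNReal.coe_lt_top hf.1.2)⟩,
        h3.trans (mul_le_mul' ?_ le_rfl)⟩
      rw [← ENNReal.ofReal_coe_nnreal]
      exact ENNReal.ofReal_le_ofReal (by linarith [C1.coe_nonneg])
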